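/- Notation. An $n$-mode system has Hilbert space $L^2(\mathbb R^n)$ and quadratures $\hat R=(\hat x_1,\hat p_1,\dots,\hat x_n,\hat p_n)$, with $\hat x_j$ multiplication by $x_j$ and $\hat p_j=-i\partial_j$; $\Omega_n=\mathbb 1_n\otimes\begin{pmatrix}0&1\\-1&0\end{pmatrix}$, and $S\in\mathbb R^{2n\times 2n}$ is symplectic if $S\Omega_nS^{\intercal}=\Omega_n$. The unitary generated by a Hamiltonian $\hat H$, a polynomial in the quadratures that is essentially self-adjoint on the Schwartz functions, is $e^{-i\hat H}$ ($\hat H$ also denoting the closure). A Gaussian unitary is a composition of unitaries generated by quadratic Hamiltonians $\frac12(\hat R-\mathbf m)^{\intercal}h(\hat R-\mathbf m)$, with $h$ real symmetric and $\mathbf m\in\mathbb R^{2n}$. A symplectic unitary $U_S$ associated with a symplectic matrix $S$ is a Gaussian unitary with $U_S^\dagger\hat R\,U_S=S\hat R$ on Schwartz functions (it is unique up to a phase); it is passive if $S$ is also orthogonal. The displacement operator is $\hat D_{\mathbf r}=e^{-i\mathbf r^{\intercal}\Omega_n\hat R}$. A $\kappa$-local unitary is one generated by a Hamiltonian that is a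 (noncommutative) polynomial in at most $\kappa$ of the $2n$ quadratures. A $(t,\kappa)$-doped Gaussian unitary is a product $U=G_tW_t\cdots G_1W_1G_0$ with Gaussian unitaries $G_i$ and (possibly non-Gaussian) $\kappa$-local unitaries $W_i$; a $(t,\kappa)$-doped Gaussian state vector is $U|0\rangle^{\otimes n}$ with such a $U$, where $|0\rangle^{\otimes n}$ is the vacuum $\pi^{-n/4}e^{-|x|^2/2}$. If $\psi$ is a unit vector with finite second moments (it lies in the domain of every $\hat R_k$), then $\mathbf m(\psi)_k=\langle\psi,\hat R_k\psi\rangle$ and $V(\psi)_{kl}=\langle\psi,\{\hat R_k-\mathbf m(\psi)_k,\hat R_l-\mathbf m(\psi)_l\}\psi\rangle$ (read as a quadratic form). Theorem. Let $n,\kappa,t\in\mathbb N$ with $\kappa t\le n$. (1) For every $n$-mode $(t,\kappa)$-doped Gaussian unitary $U$ there are a Gaussian unitary $G$, a passive Gaussian unitary $G_{\mathrm{passive}}$ and a unitary $u_{\kappa t}$ on the first $\kappa t$ modes with $$U=G\,(u_{\kappa t}\otimes\mathbb 1_{n-\kappa t})\,G_{\mathrm{passive}}.$$ (2) For every $n$-mode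 $(t,\kappa)$-doped Gaussian state vector $|\psi\rangle$ there are a Gaussian unitary $G$ and a $\kappa t$-mode state vector $|\phi\rangle$ with $$|\psi\rangle=G\big(|\phi\rangle\otimes|0\rangle^{\otimes(n-\kappa t)}\big).$$ (3) Suppose in addition that $\psi$ has finite second moments. Then $V(\psi)$ has a Williamson decomposition $V(\psi)=S\,\mathrm{diag}(d_1,d_1,\dots,d_n,d_n)\,S^{\intercal}$ with $S$ symplectic, all $d_j\ge1$, and $d_j=1$ for $j>\kappa t$. Moreover, for every decomposition $V(\psi)=S(D\oplus I_{2(n-\kappa t)})S^{\intercal}$ with $S$ symplectic and $D$ a $2\kappa t\times2\kappa t$ diagonal matrix, a symplectic unitary $U_S$ exists, and for each choice of it the operator $\hat D_{\mathbf m(\psi)}U_S$ is a Gaussian unitary and there is a $\kappa t$-mode state vector $|\varphi\rangle$ with $$|\psi\rangle=\hat D_{\mathbf m(\psi)}U_S\big(|\varphi\rangle\otimes|0\rangle^{\otimes(n-\kappa t)}\big).$$ -/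

import Mathlib

open MeasureTheory SchwartzMap
open scoped InnerProductSpace LineDeriv Matrix Kronecker

noncomputable section

namespace Bosonic

/-! ### The Hilbert space of `n` modes and its quadrature operators -/

/-- The Hilbert space `L²(ℝⁿ)` of `n` modes. -/
abbrev Modes (n : ℕ) : Type := Lp ℂ 2 (volume : Measure (EuclideanSpace ℝ (Fin n)))

/-- The `n`-mode unitaries; the group law is composition. -/
abbrev ModeUnitary (n : ℕ) : Type := Modes n ≃ₗᵢ[ℂ] Modes n

/-- The Schwartz functions on `ℝⁿ`, the common invariant core of all polynomials in the
quadratures. -/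
abbrev Core (n : ℕ) : Type := 𝓢(EuclideanSpace ℝ (Fin n), ℂ)

/-- The inclusion of the Schwartz functions in `L²(ℝⁿ)`. -/
def coreIncl (n : ℕ) : Core n →ₗ[ℂ] Modes n :=
  (SchwartzMap.toLpCLM ℂ ℂ 2 (volume : Measure (EuclideanSpace ℝ (Fin n)))).toLinearMap

theorem coreIncl_injective (n : ℕ) : Function.Injective (coreIncl n) :=
  SchwartzMap.injective_toLp 2 (volume : Measure (EuclideanSpace ℝ (Fin n)))

/-- Quadratures are indexed by a mode and by `0` (position) or `1` (momentum); in the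
lexicographic order they are `x₁, p₁, …, xₙ, pₙ`. -/
abbrev QIdx (n : ℕ) : Type := Fin n × Fin 2

/-- The position operator `f ↦ x_j f` on Schwartz functions. -/
def position {n : ℕ} (j : Fin n) : Module.End ℂ (Core n) :=
  (SchwartzMap.smulLeftCLM ℂ
    (fun x : EuclideanSpace ℝ (Fin n) => ((x j : ℝ) : ℂ))).toLinearMap

/-- The momentum operator `f ↦ -i ∂_j f` on Schwartz functions. -/
def momentum {n : ℕ} (j : Fin n) : Module.End ℂ (Core n) :=
  (-Complex.I) • (LineDeriv.lineDerivOpCLM ℂ (Core n)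
    (EuclideanSpace.single j (1 : ℝ))).toLinearMap

theorem position_apply {n : ℕ} (j : Fin n) (f : Core n) (x : EuclideanSpace ℝ (Fin n)) :
    position j f x = ((x j : ℝ) : ℂ) * f x := by
  have h : Function.HasTemperateGrowth
      (fun x : EuclideanSpace ℝ (Fin n) => ((x j : ℝ) : ℂ)) :=
    (Complex.ofRealCLM.comp (EuclideanSpace.proj j :
      EuclideanSpace ℝ (Fin n) →L[ℝ] ℝ)).hasTemperateGrowth
  exact SchwartzMap.smulLeftCLM_apply_apply h f x

theorem momentum_apply {n : ℕ} (j : Fin n) (f : Core n) (x : EuclideanSpace ℝ (Fin n)) :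
    momentum j f x = -Complex.I * lineDeriv ℝ f x (EuclideanSpace.single j 1) := by
  rw [← SchwartzMap.lineDerivOp_apply]
  rfl

/-- The quadrature `R_k` on Schwartz functions. -/
def quad {n : ℕ} (k : QIdx n) : Module.End ℂ (Core n) :=
  if k.2 = 0 then position k.1 else momentum k.1

/-- An operator on Schwartz functions as an unbounded operator on `L²(ℝⁿ)` with the Schwartz
functions as domain. -/
def unbounded {n : ℕ} (P : Module.End ℂ (Core n)) : Modes n →ₗ.[ℂ] Modes n where
  domain := LinearMap.range (coreIncl n)
  toFun := coreIncl n ∘ₗ P ∘ₗ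
    (LinearEquiv.ofInjective (coreIncl n) (coreIncl_injective n)).symm.toLinearMap

theorem unbounded_apply {n : ℕ} (P : Module.End ℂ (Core n)) (f : Core n) :
    unbounded P ⟨coreIncl n f, LinearMap.mem_range_self _ f⟩ = coreIncl n (P f) := by
  have h : (LinearEquiv.ofInjective (coreIncl n) (coreIncl_injective n)).symm
      ⟨coreIncl n f, LinearMap.mem_range_self _ f⟩ = f :=
    (LinearEquiv.symm_apply_eq _).2 rfl
  exact congrArg (fun g => coreIncl n (P g)) h

/-- The closure of `P`, initially defined on Schwartz functions. -/
def closedOp {n : ℕ} (P : Module.End ℂ (Core n)) : Modes n →ₗ.[ℂ] Modes n :=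
  (unbounded P).closure

/-! ### Unitaries generated by Hamiltonians -/

/-- `W = exp (-i A)` for a self-adjoint operator `A`: `W` is the value at time `1` of the strongly
continuous one-parameter unitary group `U s = exp (-i s A)`, which solves the Schrödinger equation
on the domain of `A`. -/
def IsExp {n : ℕ} (A : Modes n →ₗ.[ℂ] Modes n) (W : ModeUnitary n) : Prop :=
  IsSelfAdjoint A ∧
  ∃ U : ℝ → ModeUnitary n,
    U 0 = 1 ∧ (∀ s s', U (s + s') = U s * U s') ∧ (∀ v, Continuous fun s => U s v) ∧
    (∀ v : A.domain, HasDerivAt (fun s => U s v) (-Complex.I • A v) 0) ∧ U 1 = W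

/-- `W` is the unitary `exp (-i H)` generated by the Hamiltonian `H`, given by its action on
Schwartz functions and essentially self-adjoint there (that is, its closure is self-adjoint). -/
def IsGeneratedBy {n : ℕ} (H : Module.End ℂ (Core n)) (W : ModeUnitary n) : Prop :=
  IsExp (closedOp H) W

/-- The quadratic Hamiltonian `½ (R - m)ᵀ h (R - m)`. -/
def quadraticHam {n : ℕ} (h : Matrix (QIdx n) (QIdx n) ℝ) (m : QIdx n → ℝ) :
    Module.End ℂ (Core n) :=
  (1 / 2 : ℂ) • ∑ k, ∑ l, ((h k l : ℝ) : ℂ) •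
    ((quad k - ((m k : ℝ) : ℂ) • 1) * (quad l - ((m l : ℝ) : ℂ) • 1))

/-- A Gaussian unitary: a composition of unitaries generated by quadratic Hamiltonians. -/
def IsGaussian {n : ℕ} (G : ModeUnitary n) : Prop :=
  G ∈ Submonoid.closure {W : ModeUnitary n |
    ∃ (h : Matrix (QIdx n) (QIdx n) ℝ) (m : QIdx n → ℝ),
      h.IsSymm ∧ IsGeneratedBy (quadraticHam h m) W}

/-- A `κ`-local unitary: generated by a Hamiltonian which is a (noncommutative) polynomial in at
most `κ` of the quadratures. -/
def IsLocal {n : ℕ} (κ : ℕ) (W : ModeUnitary n) : Prop :=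
  ∃ (μ : Fin κ → QIdx n) (P : FreeAlgebra ℂ (Fin κ)),
    IsGeneratedBy (FreeAlgebra.lift ℂ (fun r => quad (μ r)) P) W

/-- `IsDoped κ t U`: the unitary `U = G_t W_t ⋯ G_1 W_1 G_0` is `(t, κ)`-doped Gaussian. -/
inductive IsDoped {n : ℕ} (κ : ℕ) : ℕ → ModeUnitary n → Prop
  | zero (G : ModeUnitary n) : IsGaussian G → IsDoped κ 0 G
  | succ (t : ℕ) (U W G : ModeUnitary n) :
      IsDoped κ t U → IsLocal κ W → IsGaussian G → IsDoped κ (t + 1) (G * W * U)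

/-! ### Symplectic unitaries and displacements -/

/-- The symplectic form `Ω = 𝟙ₙ ⊗ (0 1; -1 0)`. -/
def Omega (n : ℕ) : Matrix (QIdx n) (QIdx n) ℝ :=
  (1 : Matrix (Fin n) (Fin n) ℝ) ⊗ₖ !![0, 1; -1, 0]

/-- Symplectic matrices. -/
def IsSymplectic {n : ℕ} (S : Matrix (QIdx n) (QIdx n) ℝ) : Prop :=
  S * Omega n * Sᵀ = Omega n

/-- `U` is a symplectic unitary `U_S` associated with `S` (unique up to a global phase): a Gaussian
unitary with `U† R_k U = ∑ l, S k l R_l`, as operators on Schwartz functions. -/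
def IsSymplecticUnitary {n : ℕ} (S : Matrix (QIdx n) (QIdx n) ℝ) (U : ModeUnitary n) : Prop :=
  IsGaussian U ∧ ∀ f : Core n, ∃ g : Core n, coreIncl n g = U (coreIncl n f) ∧
    ∀ k, coreIncl n (quad k g) = U (coreIncl n (∑ l, ((S k l : ℝ) : ℂ) • quad l f))

/-- Passive Gaussian unitaries: symplectic unitaries of orthogonal symplectic matrices. -/
def IsPassive {n : ℕ} (U : ModeUnitary n) : Prop :=
  ∃ O : Matrix (QIdx n) (QIdx n) ℝ,
    IsSymplectic O ∧ O ∈ Matrix.orthogonalGroup (QIdx n) ℝ ∧ IsSymplecticUnitary O U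

/-- `D` is the displacement operator `exp (-i rᵀ Ω R)`. -/
def IsDisplacement {n : ℕ} (r : QIdx n → ℝ) (D : ModeUnitary n) : Prop :=
  IsGeneratedBy (∑ k, ∑ l, ((r k * Omega n k l : ℝ) : ℂ) • quad l) D

/-! ### First moments and covariance matrix of a state vector -/

/-- The quadrature `R_k` as a closed operator on `L²(ℝⁿ)`. -/
def quadOp {n : ℕ} (k : QIdx n) : Modes n →ₗ.[ℂ] Modes n := closedOp (quad k)

/-- `ψ` has finite second moments: every quadrature observable has a finite second moment. -/
def FiniteSecondMoments {n : ℕ} (ψ : Modes n) : Prop := ∀ k, ψ ∈ (quadOp (n := n) k).domain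

/-- The first moment, `m_k = ⟨ψ, R_k ψ⟩`. -/
def firstMoment {n : ℕ} (ψ : Modes n) (hψ : FiniteSecondMoments ψ) (k : QIdx n) : ℝ :=
  (⟪ψ, quadOp k ⟨ψ, hψ k⟩⟫_ℂ).re

/-- The vector `(R_k - m_k) ψ`. -/
def centred {n : ℕ} (ψ : Modes n) (hψ : FiniteSecondMoments ψ) (k : QIdx n) : Modes n :=
  quadOp k ⟨ψ, hψ k⟩ - ((firstMoment ψ hψ k : ℝ) : ℂ) • ψ

/-- The covariance matrix, `V_{kl} = ⟨ψ, {R_k - m_k, R_l - m_l} ψ⟩`, read as a quadratic form. -/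
def covariance {n : ℕ} (ψ : Modes n) (hψ : FiniteSecondMoments ψ) :
    Matrix (QIdx n) (QIdx n) ℝ :=
  Matrix.of fun k l => (⟪centred ψ hψ k, centred ψ hψ l⟫_ℂ + ⟪centred ψ hψ l, centred ψ hψ k⟫_ℂ).re

/-! ### Tensor products and the vacuum -/

/-- The first `k` coordinates. -/
def firstModes {k n : ℕ} (h : k ≤ n) (x : EuclideanSpace ℝ (Fin n)) : EuclideanSpace ℝ (Fin k) :=
  WithLp.toLp 2 fun i => x (Fin.castLE h i)

/-- The last `n - k` coordinates. -/
def lastModes {k n : ℕ} (h : k ≤ n) (x : EuclideanSpace ℝ (Fin n)) :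
    EuclideanSpace ℝ (Fin (n - k)) :=
  WithLp.toLp 2 fun i => x ⟨k + i, by omega⟩

theorem measurePreserving_splitModes {k n : ℕ} (h : k ≤ n) :
    MeasurePreserving (fun x => (firstModes h x, lastModes h x)) volume
      ((volume : Measure (EuclideanSpace ℝ (Fin k))).prod
        (volume : Measure (EuclideanSpace ℝ (Fin (n - k))))) := by
  let e : Fin k ⊕ Fin (n - k) ≃ Fin n :=
    finSumFinEquiv.trans (finCongr (Nat.add_sub_cancel' h))
  have h1 := PiLp.volume_preserving_ofLp (Fin n)
  have h2 := (volume_measurePreserving_piCongrLeft (fun _ : Fin n => ℝ) e).symm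
  have h3 := volume_measurePreserving_sumPiEquivProdPi (fun _ : Fin k ⊕ Fin (n - k) => ℝ)
  have h4 := (PiLp.volume_preserving_toLp (Fin k)).prod (PiLp.volume_preserving_toLp (Fin (n - k)))
  exact h4.comp (h3.comp (h2.comp h1))

theorem memLp_tensor {k n : ℕ} (h : k ≤ n) (φ : Modes k) (χ : Modes (n - k)) :
    MemLp (fun x => φ (firstModes h x) * χ (lastModes h x)) 2
      (volume : Measure (EuclideanSpace ℝ (Fin n))) := by
  have hm : MemLp (fun z : EuclideanSpace ℝ (Fin k) × EuclideanSpace ℝ (Fin (n - k)) =>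
      φ z.1 * χ z.2) 2 (volume.prod volume) := by
    have hφ := Lp.memLp φ
    have hχ := Lp.memLp χ
    refine (memLp_two_iff_integrable_sq_norm
      (hφ.aestronglyMeasurable.comp_fst.mul hχ.aestronglyMeasurable.comp_snd)).2 ?_
    have hi := ((memLp_two_iff_integrable_sq_norm hφ.aestronglyMeasurable).1 hφ).mul_prod
      ((memLp_two_iff_integrable_sq_norm hχ.aestronglyMeasurable).1 hχ)
    simpa [mul_pow] using hi
  exact hm.comp_measurePreserving (measurePreserving_splitModes h)

/-- `φ ⊗ χ`, with `φ` on the first `k` modes and `χ` on the last `n - k` modes. -/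
def tensor {k n : ℕ} (h : k ≤ n) (φ : Modes k) (χ : Modes (n - k)) : Modes n :=
  (memLp_tensor h φ χ).toLp _

/-- `T = u ⊗ 𝟙`, with `u` acting on the first `k` modes. -/
def IsAmplification {k n : ℕ} (h : k ≤ n) (u : ModeUnitary k) (T : ModeUnitary n) : Prop :=
  ∀ φ χ, T (tensor h φ χ) = tensor h (u φ) χ

/-- The wave function of the vacuum. -/
def vacuumFun (n : ℕ) (x : EuclideanSpace ℝ (Fin n)) : ℂ :=
  ((Real.pi ^ (-(n : ℝ) / 4) * Real.exp (-‖x‖ ^ 2 / 2) : ℝ) : ℂ)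

theorem memLp_vacuumFun (n : ℕ) :
    MemLp (vacuumFun n) 2 (volume : Measure (EuclideanSpace ℝ (Fin n))) := by
  have hc : Continuous (vacuumFun n) := by unfold vacuumFun; fun_prop
  rw [memLp_two_iff_integrable_sq_norm hc.aestronglyMeasurable]
  have hi := (GaussianFourier.integrable_cexp_neg_mul_sq_norm_add
    (V := EuclideanSpace ℝ (Fin n)) (b := 1) (by simp) 0 0).norm.const_mul
      ((Real.pi ^ (-(n : ℝ) / 4)) ^ 2)
  refine hi.congr (Filter.Eventually.of_forall fun x => ?_)
  have hr : Real.exp (-‖x‖ ^ 2) = Real.exp (-‖x‖ ^ 2 / 2) ^ 2 := by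
    rw [← Real.exp_nat_mul]; congr 1; push_cast; ring
  simp only [vacuumFun, Complex.norm_real, Real.norm_eq_abs, sq_abs, mul_pow, Complex.norm_exp]
  rw [← hr]
  simp [← Complex.ofReal_pow]

/-- The vacuum `|0⟩^{⊗ n}`. -/
def vacuum (n : ℕ) : Modes n := (memLp_vacuumFun n).toLp _

/-- `(t, κ)`-doped Gaussian state vectors. -/
def IsDopedState {n : ℕ} (κ t : ℕ) (ψ : Modes n) : Prop :=
  ∃ U : ModeUnitary n, IsDoped κ t U ∧ ψ = U (vacuum n)

end Bosonic

end

open Bosonic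

noncomputable section

namespace Bosonic

/-! ### Unitaries preserving the Schwartz functions -/

/-! Write `W_ξ = exp (i ∑ ξ_k R_k)` for the Weyl operators. The structure of a doped unitary is read
off from how its factors move them. A Gaussian unitary sends `W_ξ` to a phase times `W_{Aξ}` with
`A` symplectic (`IsGaussian.exists_normalizesWeyl`). A local unitary commutes with every `W_ζ` whose
shift `Ω ζ` vanishes on the `κ` quadratures of its Hamiltonian (`IsLocal.exists_commute`). Moving
all Gaussian factors to the left gives `U = F B`, with `F` Gaussian and `B` commuting with `W_ξ` for
all `ξ` orthogonal to a set `s` of at most `κ t` vectors (`IsDoped.exists_factorization`). The span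
of `s` and `Ω s` is `Ω`-invariant of dimension at most `2 κ t`, so an orthogonal symplectic matrix
moves it into the first `κ t` modes (`exists_orthogonal_symplectic`). After conjugation by the
corresponding passive unitary, `B` commutes with all Weyl operators of the remaining modes, and such
an operator has the form `u ⊗ 1` (`CommutesLast.exists_amplification`).

For states, a passive unitary keeps the vacuum annihilated by every `x_j + i p_j`
(`weakVac_passive`), and a vector annihilated by these operators on the last modes is `φ ⊗ |0⟩`
(`WeakVac.exists_tensor`).

For the covariance matrix `V`, the Gaussian unitary carries the annihilation operators of the last
modes to centred linear forms killing `ψ` (`exists_annihilating`). Real and imaginary parts of this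
say that `V` has symplectic eigenvalue `1` there (`covariance_mulVec_of_annihilating`), and the
pairs found are completed to a Williamson basis (`exists_williamson`). The squared norm of the
centred annihilation operator of mode `j` on `ψ` is `d_j - 1` (`inner_annihilation`): hence `d_j ≥
1`. Conversely, in any decomposition `d_j = 1` forces annihilation, and undoing the displacement and
`U_S` leaves the vacuum on the last modes (`weakVac_of_williamson`).

Two analytic points support this. Unitaries are not assumed to preserve Schwartz functions, so
commutation is proved on domains of closures (`IsGeneratedBy.commute_lift`), and Gaussian evolution
through explicit short-time Gaussian solutions and uniqueness for the Schrödinger equation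
(`IsFlow.normalizesWeyl_small`). Symplectic unitaries exist because shears generate the symplectic
group (`IsSymplectic.induction`) and are realised by quadratic phases in position or in momentum
(`exists_intertwines`). -/

theorem denseRange_coreIncl (n : ℕ) : DenseRange (coreIncl n) :=
  SchwartzMap.denseRange_toLpCLM (F := ℂ) (p := 2)
    (μ := (volume : Measure (EuclideanSpace ℝ (Fin n)))) (by simp)

theorem modeUnitary_ext {n : ℕ} {U W : ModeUnitary n}
    (h : ∀ f, U (coreIncl n f) = W (coreIncl n f)) : U = W := by
  refine LinearIsometryEquiv.ext fun v => ?_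
  exact congrFun ((denseRange_coreIncl n).equalizer U.continuous W.continuous (funext h)) v

/-- The linear automorphisms of the Schwartz functions that preserve the `L²` norm. -/
def coreUnitary (n : ℕ) : Subgroup (Core n ≃ₗ[ℂ] Core n) where
  carrier := {e | ∀ f, ‖coreIncl n (e f)‖ = ‖coreIncl n f‖}
  mul_mem' := fun {a b} ha hb f => by
    rw [LinearEquiv.mul_apply, ha, hb]
  one_mem' := fun f => rfl
  inv_mem' := fun {a} ha f => by
    rw [← ha (a⁻¹ f), ← LinearEquiv.mul_apply, mul_inv_cancel]; rfl

/-- The extension to `L²` of an isometric automorphism of the Schwartz functions. -/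
def extendCore {n : ℕ} (e : Core n ≃ₗ[ℂ] Core n) (he : ∀ f, ‖coreIncl n (e f)‖ = ‖coreIncl n f‖) :
    ModeUnitary n :=
  e.extendOfIsometry (coreIncl n) (coreIncl n) (denseRange_coreIncl n) (denseRange_coreIncl n) he

theorem extendCore_apply {n : ℕ} (e : Core n ≃ₗ[ℂ] Core n)
    (he : ∀ f, ‖coreIncl n (e f)‖ = ‖coreIncl n f‖) (f : Core n) :
    extendCore e he (coreIncl n f) = coreIncl n (e f) :=
  LinearEquiv.extendOfIsometry_eq e (coreIncl n) (coreIncl n) (denseRange_coreIncl n)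
    (denseRange_coreIncl n) he f

/-- The unitary extending an element of `coreUnitary`. -/
def lift {n : ℕ} : coreUnitary n →* ModeUnitary n where
  toFun e := extendCore e.1 fun f => e.2 f
  map_one' := modeUnitary_ext fun f => extendCore_apply _ _ f
  map_mul' a b := modeUnitary_ext fun f => by
    rw [extendCore_apply]
    show _ = extendCore a.1 _ (extendCore b.1 _ (coreIncl n f))
    rw [extendCore_apply, extendCore_apply]
    rfl

theorem mul_apply' {n : ℕ} (U W : ModeUnitary n) (v : Modes n) : (U * W) v = U (W v) := rfl

theorem inv_apply_self' {n : ℕ} (U : ModeUnitary n) (v : Modes n) : U⁻¹ (U v) = v :=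
  U.symm_apply_apply v

theorem apply_inv_self' {n : ℕ} (U : ModeUnitary n) (v : Modes n) : U (U⁻¹ v) = v :=
  U.apply_symm_apply v

theorem inner_inv_left {n : ℕ} (U : ModeUnitary n) (v w : Modes n) :
    ⟪U⁻¹ v, w⟫_ℂ = ⟪v, U w⟫_ℂ := by
  rw [← U.inner_map_map (U⁻¹ v) w, apply_inv_self']

theorem inner_inv_right {n : ℕ} (U : ModeUnitary n) (v w : Modes n) :
    ⟪v, U⁻¹ w⟫_ℂ = ⟪U v, w⟫_ℂ := by
  rw [← U.inner_map_map v (U⁻¹ w), apply_inv_self']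

@[simp]
theorem lift_apply {n : ℕ} (e : coreUnitary n) (f : Core n) :
    lift e (coreIncl n f) = coreIncl n (e.1 f) :=
  extendCore_apply e.1 (fun f => e.2 f) f

theorem eq_zero_of_inner_core {n : ℕ} {v : Modes n} (h : ∀ f, ⟪v, coreIncl n f⟫_ℂ = 0) :
    v = 0 := by
  have : ∀ w, ⟪v, w⟫_ℂ = 0 := fun w => congrFun ((denseRange_coreIncl n).equalizer
    (g := fun w => ⟪v, w⟫_ℂ) (h := fun _ => 0) (by fun_prop) (by fun_prop) (funext h)) w
  exact inner_self_eq_zero.1 (this v)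

/-! ### Differentiating unitary families -/

/-- The product rule survives without norm continuity of `U`: each `U r` is an isometry, so the
remainder of `y` keeps its size, and continuity is needed only on the single vector `y'`. -/
theorem hasDerivAt_unitary_apply {n : ℕ} {U : ℝ → ModeUnitary n} {y : ℝ → Modes n}
    {y' w : Modes n} {s : ℝ} (hy : HasDerivAt y y' s)
    (hU : HasDerivAt (fun r => U r (y s)) w s) (hc : ContinuousAt (fun r => U r y') s) :
    HasDerivAt (fun r => U r (y r)) (w + U s y') s := by
  rw [hasDerivAt_iff_isLittleO] at hy hU ⊢
  have h1 : (fun r => U r (y r - y s - (r - s) • y')) =o[nhds s] fun r => r - s :=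
    (Asymptotics.IsBigO.of_bound 1 (Filter.Eventually.of_forall fun r => by
      rw [(U r).norm_map, one_mul])).trans_isLittleO hy
  have h2 : (fun r => (r - s) • (U r y' - U s y')) =o[nhds s] fun r => r - s := by
    have := (Asymptotics.isBigO_refl (fun r : ℝ => r - s) (nhds s)).smul_isLittleO
      ((Asymptotics.isLittleO_one_iff ℝ).2 (tendsto_sub_nhds_zero_iff.2 hc))
    simpa using this
  refine ((hU.add h1).add h2).congr_left fun r => ?_
  have e : U r (y r - y s - (r - s) • y') = U r (y r) - U r (y s) - (r - s) • U r y' := by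
    rw [map_sub, map_sub]
    congr 1
    exact (U r).toLinearIsometry.toLinearMap.map_smul_of_tower (r - s) y'
  rw [e, smul_sub, smul_add]
  abel

/-- `U` is a one-parameter unitary group whose generator extends `H`. -/
structure IsFlow {n : ℕ} (H : Module.End ℂ (Core n)) (U : ℝ → ModeUnitary n) : Prop where
  zero : U 0 = 1
  add : ∀ s s', U (s + s') = U s * U s'
  deriv_zero : ∀ f, HasDerivAt (fun s => U s (coreIncl n f)) (-Complex.I • coreIncl n (H f)) 0

theorem IsFlow.mul_neg {n : ℕ} {H : Module.End ℂ (Core n)} {U : ℝ → ModeUnitary n}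
    (h : IsFlow H U) (s : ℝ) : U (-s) = (U s)⁻¹ := by
  rw [eq_inv_iff_mul_eq_one, ← h.add, neg_add_cancel, h.zero]

/-- The group law `U r = U s * U (r - s)` carries the derivative from `0` to `s`. With `U s` on the
outside, the flow need not preserve the Schwartz functions. -/
theorem IsFlow.hasDerivAt {n : ℕ} {H : Module.End ℂ (Core n)} {U : ℝ → ModeUnitary n}
    (h : IsFlow H U) (f : Core n) (s : ℝ) :
    HasDerivAt (fun s => U s (coreIncl n f)) (U s (-Complex.I • coreIncl n (H f))) s := by
  have h1 := (h.deriv_zero f).scomp_of_eq (x := s) (h := fun r => r - s)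
    ((hasDerivAt_id s).sub_const s) (by simp)
  have h2 := ((U s).toContinuousLinearEquiv.toContinuousLinearMap.restrictScalars
    ℝ).hasFDerivAt.comp_hasDerivAt s h1
  simp only [one_smul] at h2
  refine h2.congr_of_eventuallyEq (Filter.Eventually.of_forall fun r => ?_)
  show _ = (U s) (U (r - s) (coreIncl n f))
  rw [← mul_apply', ← h.add, add_sub_cancel]

theorem continuous_unitary_of_core {n : ℕ} {U : ℝ → ModeUnitary n}
    (h : ∀ f, Continuous fun s => U s (coreIncl n f)) (v : Modes n) :
    Continuous fun s => U s v := by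
  refine continuous_iff_continuousAt.2 fun s => ?_
  rw [Metric.continuousAt_iff']
  intro ε hε
  obtain ⟨f, hf⟩ := Metric.denseRange_iff.1 (denseRange_coreIncl n) v (ε / 3) (by positivity)
  filter_upwards [Metric.continuousAt_iff'.1 (h f).continuousAt (ε / 3) (by positivity)] with r hr
  calc dist (U r v) (U s v) ≤ dist (U r v) (U r (coreIncl n f))
      + dist (U r (coreIncl n f)) (U s (coreIncl n f)) + dist (U s (coreIncl n f)) (U s v) :=
        dist_triangle4 _ _ _ _
    _ < ε / 3 + ε / 3 + ε / 3 := by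
        rw [LinearIsometryEquiv.dist_map, LinearIsometryEquiv.dist_map, dist_comm _ v]
        gcongr
    _ = ε := by ring

theorem IsFlow.continuous {n : ℕ} {H : Module.End ℂ (Core n)} {U : ℝ → ModeUnitary n}
    (h : IsFlow H U) (v : Modes n) : Continuous fun s => U s v :=
  continuous_unitary_of_core (fun f => continuous_iff_continuousAt.2 fun s =>
    (h.hasDerivAt f s).continuousAt) v

/-- A curve of Schwartz functions solving the Schrödinger equation follows the flow. -/
theorem IsFlow.eq_of_curve {n : ℕ} {H : Module.End ℂ (Core n)} {U : ℝ → ModeUnitary n}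
    (h : IsFlow H U) {g : ℝ → Core n} {ε : ℝ}
    (hg : ∀ s ∈ Set.Ioo (-ε) ε,
      HasDerivAt (fun s => coreIncl n (g s)) (-Complex.I • coreIncl n (H (g s))) s)
    {s : ℝ} (hs : s ∈ Set.Ioo (-ε) ε) : coreIncl n (g s) = U s (coreIncl n (g 0)) := by
  have h0 : (0 : ℝ) ∈ Set.Ioo (-ε) ε := ⟨by linarith [hs.1, hs.2], by linarith [hs.1, hs.2]⟩
  -- The curve is pulled back by the flow; the two contributions to the derivative cancel, so the
  -- pulled-back curve is constant.
  have hd : ∀ r ∈ Set.Ioo (-ε) ε,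
      HasDerivAt (fun r => U (-r) (coreIncl n (g r))) 0 r := by
    intro r hr
    have h1 := ((h.hasDerivAt (g r) (-r)).scomp (h := fun r => -r) r (hasDerivAt_neg r))
    have h2 := hasDerivAt_unitary_apply (U := fun r => U (-r)) (hg r hr) h1
      ((h.continuous _).comp continuous_neg).continuousAt
    convert h2 using 1
    simp
  have hc : ∀ r ∈ Set.Ioo (-ε) ε, HasFDerivAt (𝕜 := ℝ) (fun r => U (-r) (coreIncl n (g r)))
      (0 : ℝ →L[ℝ] Modes n) r := fun r hr => by
    simpa using (hd r hr).hasFDerivAt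
  have := (convex_Ioo (-ε) ε).is_const_of_fderivWithin_eq_zero (𝕜 := ℝ)
    (f := fun r => U (-r) (coreIncl n (g r)))
    (fun r hr => (hc r hr).differentiableAt.differentiableWithinAt)
    (fun r hr => by
      rw [fderivWithin_of_isOpen isOpen_Ioo hr]; exact (hc r hr).fderiv) h0 hs
  simp only [neg_zero, h.zero] at this
  rw [h.mul_neg] at this
  have := congrArg (U s) this
  rw [apply_inv_self'] at this
  exact this.symm

/-! ### Generators of one-parameter groups preserving the Schwartz functions -/

/-- The graph of an operator on Schwartz functions. -/
def coreGraph {n : ℕ} (H : Module.End ℂ (Core n)) : Submodule ℂ (Modes n × Modes n) :=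
  LinearMap.range ((coreIncl n).prod (coreIncl n ∘ₗ H))

theorem graph_unbounded {n : ℕ} (H : Module.End ℂ (Core n)) :
    (unbounded H).graph = coreGraph H := by
  ext ⟨v, w⟩
  rw [LinearPMap.mem_graph_iff, coreGraph, LinearMap.mem_range]
  constructor
  · rintro ⟨⟨_, f, rfl⟩, rfl, rfl⟩
    exact ⟨f, Prod.ext rfl (unbounded_apply H f).symm⟩
  · rintro ⟨f, hf⟩
    exact ⟨⟨coreIncl n f, f, rfl⟩, congrArg Prod.fst hf,
      (unbounded_apply H f).trans (congrArg Prod.snd hf)⟩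

theorem mem_graph_closedOp_core {n : ℕ} (H : Module.End ℂ (Core n)) (f : Core n) :
    (coreIncl n f, coreIncl n (H f)) ∈ (closedOp H).graph :=
  LinearPMap.le_graph_of_le (LinearPMap.le_closure _) (by
    rw [graph_unbounded]; exact ⟨f, rfl⟩)

theorem dense_domain_closedOp {n : ℕ} (H : Module.End ℂ (Core n)) :
    Dense ((closedOp H).domain : Set (Modes n)) :=
  (denseRange_coreIncl n).mono (by
    rintro _ ⟨f, rfl⟩
    exact LinearPMap.mem_domain_of_mem_graph (mem_graph_closedOp_core H f))

theorem graph_closedOp {n : ℕ} {H : Module.End ℂ (Core n)} (h : (unbounded H).IsClosable) :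
    (closedOp H).graph = (coreGraph H).topologicalClosure := by
  rw [closedOp, ← h.graph_closure_eq_closure_graph, graph_unbounded]

/-- Symmetric operators. -/
def IsSymm {n : ℕ} (H : Module.End ℂ (Core n)) : Prop :=
  ∀ f g, ⟪coreIncl n (H f), coreIncl n g⟫_ℂ = ⟪coreIncl n f, coreIncl n (H g)⟫_ℂ

/-- A symmetric operator is contained in its adjoint, which is closed. -/
theorem IsSymm.isClosable {n : ℕ} {H : Module.End ℂ (Core n)} (h : IsSymm H) :
    (unbounded H).IsClosable := by
  have hd : Dense ((unbounded H).domain : Set (Modes n)) := denseRange_coreIncl n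
  refine LinearPMap.isClosable_iff_exists_closed_extension.2
    ⟨(unbounded H).adjoint, LinearPMap.adjoint_isClosed hd, ?_⟩
  refine LinearPMap.IsFormalAdjoint.le_adjoint hd ?_
  rintro ⟨_, f, rfl⟩ ⟨_, g, rfl⟩
  rw [unbounded_apply, unbounded_apply]
  exact h f g

/-- The `closure` of a non-closable operator is by convention the operator itself. Self-adjoint
operators are closed, so this default value is excluded. -/
theorem isClosable_of_isSelfAdjoint {n : ℕ} {H : Module.End ℂ (Core n)}
    (h : IsSelfAdjoint (closedOp H)) : (unbounded H).IsClosable := by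
  by_contra hc
  have := h.isClosed
  rw [closedOp, LinearPMap.closure_def' hc] at this
  exact hc this.isClosable

/-- Properties that hold on the graph of `H` and are closed hold on the graph of its closure. -/
theorem closedOp_induction {n : ℕ} {H : Module.End ℂ (Core n)} (h : (unbounded H).IsClosable)
    {p : Modes n → Modes n → Prop} (hp : IsClosed {z : Modes n × Modes n | p z.1 z.2})
    (hc : ∀ f, p (coreIncl n f) (coreIncl n (H f))) (v : (closedOp H).domain) :
    p v (closedOp H v) := by
  have hv : ((v : Modes n), closedOp H v) ∈ (closedOp H).graph := LinearPMap.mem_graph _ v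
  rw [graph_closedOp h] at hv
  have : closure (coreGraph H : Set (Modes n × Modes n)) ⊆ {z | p z.1 z.2} :=
    closure_minimal (by rintro _ ⟨f, rfl⟩; exact hc f) hp
  exact this hv

/-- The inner product of two orbits is constant; its derivative at `0` is the defect of symmetry. -/
theorem IsFlow.isSymm {n : ℕ} {H : Module.End ℂ (Core n)} {U : ℝ → ModeUnitary n}
    (h : IsFlow H U) : IsSymm H := by
  intro f g
  have h1 := (h.deriv_zero f).inner ℂ (h.deriv_zero g)
  have h2 : HasDerivAt (fun s => ⟪U s (coreIncl n f), U s (coreIncl n g)⟫_ℂ) 0 0 := by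
    simp only [LinearIsometryEquiv.inner_map_map]
    exact hasDerivAt_const _ _
  have := h1.unique h2
  simp only [h.zero, inner_smul_left, inner_smul_right, map_neg, Complex.conj_I, neg_neg] at this
  change -Complex.I * ⟪coreIncl n f, coreIncl n (H g)⟫_ℂ
    + Complex.I * ⟪coreIncl n (H f), coreIncl n g⟫_ℂ = 0 at this
  have h3 : Complex.I * (⟪coreIncl n (H f), coreIncl n g⟫_ℂ
    - ⟪coreIncl n f, coreIncl n (H g)⟫_ℂ) = 0 := by linear_combination this
  exact sub_eq_zero.1 ((mul_eq_zero.1 h3).resolve_left Complex.I_ne_zero)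

/-- The orbit has speed of constant norm, so the mean value inequality applies. Being a closed
condition on the graph, the bound later passes to the closure of `H`. -/
theorem norm_sub_le_of_flow {n : ℕ} {H : Module.End ℂ (Core n)} {U : ℝ → ModeUnitary n}
    (h : IsFlow H U) (s : ℝ) (f : Core n) :
    ‖U s (coreIncl n f) - coreIncl n f‖ ≤ |s| * ‖coreIncl n (H f)‖ := by
  have := convex_univ.norm_image_sub_le_of_norm_hasDerivWithin_le (𝕜 := ℝ)
    (f := fun s => U s (coreIncl n f)) (x := 0) (y := s)
    (C := ‖coreIncl n (H f)‖) (fun r _ => (h.hasDerivAt f r).hasDerivWithinAt)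
    (fun r _ => by simp [norm_smul]) (Set.mem_univ _)
    (Set.mem_univ _)
  simp only [h.zero, sub_zero, Real.norm_eq_abs] at this
  rw [mul_comm]
  exact this

/-- A one-parameter unitary group is differentiable on the domain of the closure of its
generator on Schwartz functions. -/
theorem IsFlow.hasDerivAt_closedOp {n : ℕ} {H : Module.End ℂ (Core n)} {U : ℝ → ModeUnitary n}
    (h : IsFlow H U) (v : (closedOp H).domain) :
    HasDerivAt (fun s => U s v) (-Complex.I • closedOp H v) 0 := by
  have hcl := h.isSymm.isClosable
  have hlip : ∀ s, ‖U s (v : Modes n) - v‖ ≤ |s| * ‖closedOp H v‖ := by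
    intro s
    refine closedOp_induction hcl (p := fun v w => ‖U s v - v‖ ≤ |s| * ‖w‖) ?_
      (fun f => norm_sub_le_of_flow h s f) v
    exact isClosed_le (by fun_prop) (by fun_prop)
  have hlip' : ∀ (f : Core n) (s : ℝ), ‖U s ((v : Modes n) - coreIncl n f)
      - (v - coreIncl n f)‖ ≤ |s| * ‖closedOp H v - coreIncl n (H f)‖ := by
    intro f s
    refine closedOp_induction hcl (p := fun v w => ‖U s (v - coreIncl n f)
      - (v - coreIncl n f)‖ ≤ |s| * ‖w - coreIncl n (H f)‖) ?_ (fun g => ?_) v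
    · exact isClosed_le (by fun_prop) (by fun_prop)
    · simpa only [map_sub] using norm_sub_le_of_flow h s (g - f)
  rw [hasDerivAt_iff_isLittleO, Asymptotics.isLittleO_iff]
  intro c hc
  have hv : ((v : Modes n), closedOp H v) ∈ (closedOp H).graph := LinearPMap.mem_graph _ v
  rw [graph_closedOp hcl] at hv
  obtain ⟨_, ⟨f, rfl⟩, hf⟩ := Metric.mem_closure_iff.1 hv (c / 3) (by positivity)
  have hf2 : ‖closedOp H v - coreIncl n (H f)‖ ≤ c / 3 := by
    rw [← dist_eq_norm]; exact (le_max_right _ _).trans hf.le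
  have h1 := (Asymptotics.isLittleO_iff.1 (hasDerivAt_iff_isLittleO.1 (h.deriv_zero f)))
    (c := c / 3) (by positivity)
  filter_upwards [h1] with s hs
  simp only [h.zero, sub_zero, Real.norm_eq_abs] at hs ⊢
  -- The error splits into the displacement of `v - f`, the first-order error at the core vector
  -- `f`, and the mismatch of the derivatives; each is at most `|s| c / 3`.
  have e : U s (v : Modes n) - (1 : ModeUnitary n) v - s • (-Complex.I • closedOp H v)
      = (U s ((v : Modes n) - coreIncl n f) - (v - coreIncl n f))
        + (U s (coreIncl n f) - (1 : ModeUnitary n) (coreIncl n f)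
            - s • (-Complex.I • coreIncl n (H f)))
        - s • (-Complex.I • (closedOp H v - coreIncl n (H f))) := by
    rw [map_sub, smul_sub, smul_sub]
    show _ - (v : Modes n) - _ = _ - _ - _ + (_ - coreIncl n f - _) - _
    abel
  rw [e]
  refine (norm_sub_le _ _).trans ?_
  have h4 : ‖s • (-Complex.I • (closedOp H v - coreIncl n (H f)))‖
      = |s| * ‖closedOp H v - coreIncl n (H f)‖ := by simp [norm_smul]
  have h5 := norm_add_le (U s ((v : Modes n) - coreIncl n f) - (v - coreIncl n f))
    (U s (coreIncl n f) - (1 : ModeUnitary n) (coreIncl n f)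
            - s • (-Complex.I • coreIncl n (H f)))
  have h6 := hlip' f s
  have h7 : |s| * ‖closedOp H v - coreIncl n (H f)‖ ≤ |s| * (c / 3) := by gcongr
  rw [h4]
  nlinarith

/-- The deficiency spaces of a generator preserving the Schwartz functions are trivial. -/
theorem eq_zero_of_deficiency {n : ℕ} {H : Module.End ℂ (Core n)} {e : ℝ → coreUnitary n}
    (h : IsFlow H fun s => lift (e s)) {c : ℝ} (hc : c = 1 ∨ c = -1) {v : Modes n}
    (hv : ∀ f, ⟪v, -Complex.I • coreIncl n (H f)⟫_ℂ = c * ⟪v, coreIncl n f⟫_ℂ) : v = 0 := by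
  refine eq_zero_of_inner_core fun f => ?_
  set k : ℝ → ℂ := fun s => ⟪v, lift (e s) (coreIncl n f)⟫_ℂ with hk
  have hder : ∀ s, HasDerivAt k (c * k s) s := by
    intro s
    have h1 := h.hasDerivAt f s
    have h2 := (hasDerivAt_const s v).inner ℂ h1
    -- Invariance of the Schwartz functions enters here: differentiating the orbit in two ways shows
    -- that `H` commutes with the flow.
    have h3 : lift (e s) (-Complex.I • coreIncl n (H f))
        = -Complex.I • coreIncl n (H ((e s).1 f)) := by
      have h4 := h1
      have h5 : HasDerivAt (fun r => lift (e r) (coreIncl n f))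
          (-Complex.I • coreIncl n (H ((e s).1 f))) s := by
        have h6 := (h.deriv_zero ((e s).1 f)).scomp_of_eq (x := s) (h := fun r => r - s)
          ((hasDerivAt_id s).sub_const s) (by simp)
        simp only [one_smul] at h6
        refine h6.congr_of_eventuallyEq (Filter.Eventually.of_forall fun r => ?_)
        show lift (e r) _ = lift (e (r - s)) _
        rw [← lift_apply, ← mul_apply']
        have := h.add (r - s) s
        simp only [sub_add_cancel] at this
        rw [this]
      exact h1.unique h5
    rw [h3] at h2
    have h7 : ⟪v, -Complex.I • coreIncl n (H ((e s).1 f))⟫_ℂ = c * k s := by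
      rw [hv, hk]; simp only [lift_apply]
    rw [h7, inner_zero_left, add_zero] at h2
    exact h2
  have hexp : ∀ s, k s = k 0 * Real.exp (c * s) := by
    intro s
    have hd : ∀ r, HasDerivAt (fun r : ℝ => k r * Real.exp (-(c * r))) 0 r := by
      intro r
      have h1 : HasDerivAt (fun r : ℝ => (Real.exp (-(c * r)) : ℂ))
          ((Real.exp (-(c * r)) * (-c) : ℝ) : ℂ) r := by
        have := (((hasDerivAt_id r).const_mul c).neg).exp
        simp only [id, mul_one] at this
        exact this.ofReal_comp
      refine ((hder r).mul h1).congr_deriv ?_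
      push_cast; ring
    have := is_const_of_deriv_eq_zero (fun r => (hd r).differentiableAt)
      (fun r => (hd r).deriv) s 0
    simp only [mul_zero, neg_zero, Real.exp_zero, Complex.ofReal_one, mul_one] at this
    rw [← this, mul_assoc, ← Complex.ofReal_mul, ← Real.exp_add]
    simp
  have hb : ∀ s, ‖k 0‖ * Real.exp (c * s) ≤ ‖v‖ * ‖coreIncl n f‖ := by
    intro s
    have := norm_inner_le_norm (𝕜 := ℂ) v (lift (e s) (coreIncl n f))
    rw [LinearIsometryEquiv.norm_map] at this
    change ‖k s‖ ≤ _ at this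
    rwa [hexp, norm_mul, Complex.norm_real, Real.norm_eq_abs, Real.abs_exp] at this
  have hcc : c * c = 1 := by rcases hc with rfl | rfl <;> norm_num
  have hk0 : k 0 = 0 := by
    by_contra hne
    have hpos : 0 < ‖k 0‖ := norm_pos_iff.2 hne
    -- At this time the exponent is the bound divided by `‖k 0‖`, and `exp x ≥ x + 1` exceeds what
    -- boundedness of `k` allows.
    have h1 := hb (c * (‖v‖ * ‖coreIncl n f‖ / ‖k 0‖))
    rw [← mul_assoc, hcc, one_mul] at h1
    have h2 := Real.add_one_le_exp (‖v‖ * ‖coreIncl n f‖ / ‖k 0‖)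
    have h3 : ‖k 0‖ * (‖v‖ * ‖coreIncl n f‖ / ‖k 0‖ + 1) ≤ ‖v‖ * ‖coreIncl n f‖ :=
      (mul_le_mul_of_nonneg_left h2 hpos.le).trans h1
    rw [mul_add, mul_div_cancel₀ _ hpos.ne'] at h3
    linarith
  simp only [hk, h.zero] at hk0
  exact hk0

/-- Both deficiency spaces are trivial because the group preserves the core. One of them makes the
closure plus `i` surjective, the other shows that the adjoint does not extend the closure properly.
-/
theorem IsFlow.isSelfAdjoint {n : ℕ} {H : Module.End ℂ (Core n)} {e : ℝ → coreUnitary n}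
    (h : IsFlow H fun s => lift (e s)) : IsSelfAdjoint (closedOp H) := by
  have hs := h.isSymm
  have hcl := hs.isClosable
  have hd := dense_domain_closedOp H
  have hcore : ∀ f, ∃ v : (closedOp H).domain, (v : Modes n) = coreIncl n f ∧
      closedOp H v = coreIncl n (H f) := fun f =>
    (LinearPMap.mem_graph_iff _).1 (mem_graph_closedOp_core H f)
  have hsym : ∀ (v : (closedOp H).domain) (f : Core n),
      ⟪closedOp H v, coreIncl n f⟫_ℂ = ⟪(v : Modes n), coreIncl n (H f)⟫_ℂ := by
    intro v f
    exact closedOp_induction hcl (p := fun v w => ⟪w, coreIncl n f⟫_ℂ = ⟪v, coreIncl n (H f)⟫_ℂ)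
      (isClosed_eq (by fun_prop) (by fun_prop)) (fun g => hs g f) v
  have hsym2 : ∀ v w : (closedOp H).domain,
      ⟪closedOp H v, (w : Modes n)⟫_ℂ = ⟪(v : Modes n), closedOp H w⟫_ℂ := by
    intro v w
    exact closedOp_induction hcl
      (p := fun w z => ⟪closedOp H v, w⟫_ℂ = ⟪(v : Modes n), z⟫_ℂ)
      (isClosed_eq (by fun_prop) (by fun_prop)) (fun g => hsym v g) w
  -- `H + i` has dense range
  have hrange : ∀ y : Modes n, ∃ u : (closedOp H).domain,
      closedOp H u + Complex.I • (u : Modes n) = y := by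
    intro y
    let B : Core n →ₗ[ℂ] Modes n := coreIncl n ∘ₗ H + Complex.I • coreIncl n
    have hnorm : ∀ f, ‖coreIncl n f‖ ≤ ‖B f‖ ∧ ‖coreIncl n (H f)‖ ≤ ‖B f‖ := by
      intro f
      -- By symmetry the cross term is purely imaginary. Hence `H + i` controls the graph norm, and
      -- a convergent sequence in its range comes from a convergent sequence in the graph.
      have h0 : ‖B f‖ ^ 2 = ‖coreIncl n (H f)‖ ^ 2 + ‖coreIncl n f‖ ^ 2 := by
        show ‖coreIncl n (H f) + Complex.I • coreIncl n f‖ ^ 2 = _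
        rw [@norm_add_sq ℂ]
        have : (⟪coreIncl n (H f), Complex.I • coreIncl n f⟫_ℂ).re = 0 := by
          rw [inner_smul_right]
          have : (starRingEnd ℂ) ⟪coreIncl n (H f), coreIncl n f⟫_ℂ
              = ⟪coreIncl n (H f), coreIncl n f⟫_ℂ := by rw [inner_conj_symm, hs]
          have := Complex.conj_eq_iff_im.1 this
          simp [this]
        simp [this, norm_smul]
      constructor <;> refine le_of_sq_le_sq ?_ (norm_nonneg _) <;> nlinarith [sq_nonneg ‖coreIncl n f‖, sq_nonneg ‖coreIncl n (H f)‖]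
    have hdense : Dense (LinearMap.range B : Set (Modes n)) := by
      rw [Submodule.dense_iff_topologicalClosure_eq_top,
        Submodule.topologicalClosure_eq_top_iff, Submodule.eq_bot_iff]
      intro v hv
      refine eq_zero_of_deficiency h (c := -1) (Or.inr rfl) fun f => ?_
      have h1 := hv (B f) ⟨f, rfl⟩
      rw [← inner_conj_symm, map_eq_zero] at h1
      change ⟪v, coreIncl n (H f) + Complex.I • coreIncl n f⟫_ℂ = 0 at h1
      rw [inner_add_right, inner_smul_right] at h1
      rw [inner_smul_right]
      have := Complex.I_mul_I
      push_cast
      linear_combination (-Complex.I) * h1 + ⟪v, coreIncl n f⟫_ℂ * this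
    obtain ⟨x, hx, hxy⟩ := mem_closure_iff_seq_limit.1 (hdense y)
    choose f hf using hx
    have hcauchy := hxy.cauchySeq
    have hB : ∀ i j, x i - x j = B (f i - f j) := fun i j => by rw [map_sub, hf, hf]
    have c1 : CauchySeq fun i => coreIncl n (f i) := by
      refine Metric.cauchySeq_iff'.2 fun ε hε => ?_
      obtain ⟨N, hN⟩ := Metric.cauchySeq_iff'.1 hcauchy ε hε
      refine ⟨N, fun i hi => lt_of_le_of_lt ?_ (hN i hi)⟩
      rw [dist_eq_norm, dist_eq_norm, hB, ← map_sub]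
      exact (hnorm _).1
    obtain ⟨u, hu⟩ := cauchySeq_tendsto_of_complete c1
    have hw : Filter.Tendsto (fun i => coreIncl n (H (f i))) Filter.atTop
        (nhds (y - Complex.I • u)) := by
      refine (hxy.sub (hu.const_smul Complex.I)).congr fun i => ?_
      rw [← hf i]
      show coreIncl n (H (f i)) + Complex.I • coreIncl n (f i) - _ = _
      rw [add_sub_cancel_right]
    have hmem : (u, y - Complex.I • u) ∈ (closedOp H).graph := by
      rw [graph_closedOp hcl]
      exact mem_closure_of_tendsto (hu.prodMk_nhds hw)
        (Filter.Eventually.of_forall fun i => ⟨f i, rfl⟩)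
    obtain ⟨u', h1, h2⟩ := (LinearPMap.mem_graph_iff _).1 hmem
    exact ⟨u', by rw [h1, h2]; simp⟩
  rw [LinearPMap.isSelfAdjoint_def]
  refine le_antisymm ?_ (LinearPMap.IsFormalAdjoint.le_adjoint hd fun v w => hsym2 v w)
  refine LinearPMap.le_of_le_graph ?_
  rintro ⟨v, w⟩ hvw
  obtain ⟨v', rfl, rfl⟩ := (LinearPMap.mem_graph_iff _).1 hvw
  -- With `u` in the domain of the closure solving `(H + i) u = (H* + i) v'`, the difference `v' -
  -- u` lies in a deficiency space, hence vanishes.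
  obtain ⟨u, hu⟩ := hrange ((closedOp H).adjoint v' + Complex.I • (v' : Modes n))
  have hadj : ∀ f, ⟪(closedOp H).adjoint v', coreIncl n f⟫_ℂ
      = ⟪(v' : Modes n), coreIncl n (H f)⟫_ℂ := by
    intro f
    obtain ⟨z, hz, hz'⟩ := hcore f
    rw [← hz, ← hz']
    exact LinearPMap.adjoint_isFormalAdjoint hd v' z
  have hzero : (v' : Modes n) - u = 0 := by
    refine eq_zero_of_deficiency h (c := 1) (Or.inl rfl) fun f => ?_
    have h1 := hadj f
    have h2 := hsym u f
    have h3 : (closedOp H).adjoint v' = closedOp H u + Complex.I • (u : Modes n)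
        - Complex.I • (v' : Modes n) := by rw [hu]; simp
    rw [h3, inner_sub_left, inner_add_left, h2, inner_smul_left, inner_smul_left,
      Complex.conj_I] at h1
    rw [inner_smul_right, inner_sub_left, inner_sub_left]
    have := Complex.I_mul_I
    push_cast
    linear_combination (Complex.I) * h1 + (⟪(u : Modes n), coreIncl n f⟫_ℂ - ⟪(v' : Modes n), coreIncl n f⟫_ℂ) * this
  have hvu : (v' : Modes n) = u := sub_eq_zero.1 hzero
  have hval : (closedOp H).adjoint v' = closedOp H u := by
    have := hu
    rw [hvu] at this
    exact (add_right_cancel this).symm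
  rw [hval, hvu]
  exact LinearPMap.mem_graph _ u

/-- A one-parameter group of unitaries preserving the Schwartz functions is generated by its
derivative there. -/
theorem IsFlow.isGeneratedBy {n : ℕ} {H : Module.End ℂ (Core n)} {e : ℝ → coreUnitary n}
    (h : IsFlow H fun s => lift (e s)) : IsGeneratedBy H (lift (e 1)) :=
  ⟨h.isSelfAdjoint, fun s => lift (e s), h.zero, h.add, h.continuous, h.hasDerivAt_closedOp, rfl⟩

theorem IsGeneratedBy.exists_flow {n : ℕ} {H : Module.End ℂ (Core n)} {W : ModeUnitary n}
    (h : IsGeneratedBy H W) : ∃ U : ℝ → ModeUnitary n, IsFlow H U ∧ U 1 = W := by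
  obtain ⟨-, U, h0, hadd, -, hd, h1⟩ := h
  refine ⟨U, ⟨h0, hadd, fun f => ?_⟩, h1⟩
  obtain ⟨v, hv, hv'⟩ := (LinearPMap.mem_graph_iff _).1 (mem_graph_closedOp_core H f)
  dsimp only at hv hv'
  rw [← hv, ← hv']
  exact hd v

/-! ### Symmetries of a Hamiltonian commute with the unitary it generates -/

/-- `W` may leave the Schwartz functions, so the symmetry is first extended to the self-adjoint
closure `A`. On its domain, `⟪e U_r v, U_{r-s} w⟫ - ⟪U_r e v, U_{r-s} w⟫` has zero derivative in
`r`, vanishes at `r = 0`, and at `r = s` is the commutator tested against `w`. -/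
theorem IsGeneratedBy.commute_lift {n : ℕ} {H : Module.End ℂ (Core n)} {W : ModeUnitary n}
    (h : IsGeneratedBy H W) {e : coreUnitary n} (he : ∀ f, H (e.1 f) = e.1 (H f)) :
    Commute (lift e) W := by
  obtain ⟨hA, U, h0, hadd, hcont, hd, rfl⟩ := h
  have hcl := isClosable_of_isSelfAdjoint hA
  have hdense := dense_domain_closedOp H
  set A := closedOp H
  have hclosed : IsClosed (A.graph : Set (Modes n × Modes n)) := hA.isClosed
  have hsym : ∀ v w : A.domain, ⟪A v, (w : Modes n)⟫_ℂ = ⟪(v : Modes n), A w⟫_ℂ := by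
    have := LinearPMap.adjoint_isFormalAdjoint hdense
    rw [LinearPMap.isSelfAdjoint_def.1 hA] at this
    exact fun v w => this v w
  have hneg : ∀ s, U (-s) = (U s)⁻¹ := fun s => by
    rw [eq_inv_iff_mul_eq_one, ← hadd, neg_add_cancel, h0]
  have hE : ∀ v : A.domain, ∃ w : A.domain, (w : Modes n) = lift e v ∧ A w = lift e (A v) := by
    intro v
    refine (LinearPMap.mem_graph_iff A (x := (lift e v, lift e (A v)))).1 ?_
    refine closedOp_induction hcl (p := fun v w => (lift e v, lift e w) ∈ A.graph) ?_ ?_ v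
    · exact hclosed.preimage (f := fun z : Modes n × Modes n => (lift e z.1, lift e z.2))
        (by fun_prop)
    · intro f
      rw [lift_apply, lift_apply, ← he]
      exact mem_graph_closedOp_core H _
  have hder : ∀ (v : A.domain) (s : ℝ),
      HasDerivAt (fun r => U r (v : Modes n)) (U s (-Complex.I • A v)) s := by
    intro v s
    have h1 := (hd v).scomp_of_eq (x := s) (h := fun r => r - s)
      ((hasDerivAt_id s).sub_const s) (by simp)
    have h2 := ((U s).toContinuousLinearEquiv.toContinuousLinearMap.restrictScalars
      ℝ).hasFDerivAt.comp_hasDerivAt s h1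
    simp only [one_smul] at h2
    refine h2.congr_of_eventuallyEq (Filter.Eventually.of_forall fun r => ?_)
    show _ = (U s) (U (r - s) v)
    rw [← mul_apply', ← hadd, add_sub_cancel]
  -- The group preserves the domain of `A`: differentiating matrix elements puts `U s v` in the
  -- domain of the adjoint, which is `A`.
  have hU : ∀ (s : ℝ) (v : A.domain), ∃ w : A.domain,
      (w : Modes n) = U s v ∧ A w = U s (A v) := by
    intro s v
    have hform : ∀ w : A.domain, ⟪U s (A v), (w : Modes n)⟫_ℂ = ⟪U s v, A w⟫_ℂ := by
      intro w
      have h1 : HasDerivAt (fun r => ⟪U r (v : Modes n), (w : Modes n)⟫_ℂ)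
          ⟪U s (-Complex.I • A v), (w : Modes n)⟫_ℂ s := by
        simpa using (hder v s).inner ℂ (hasDerivAt_const s (w : Modes n))
      have h2 : HasDerivAt (fun r => ⟪U s (v : Modes n), U (s - r) (w : Modes n)⟫_ℂ)
          ⟪U s (v : Modes n), Complex.I • A w⟫_ℂ s := by
        have h3 := (hd w).scomp_of_eq (x := s) (h := fun r => s - r)
          ((hasDerivAt_id s).const_sub s) (by simp)
        simpa using (hasDerivAt_const s (U s (v : Modes n))).inner ℂ h3
      have h4 : (fun r => ⟪U r (v : Modes n), (w : Modes n)⟫_ℂ)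
          = fun r => ⟪U s (v : Modes n), U (s - r) (w : Modes n)⟫_ℂ := by
        funext r
        have : U s = U (s - r) * U r := by rw [← hadd, sub_add_cancel]
        rw [this, mul_apply', LinearIsometryEquiv.inner_map_map]
      rw [h4] at h1
      have h5 := h1.unique h2
      rw [map_smul, inner_smul_left, inner_smul_right, map_neg, Complex.conj_I, neg_neg] at h5
      exact mul_left_cancel₀ Complex.I_ne_zero h5
    have hmem : U s v ∈ A.adjoint.domain := LinearPMap.mem_adjoint_domain_of_exists _ ⟨_, hform⟩
    have hval := LinearPMap.adjoint_apply_eq hdense ⟨U s v, hmem⟩ hform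
    have hg : (U s v, U s (A v)) ∈ A.adjoint.graph :=
      (LinearPMap.mem_graph_iff _).2 ⟨⟨_, hmem⟩, rfl, hval⟩
    rw [LinearPMap.isSelfAdjoint_def.1 hA] at hg
    exact (LinearPMap.mem_graph_iff _).1 hg
  have hcomm : ∀ (s : ℝ) (v : A.domain), lift e (U s v) = U s (lift e v) := by
    intro s v
    refine ext_inner_right ℂ fun w => ?_
    refine congrFun (hdense.denseRange_val.equalizer
      (g := fun w : Modes n => ⟪lift e (U s v), w⟫_ℂ)
      (h := fun w => ⟪U s (lift e v), w⟫_ℂ) (by fun_prop) (by fun_prop) (funext fun w => ?_)) w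
    show ⟪lift e (U s v), (w : Modes n)⟫_ℂ = ⟪U s (lift e v), (w : Modes n)⟫_ℂ
    obtain ⟨v', hv', hAv'⟩ := hE v
    have hd0 : ∀ r, HasDerivAt (fun r => ⟪lift e (U r v), U (r - s) (w : Modes n)⟫_ℂ
        - ⟪U r (lift e v), U (r - s) (w : Modes n)⟫_ℂ) 0 r := by
      intro r
      obtain ⟨z, hz, hAz⟩ := hU (r - s) w
      obtain ⟨u, hu, hAu⟩ := hU r v
      obtain ⟨u', hu', hAu'⟩ := hE u
      obtain ⟨x, hx, hAx⟩ := hU r v'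
      have e1 : HasDerivAt (fun r => U (r - s) (w : Modes n)) (-Complex.I • A z) r := by
        have := (hder w (r - s)).scomp r ((hasDerivAt_id r).sub_const s)
        simp only [one_smul, map_smul] at this
        rw [hAz]; exact this
      have e2 : HasDerivAt (fun r => lift e (U r v)) (-Complex.I • A u') r := by
        have := ((lift e).toContinuousLinearEquiv.toContinuousLinearMap.restrictScalars
          ℝ).hasFDerivAt.comp_hasDerivAt r (hder v r)
        refine this.congr_deriv ?_
        rw [hAu', hAu]
        simp
      have e3 : HasDerivAt (fun r => U r (lift e v)) (-Complex.I • A x) r := by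
        have := hder v' r
        rw [hAx]
        simpa [hv'] using this
      refine ((e2.inner ℂ e1).sub (e3.inner ℂ e1)).congr_deriv ?_
      rw [← hz, ← hu, ← hu', ← hv', ← hx]
      simp only [inner_smul_left, inner_smul_right, map_neg, Complex.conj_I, hsym]
      ring
    have := is_const_of_deriv_eq_zero (fun r => (hd0 r).differentiableAt)
      (fun r => (hd0 r).deriv) s 0
    simp only [sub_self, h0, zero_sub] at this
    change _ = ⟪lift e v, _⟫_ℂ - ⟪lift e v, _⟫_ℂ at this
    rw [sub_self] at this
    exact sub_eq_zero.1 this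
  refine modeUnitary_ext fun f => ?_
  obtain ⟨v, hv, -⟩ := (LinearPMap.mem_graph_iff _).1 (mem_graph_closedOp_core H f)
  dsimp only at hv
  rw [mul_apply', mul_apply', ← hv]
  exact hcomm 1 v

/-! ### Exponentials of functions of temperate growth -/

theorem norm_iteratedFDeriv_cexp (i : ℕ) (z : ℂ) :
    ‖iteratedFDeriv ℝ i Complex.exp z‖ = Real.exp z.re := by
  have h := (Complex.contDiff_exp (𝕜 := ℂ) (n := i)).contDiffAt.restrictScalars_iteratedFDeriv
    (𝕜 := ℝ) (x := z)
  rw [← h, Function.comp_apply, ContinuousMultilinearMap.norm_restrictScalars,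
    norm_iteratedFDeriv_eq_norm_iteratedDeriv, iteratedDeriv_eq_iterate, Complex.iter_deriv_exp,
    Complex.norm_exp]

/-- All derivatives of `exp` at `z` have norm `exp (Re z)` and those of `p` grow polynomially, so
the Faà di Bruno bound leaves a polynomial times `exp (Re p)`. -/
theorem norm_iteratedFDeriv_cexp_comp_le {E : Type*} [NormedAddCommGroup E] [NormedSpace ℝ E]
    {p : E → ℂ} (hp : p.HasTemperateGrowth) (m : ℕ) :
    ∃ (k : ℕ) (C : ℝ), 0 ≤ C ∧ ∀ x, ‖iteratedFDeriv ℝ m (fun x => Complex.exp (p x)) x‖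
      ≤ C * (1 + ‖x‖) ^ k * Real.exp (p x).re := by
  obtain ⟨k, C, hC, h⟩ := hp.norm_iteratedFDeriv_le_uniform m
  refine ⟨k * m, m.factorial * (1 + C) ^ m, by positivity, fun x => ?_⟩
  -- A base of at least `1` lies below each of its positive powers, the form in which the
  -- composition bound wants the derivatives of `p`.
  have h1 : 1 ≤ (1 + C) * (1 + ‖x‖) ^ k :=
    one_le_mul_of_one_le_of_one_le (by linarith) (one_le_pow₀ (by simp))
  refine (norm_iteratedFDeriv_comp_le (N := m) (D := (1 + C) * (1 + ‖x‖) ^ k)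
    Complex.contDiff_exp (hp.1.of_le (by exact_mod_cast le_top)) le_rfl x
    (fun i _ => (norm_iteratedFDeriv_cexp i (p x)).le) fun i hi hin => ?_).trans_eq ?_
  · refine (h i hin x).trans (le_trans ?_ (le_self_pow₀ h1 (by omega)))
    gcongr
    linarith
  · rw [mul_pow, pow_mul]; ring

theorem hasTemperateGrowth_cexp {E : Type*} [NormedAddCommGroup E] [NormedSpace ℝ E]
    {p : E → ℂ} (hp : p.HasTemperateGrowth) (hre : ∀ x, (p x).re ≤ 0) :
    (fun x => Complex.exp (p x)).HasTemperateGrowth := by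
  refine ⟨hp.1.cexp, fun m => ?_⟩
  obtain ⟨k, C, hC, h⟩ := norm_iteratedFDeriv_cexp_comp_le hp m
  refine ⟨k, C, fun x => (h x).trans (mul_le_of_le_one_right (by positivity) ?_)⟩
  exact Real.exp_le_one_iff.2 (hre x)

theorem exists_pow_mul_exp_neg_sq_le (k : ℕ) {ε : ℝ} (hε : 0 < ε) :
    ∃ C, ∀ t : ℝ, 0 ≤ t → (1 + t) ^ k * Real.exp (-ε * t ^ 2) ≤ C := by
  refine ⟨k.factorial * Real.exp (1 + 1 / (4 * ε)), fun t ht => ?_⟩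
  have h1 : (1 + t) ^ k ≤ k.factorial * Real.exp (1 + t) := by
    have := Real.pow_div_factorial_le_exp (1 + t) (by linarith) k
    rw [div_le_iff₀ (by positivity)] at this
    linarith
  have h2 : Real.exp (1 + t) * Real.exp (-ε * t ^ 2) ≤ Real.exp (1 + 1 / (4 * ε)) := by
    rw [← Real.exp_add]
    refine Real.exp_le_exp.2 ?_
    -- Completing the square lets the Gaussian absorb the linear exponent.
    have h3 : 1 / (4 * ε) - t + ε * t ^ 2 = ε * (t - 1 / (2 * ε)) ^ 2 := by
      field_simp; ring
    nlinarith [mul_nonneg hε.le (sq_nonneg (t - 1 / (2 * ε)))]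
  calc (1 + t) ^ k * Real.exp (-ε * t ^ 2)
      ≤ (k.factorial * Real.exp (1 + t)) * Real.exp (-ε * t ^ 2) := by gcongr
    _ ≤ _ := by rw [mul_assoc]; gcongr

/-- `exp p` is a Schwartz function if `p` has temperate growth and `Re p` is bounded above by
a negative multiple of `‖x‖ ^ 2` up to a constant. -/
def expSchwartz {E : Type*} [NormedAddCommGroup E] [NormedSpace ℝ E] (p : E → ℂ)
    (hp : p.HasTemperateGrowth) (hre : ∃ ε > 0, ∃ c : ℝ, ∀ x, (p x).re ≤ -ε * ‖x‖ ^ 2 + c) :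
    𝓢(E, ℂ) where
  toFun x := Complex.exp (p x)
  smooth' := hp.1.cexp
  decay' k m := by
    obtain ⟨ε, hε, c, h⟩ := hre
    obtain ⟨l, C, hC, hl⟩ := norm_iteratedFDeriv_cexp_comp_le hp m
    obtain ⟨C', hC'⟩ := exists_pow_mul_exp_neg_sq_le (k + l) hε
    refine ⟨C * C' * Real.exp c, fun x => ?_⟩
    calc ‖x‖ ^ k * ‖iteratedFDeriv ℝ m (fun x => Complex.exp (p x)) x‖
        ≤ (1 + ‖x‖) ^ k * (C * (1 + ‖x‖) ^ l * Real.exp (-ε * ‖x‖ ^ 2 + c)) := by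
          gcongr
          · linarith
          · exact (hl x).trans (by gcongr; exact h x)
      _ = C * ((1 + ‖x‖) ^ (k + l) * Real.exp (-ε * ‖x‖ ^ 2)) * Real.exp c := by
          rw [Real.exp_add, pow_add]; ring
      _ ≤ C * C' * Real.exp c := by gcongr; exact hC' _ (norm_nonneg x)

@[simp]
theorem expSchwartz_apply {E : Type*} [NormedAddCommGroup E] [NormedSpace ℝ E] (p : E → ℂ)
    (hp : p.HasTemperateGrowth) (hre : ∃ ε > 0, ∃ c : ℝ, ∀ x, (p x).re ≤ -ε * ‖x‖ ^ 2 + c)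
    (x : E) : expSchwartz p hp hre x = Complex.exp (p x) := rfl

/-! ### Norms of Schwartz functions -/

theorem norm_coreIncl_le {n : ℕ} {f g : Core n} {C : ℝ} (h : ∀ x, ‖f x‖ ≤ C * ‖g x‖) :
    ‖coreIncl n f‖ ≤ C * ‖coreIncl n g‖ := by
  have hf := f.coeFn_toLp 2 (volume : Measure (EuclideanSpace ℝ (Fin n)))
  have hg := g.coeFn_toLp 2 (volume : Measure (EuclideanSpace ℝ (Fin n)))
  refine Lp.norm_le_mul_norm_of_ae_le_mul ?_
  filter_upwards [hf, hg] with x hx hx'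
  show ‖(f.toLp 2 volume) x‖ ≤ C * ‖(g.toLp 2 volume) x‖
  rw [hx, hx']
  exact h x

theorem norm_coreIncl_congr {n : ℕ} {f g : Core n} (h : ∀ x, ‖f x‖ = ‖g x‖) :
    ‖coreIncl n f‖ = ‖coreIncl n g‖ :=
  le_antisymm (by simpa using norm_coreIncl_le (C := 1) fun x => by rw [h, one_mul])
    (by simpa using norm_coreIncl_le (C := 1) fun x => by rw [← h, one_mul])

theorem inner_coreIncl {n : ℕ} (f g : Core n) :
    ⟪coreIncl n f, coreIncl n g⟫_ℂ = ∫ x, ⟪f x, g x⟫_ℂ :=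
  SchwartzMap.inner_toL2_toL2_eq f g _

/-! ### Multiplication by phases -/

theorem HasTemperateGrowth.ofReal_comp {E : Type*} [NormedAddCommGroup E] [NormedSpace ℝ E]
    {q : E → ℝ} (hq : q.HasTemperateGrowth) :
    (fun x => (q x : ℂ)).HasTemperateGrowth :=
  Function.HasTemperateGrowth.comp Function.Complex.hasTemperateGrowth_ofReal hq

theorem hasTemperateGrowth_phase {E : Type*} [NormedAddCommGroup E] [NormedSpace ℝ E]
    {q : E → ℝ} (hq : q.HasTemperateGrowth) :
    (fun x => Complex.exp (Complex.I * q x)).HasTemperateGrowth :=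
  hasTemperateGrowth_cexp ((Function.HasTemperateGrowth.const _).mul
    (HasTemperateGrowth.ofReal_comp hq)) fun x => by simp

/-- Multiplication by `q` on Schwartz functions. -/
def mulOp {n : ℕ} (q : EuclideanSpace ℝ (Fin n) → ℝ) : Module.End ℂ (Core n) :=
  (SchwartzMap.smulLeftCLM ℂ fun x => (q x : ℂ)).toLinearMap

theorem mulOp_apply {n : ℕ} {q : EuclideanSpace ℝ (Fin n) → ℝ} (hq : q.HasTemperateGrowth)
    (f : Core n) (x : EuclideanSpace ℝ (Fin n)) : mulOp q f x = q x * f x :=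
  SchwartzMap.smulLeftCLM_apply_apply (HasTemperateGrowth.ofReal_comp hq) f x

/-- Multiplication by `exp (i q)` on Schwartz functions. -/
def phase {n : ℕ} (q : EuclideanSpace ℝ (Fin n) → ℝ) (hq : q.HasTemperateGrowth) :
    coreUnitary n :=
  ⟨LinearEquiv.ofLinearMap
    (SchwartzMap.smulLeftCLM ℂ fun x => Complex.exp (Complex.I * q x)).toLinearMap
    (SchwartzMap.smulLeftCLM ℂ fun x => Complex.exp (Complex.I * ((-q) x : ℝ))).toLinearMap
    (LinearMap.ext fun f => SchwartzMap.ext fun x => by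
      simp only [LinearMap.comp_apply, ContinuousLinearMap.coe_coe, LinearMap.id_apply]
      rw [smulLeftCLM_apply_apply (hasTemperateGrowth_phase hq),
        smulLeftCLM_apply_apply (hasTemperateGrowth_phase hq.neg), smul_smul, ← Complex.exp_add]
      simp)
    (LinearMap.ext fun f => SchwartzMap.ext fun x => by
      simp only [LinearMap.comp_apply, ContinuousLinearMap.coe_coe, LinearMap.id_apply]
      rw [smulLeftCLM_apply_apply (hasTemperateGrowth_phase hq.neg),
        smulLeftCLM_apply_apply (hasTemperateGrowth_phase hq), smul_smul, ← Complex.exp_add]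
      simp),
  fun f => norm_coreIncl_congr fun x => by
    simp only [LinearEquiv.coe_ofLinearMap, ContinuousLinearMap.coe_coe]
    rw [smulLeftCLM_apply_apply (hasTemperateGrowth_phase hq), norm_smul, mul_comm Complex.I,
      Complex.norm_exp_ofReal_mul_I, one_mul]⟩

@[simp]
theorem phase_apply {n : ℕ} {q : EuclideanSpace ℝ (Fin n) → ℝ} (hq : q.HasTemperateGrowth)
    (f : Core n) (x : EuclideanSpace ℝ (Fin n)) :
    (phase q hq).1 f x = Complex.exp (Complex.I * q x) * f x :=
  smulLeftCLM_apply_apply (hasTemperateGrowth_phase hq) f x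

theorem coreUnitary_ext {n : ℕ} {a b : coreUnitary n} (h : ∀ f x, a.1 f x = b.1 f x) : a = b :=
  Subtype.ext (LinearEquiv.ext fun f => SchwartzMap.ext fun x => h f x)

theorem coreUnitary_mul_apply {n : ℕ} (a b : coreUnitary n) (f : Core n) :
    (a * b).1 f = a.1 (b.1 f) := rfl

/-- Mean value inequality: the derivative `i (exp (i t) - 1)` is bounded by `|θ|` between `0` and
`θ`. -/
theorem norm_exp_mul_I_sub_one_sub_le (θ : ℝ) :
    ‖Complex.exp (Complex.I * θ) - 1 - Complex.I * θ‖ ≤ θ ^ 2 := by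
  have h1 : ∀ t : ℝ, HasDerivAt (fun t : ℝ => Complex.exp (Complex.I * t) - 1 - Complex.I * t)
      (Complex.I * (Complex.exp (Complex.I * t) - 1)) t := by
    intro t
    have h2 : HasDerivAt (fun t : ℝ => Complex.I * (t : ℂ)) (Complex.I * 1) t :=
      (Complex.ofRealCLM.hasDerivAt (x := t)).const_mul Complex.I
    refine ((h2.cexp.sub_const 1).sub h2).congr_deriv ?_
    ring
  have h3 := (convex_uIcc 0 θ).norm_image_sub_le_of_norm_hasDerivWithin_le (𝕜 := ℝ)
    (C := |θ|) (fun t _ => (h1 t).hasDerivWithinAt) (fun t ht => ?_)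
    Set.left_mem_uIcc Set.right_mem_uIcc
  · simpa [← sq] using h3
  · rw [norm_mul, Complex.norm_I, one_mul]
    refine Real.norm_exp_I_mul_ofReal_sub_one_le.trans ?_
    rw [Real.norm_eq_abs]
    have := Set.abs_sub_left_of_mem_uIcc ht
    simpa using this

theorem norm_phase_sub_le {n : ℕ} {q : EuclideanSpace ℝ (Fin n) → ℝ} (hq : q.HasTemperateGrowth)
    (f : Core n) :
    ‖coreIncl n ((phase q hq).1 f) - coreIncl n f - Complex.I • coreIncl n (mulOp q f)‖
      ≤ ‖coreIncl n (mulOp q (mulOp q f))‖ := by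
  rw [← map_smul, ← map_sub, ← map_sub, ← one_mul ‖coreIncl n (mulOp q (mulOp q f))‖]
  refine norm_coreIncl_le fun x => ?_
  have e : ((phase q hq).1 f - f - Complex.I • mulOp q f) x
      = (Complex.exp (Complex.I * q x) - 1 - Complex.I * q x) * f x := by
    rw [sub_apply, sub_apply, smul_apply, phase_apply, mulOp_apply hq, smul_eq_mul]; ring
  rw [e, mulOp_apply hq, mulOp_apply hq, one_mul, norm_mul, norm_mul, norm_mul,
    Complex.norm_real, Real.norm_eq_abs, ← mul_assoc, ← sq, sq_abs]
  gcongr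
  exact norm_exp_mul_I_sub_one_sub_le _

theorem mulOp_smul {n : ℕ} {q : EuclideanSpace ℝ (Fin n) → ℝ} (hq : q.HasTemperateGrowth)
    (s : ℝ) (f : Core n) : mulOp (fun x => s * q x) f = (s : ℂ) • mulOp q f := by
  ext x
  rw [mulOp_apply (by fun_prop), smul_apply, mulOp_apply hq]
  push_cast; rw [smul_eq_mul, mul_assoc]

theorem real_smul_modes {n : ℕ} (s : ℝ) (v : Modes n) : s • v = (s : ℂ) • v :=
  RCLike.real_smul_eq_coe_smul (K := ℂ) s v

/-- Second-order remainders give derivatives at zero. -/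
theorem hasDerivAt_zero_of_norm_le {E : Type*} [NormedAddCommGroup E] [NormedSpace ℝ E]
    {y : ℝ → E} {y' : E} {C : ℝ} (h : ∀ s, ‖y s - y 0 - s • y'‖ ≤ s ^ 2 * C) :
    HasDerivAt y y' 0 := by
  rw [hasDerivAt_iff_isLittleO]
  simp only [sub_zero]
  refine Asymptotics.IsBigO.trans_isLittleO (g := fun s : ℝ => s ^ 2) ?_ ?_
  · refine Asymptotics.IsBigO.of_bound C (Filter.Eventually.of_forall fun s => ?_)
    rw [Real.norm_of_nonneg (sq_nonneg s), mul_comm]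
    exact h s
  · simpa using (Asymptotics.isLittleO_pow_pow (𝕜 := ℝ) (m := 1) (n := 2) (by norm_num))

theorem isFlow_phase {n : ℕ} {q : EuclideanSpace ℝ (Fin n) → ℝ} (hq : q.HasTemperateGrowth) :
    IsFlow (mulOp q) fun s => lift (phase (fun x => -s * q x) (by fun_prop)) where
  zero := by
    rw [← map_one lift]
    congr 1
    exact coreUnitary_ext fun f x => by rw [phase_apply]; simp
  add s s' := by
    rw [← map_mul]
    congr 1
    refine coreUnitary_ext fun f x => ?_
    rw [coreUnitary_mul_apply, phase_apply, phase_apply, phase_apply, ← mul_assoc,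
      ← Complex.exp_add]
    push_cast; ring_nf
  deriv_zero f := by
    refine hasDerivAt_zero_of_norm_le (C := ‖coreIncl n (mulOp q (mulOp q f))‖) fun s => ?_
    have h0 : lift (phase (fun x => -0 * q x) (by fun_prop)) (coreIncl n f) = coreIncl n f := by
      rw [lift_apply]
      congr 1
      ext x; rw [phase_apply]; simp
    have h := norm_phase_sub_le (q := fun x => -s * q x) (by fun_prop) f
    rw [mulOp_smul hq, map_smul, mulOp_smul hq, map_smul, map_smul, norm_smul, map_smul, norm_smul,
      Complex.norm_real, Real.norm_eq_abs, abs_neg, ← mul_assoc, ← sq, sq_abs] at h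
    rw [h0, lift_apply]
    have e : s • (-Complex.I • coreIncl n (mulOp q f))
        = Complex.I • ((-s : ℝ) : ℂ) • coreIncl n (mulOp q f) := by
      rw [real_smul_modes, smul_smul, smul_smul]
      congr 1
      push_cast; ring
    rw [e]
    exact h

/-! ### Translations, the Fourier transform and Weyl operators -/

open FourierTransform in
/-- The Fourier transform on Schwartz functions. -/
def fourierCore (n : ℕ) : coreUnitary n :=
  ⟨FourierTransform.fourierEquiv ℂ (Core n), fun f => SchwartzMap.norm_fourier_toL2_eq f⟩

open FourierTransform in
theorem fourierCore_apply {n : ℕ} (f : Core n) : (fourierCore n).1 f = 𝓕 f := rfl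

theorem norm_coreIncl_sq {n : ℕ} (f : Core n) :
    ‖coreIncl n f‖ ^ 2 = ∫ x, ‖f x‖ ^ 2 := by
  have h := inner_coreIncl f f
  have h2 : ∀ x, ⟪f x, f x⟫_ℂ = ((‖f x‖ ^ 2 : ℝ) : ℂ) := fun x => by
    rw [inner_self_eq_norm_sq_to_K]; push_cast; rfl
  rw [inner_self_eq_norm_sq_to_K] at h
  simp only [h2] at h
  rw [integral_complex_ofReal] at h
  refine Complex.ofReal_injective ?_
  rw [Complex.ofReal_pow]
  exact h

theorem norm_coreIncl_translate {n : ℕ} (b : EuclideanSpace ℝ (Fin n)) (f : Core n) :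
    ‖coreIncl n (compSubConstCLM ℂ b f)‖ = ‖coreIncl n f‖ := by
  refine (sq_eq_sq₀ (norm_nonneg _) (norm_nonneg _)).1 ?_
  rw [norm_coreIncl_sq, norm_coreIncl_sq]
  simp only [compSubConstCLM_apply]
  exact integral_sub_right_eq_self (fun x => ‖f x‖ ^ 2) b

/-- Translations `f ↦ f (· + b)` on Schwartz functions. -/
def transl {n : ℕ} (b : EuclideanSpace ℝ (Fin n)) : coreUnitary n :=
  ⟨LinearEquiv.ofLinearMap (compSubConstCLM ℂ (-b)).toLinearMap (compSubConstCLM ℂ b).toLinearMap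
    (LinearMap.ext fun f => SchwartzMap.ext fun x => by simp)
    (LinearMap.ext fun f => SchwartzMap.ext fun x => by simp),
  fun f => norm_coreIncl_translate (-b) f⟩

@[simp]
theorem transl_apply {n : ℕ} (b : EuclideanSpace ℝ (Fin n)) (f : Core n)
    (x : EuclideanSpace ℝ (Fin n)) : (transl b).1 f x = f (x + b) := by
  show compSubConstCLM ℂ (-b) f x = _
  rw [compSubConstCLM_apply, sub_neg_eq_add]

theorem fourier_transl {n : ℕ} (b : EuclideanSpace ℝ (Fin n)) :
    fourierCore n * transl b
      = phase (fun x => 2 * Real.pi * inner ℝ b x) (by fun_prop) * fourierCore n := by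
  refine coreUnitary_ext fun f x => ?_
  rw [coreUnitary_mul_apply, coreUnitary_mul_apply, phase_apply, fourierCore_apply,
    fourierCore_apply, SchwartzMap.fourier_coe, SchwartzMap.fourier_coe]
  have h := congrFun (VectorFourier.fourierIntegral_comp_add_right Real.fourierChar
    (volume : Measure (EuclideanSpace ℝ (Fin n))) (innerₗ (EuclideanSpace ℝ (Fin n))) f b) x
  have e : ⇑((transl b).1 f) = (f ∘ fun v => v + b) := funext fun y => transl_apply b f y
  rw [e]
  refine h.trans ?_
  rw [Circle.smul_def, Real.fourierChar_apply, smul_eq_mul, innerₗ_apply_apply, mul_comm Complex.I]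
  rfl

/-- The momentum `-i ∂_b` in the direction `b`. -/
def momentumAlong {n : ℕ} (b : EuclideanSpace ℝ (Fin n)) : Module.End ℂ (Core n) :=
  (-Complex.I) • (LineDeriv.lineDerivOpCLM ℂ (Core n) b).toLinearMap

theorem momentumAlong_apply {n : ℕ} (b : EuclideanSpace ℝ (Fin n)) (f : Core n)
    (x : EuclideanSpace ℝ (Fin n)) :
    momentumAlong b f x = -Complex.I * fderiv ℝ f x b := by
  show -Complex.I * (∂_{b} f) x = _
  rw [SchwartzMap.lineDerivOp_apply_eq_fderiv]

theorem fourierCore_momentumAlong {n : ℕ} (b : EuclideanSpace ℝ (Fin n)) (f : Core n) :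
    (fourierCore n).1 (momentumAlong b f)
      = mulOp (fun x => 2 * Real.pi * inner ℝ b x) ((fourierCore n).1 f) := by
  show (fourierCore n).1 (-Complex.I • ∂_{b} f) = _
  rw [map_smul, fourierCore_apply, SchwartzMap.fourier_lineDerivOp_eq, fourierCore_apply]
  ext x
  rw [mulOp_apply (by fun_prop), smul_apply, smul_apply, smulLeftCLM_apply_apply (by fun_prop),
    real_inner_comm]
  rw [smul_eq_mul, smul_eq_mul, Complex.real_smul]
  push_cast
  have := Complex.I_mul_I
  linear_combination (-(2 * Real.pi : ℂ) * (inner ℝ b x : ℝ) *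
    (FourierTransform.fourier f : Core n) x) * this

/-- Flows are transported by unitaries preserving the Schwartz functions: by the Fourier transform
to reach momentum Hamiltonians, by Weyl operators to recentre quadratic ones. -/
theorem IsFlow.conj {n : ℕ} {H : Module.End ℂ (Core n)} {U : ℝ → ModeUnitary n}
    (h : IsFlow H U) (e : coreUnitary n) {K : Module.End ℂ (Core n)}
    (hK : ∀ f, e.1 (K f) = H (e.1 f)) :
    IsFlow K fun s => (lift e)⁻¹ * U s * lift e where
  zero := by simp [h.zero]
  add s s' := by simp [h.add, mul_assoc]
  deriv_zero f := by
    have h1 := ((lift e)⁻¹.toContinuousLinearEquiv.toContinuousLinearMap.restrictScalars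
      ℝ).hasFDerivAt.comp_hasDerivAt 0 (h.deriv_zero (e.1 f))
    have h2 : (lift e)⁻¹ (-Complex.I • coreIncl n (H (e.1 f)))
        = -Complex.I • coreIncl n (K f) := by
      rw [← hK, map_smul, ← lift_apply, inv_apply_self']
    refine (h1.congr_of_eventuallyEq (Filter.Eventually.of_forall fun s => ?_)).congr_deriv h2
    show (lift e)⁻¹ (U s (lift e (coreIncl n f))) = _
    rw [lift_apply]
    rfl

theorem IsFlow.reverse {n : ℕ} {H : Module.End ℂ (Core n)} {U : ℝ → ModeUnitary n}
    (h : IsFlow H U) : IsFlow (-H) fun s => U (-s) where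
  zero := by simp [h.zero]
  add s s' := by rw [neg_add, h.add]
  deriv_zero f := by
    have := (h.deriv_zero f).scomp_of_eq (x := 0) (hasDerivAt_neg (0 : ℝ)) (by simp)
    refine this.congr_deriv ?_
    rw [LinearMap.neg_apply, map_neg, smul_neg, neg_smul, one_smul]

/-- Translations are Fourier conjugates of linear phases, so their generator comes from that of the
phases by conjugation and time reversal. -/
theorem isFlow_transl {n : ℕ} (b : EuclideanSpace ℝ (Fin n)) :
    IsFlow (-momentumAlong b) fun s => lift (transl (s • b)) := by
  have h := ((isFlow_phase (n := n) (q := fun x => 2 * Real.pi * inner ℝ b x)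
    (by fun_prop)).conj (fourierCore n) (fourierCore_momentumAlong b)).reverse
  convert h using 2 with s
  rw [mul_assoc, eq_inv_mul_iff_mul_eq, ← map_mul, ← map_mul, fourier_transl]
  congr 2
  refine coreUnitary_ext fun f x => ?_
  rw [phase_apply, phase_apply, inner_smul_left]
  simp only [conj_trivial, neg_neg]
  congr 3
  push_cast; ring

/-- The position coefficients of a linear form in the quadratures. -/
def posPart {n : ℕ} (ξ : QIdx n → ℝ) : EuclideanSpace ℝ (Fin n) :=
  WithLp.toLp 2 fun j => ξ (j, 0)

/-- The momentum coefficients of a linear form in the quadratures. -/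
def momPart {n : ℕ} (ξ : QIdx n → ℝ) : EuclideanSpace ℝ (Fin n) :=
  WithLp.toLp 2 fun j => ξ (j, 1)

@[simp] theorem posPart_apply {n : ℕ} (ξ : QIdx n → ℝ) (j : Fin n) : posPart ξ j = ξ (j, 0) := rfl
@[simp] theorem momPart_apply {n : ℕ} (ξ : QIdx n → ℝ) (j : Fin n) : momPart ξ j = ξ (j, 1) := rfl
theorem posPart_add {n : ℕ} (ξ η : QIdx n → ℝ) : posPart (ξ + η) = posPart ξ + posPart η := rfl
theorem momPart_add {n : ℕ} (ξ η : QIdx n → ℝ) : momPart (ξ + η) = momPart ξ + momPart η := rfl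
theorem posPart_smul {n : ℕ} (s : ℝ) (ξ : QIdx n → ℝ) : posPart (s • ξ) = s • posPart ξ := rfl
theorem momPart_smul {n : ℕ} (s : ℝ) (ξ : QIdx n → ℝ) : momPart (s • ξ) = s • momPart ξ := rfl

/-- The linear form `∑ ξ_k R_k` in the quadratures. -/
def linOp {n : ℕ} (ξ : QIdx n → ℝ) : Module.End ℂ (Core n) := ∑ k, (ξ k : ℂ) • quad k

/-- The symplectic form. -/
def omega {n : ℕ} (ξ η : QIdx n → ℝ) : ℝ :=
  inner ℝ (posPart ξ) (momPart η) - inner ℝ (momPart ξ) (posPart η)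

/-- The Weyl operator `exp (i ∑ ξ_k R_k)` on Schwartz functions. -/
def weyl {n : ℕ} (ξ : QIdx n → ℝ) : coreUnitary n :=
  phase (fun x => inner ℝ (posPart ξ) x + inner ℝ (posPart ξ) (momPart ξ) / 2) (by fun_prop)
    * transl (momPart ξ)

theorem weyl_apply {n : ℕ} (ξ : QIdx n → ℝ) (f : Core n) (x : EuclideanSpace ℝ (Fin n)) :
    (weyl ξ).1 f x = Complex.exp (Complex.I * ((inner ℝ (posPart ξ) x
      + inner ℝ (posPart ξ) (momPart ξ) / 2 : ℝ) : ℂ)) * f (x + momPart ξ) := by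
  rw [weyl, coreUnitary_mul_apply, phase_apply, transl_apply]

/-- The constant phase in `weyl` is the one that makes the cocycle of the Weyl relation
antisymmetric, hence trivial along each line. -/
theorem weyl_add_apply {n : ℕ} (ξ η : QIdx n → ℝ) (f : Core n) :
    (weyl (ξ + η)).1 f
      = Complex.exp (Complex.I * (omega ξ η / 2 : ℝ)) • (weyl ξ).1 ((weyl η).1 f) := by
  ext x
  rw [smul_apply, weyl_apply, weyl_apply, weyl_apply, smul_eq_mul, ← mul_assoc, ← mul_assoc,
    ← Complex.exp_add, ← Complex.exp_add, posPart_add, momPart_add, add_assoc x]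
  congr 2
  rw [omega]
  simp only [inner_add_left, inner_add_right]
  rw [real_inner_comm (posPart η) (momPart ξ)]
  push_cast; ring

theorem lift_weyl_add_apply {n : ℕ} (ξ η : QIdx n → ℝ) (v : Modes n) :
    lift (weyl (ξ + η)) v
      = Complex.exp (Complex.I * (omega ξ η / 2 : ℝ)) • lift (weyl ξ) (lift (weyl η) v) := by
  refine congrFun ((denseRange_coreIncl n).equalizer (g := fun v => lift (weyl (ξ + η)) v)
    (h := fun v => Complex.exp (Complex.I * (omega ξ η / 2 : ℝ)) •
      lift (weyl ξ) (lift (weyl η) v)) (by fun_prop) (by fun_prop) (funext fun f => ?_)) v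
  simp only [Function.comp_apply, lift_apply]
  rw [weyl_add_apply, map_smul]

theorem weyl_zero {n : ℕ} : weyl (0 : QIdx n → ℝ) = 1 := by
  refine coreUnitary_ext fun f x => ?_
  rw [weyl_apply]
  have h1 : posPart (0 : QIdx n → ℝ) = 0 := rfl
  have h2 : momPart (0 : QIdx n → ℝ) = 0 := rfl
  rw [h1, h2]
  simp

theorem omega_smul_smul_self {n : ℕ} (s s' : ℝ) (ξ : QIdx n → ℝ) :
    omega (s • ξ) (s' • ξ) = 0 := by
  rw [omega, posPart_smul, momPart_smul, posPart_smul, momPart_smul]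
  simp only [inner_smul_left, inner_smul_right, conj_trivial]
  rw [real_inner_comm (posPart ξ) (momPart ξ)]
  ring

theorem momentumAlong_eq {n : ℕ} (ξ : QIdx n → ℝ) :
    momentumAlong (momPart ξ) = ∑ j, (ξ (j, 1) : ℂ) • momentum j := by
  refine LinearMap.ext fun f => SchwartzMap.ext fun x => ?_
  have hs : momPart ξ = ∑ j, ξ (j, 1) • EuclideanSpace.single j (1 : ℝ) := by
    ext i; simp [Finset.sum_apply, Pi.single_apply]
  rw [momentumAlong_apply, LinearMap.sum_apply, sum_apply, hs, map_sum,
    Finset.mul_sum]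
  refine Finset.sum_congr rfl fun j _ => ?_
  rw [LinearMap.smul_apply, smul_apply, momentum_apply, map_smul, smul_eq_mul, Complex.real_smul,
    f.differentiableAt.lineDeriv_eq_fderiv]
  ring

theorem mulOp_inner_eq {n : ℕ} (ξ : QIdx n → ℝ) :
    mulOp (fun x => inner ℝ (posPart ξ) x) = ∑ j, (ξ (j, 0) : ℂ) • position j := by
  refine LinearMap.ext fun f => SchwartzMap.ext fun x => ?_
  rw [mulOp_apply (by fun_prop), LinearMap.sum_apply, sum_apply, PiLp.inner_apply]
  push_cast
  rw [Finset.sum_mul]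
  refine Finset.sum_congr rfl fun j _ => ?_
  rw [LinearMap.smul_apply, smul_apply, position_apply, smul_eq_mul]
  simp
  ring

theorem linOp_eq {n : ℕ} (ξ : QIdx n → ℝ) :
    linOp ξ = mulOp (fun x => inner ℝ (posPart ξ) x) + momentumAlong (momPart ξ) := by
  rw [mulOp_inner_eq, momentumAlong_eq, ← Finset.sum_add_distrib, linOp, Fintype.sum_prod_type]
  refine Finset.sum_congr rfl fun j _ => ?_
  rw [Fin.sum_univ_two]
  rfl

/-- The sign reflects conventions: `weyl` is an exponential with `+i`, a flow one with `-i`. The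
group law holds because the cocycle vanishes on multiples of one form. -/
theorem isFlow_weyl {n : ℕ} (ξ : QIdx n → ℝ) :
    IsFlow (-linOp ξ) fun s => lift (weyl (s • ξ)) where
  zero := by rw [zero_smul, weyl_zero, map_one]
  add s s' := LinearIsometryEquiv.ext fun v => by
    rw [add_smul, lift_weyl_add_apply, omega_smul_smul_self]
    simp [mul_apply']
  deriv_zero f := by
    have h1 := (isFlow_transl (momPart ξ)).deriv_zero f
    have hp := (isFlow_phase (n := n) (q := fun x => inner ℝ (posPart ξ) x) (by fun_prop)).reverse
    have h2 := hasDerivAt_unitary_apply (s := 0) (U := fun s => lift (phase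
      (fun x => -(-s) * inner ℝ (posPart ξ) x) (by fun_prop))) h1
      (w := -Complex.I • coreIncl n ((-mulOp fun x => inner ℝ (posPart ξ) x) f)) (by
        have := hp.deriv_zero f
        rw [zero_smul]
        convert this using 4
        rw [lift_apply]
        congr 1
        ext x; simp) (hp.continuous _).continuousAt
    -- The constant phase is of second order in `s`, so it does not contribute to the derivative at
    -- `0`.
    have h3 : HasDerivAt (fun s : ℝ => Complex.exp (Complex.I *
        ((s ^ 2 * (inner ℝ (posPart ξ) (momPart ξ) / 2) : ℝ) : ℂ))) 0 0 := by
      have h4 : HasDerivAt (fun s : ℝ => s ^ 2 * (inner ℝ (posPart ξ) (momPart ξ) / 2)) 0 0 := by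
        simpa using ((hasDerivAt_id (0 : ℝ)).pow 2).mul_const
          (inner ℝ (posPart ξ) (momPart ξ) / 2)
      simpa using (h4.ofReal_comp.const_mul Complex.I).cexp
    have h5 := h3.smul h2
    refine (h5.congr_of_eventuallyEq (Filter.Eventually.of_forall fun s => ?_)).congr_deriv ?_
    · simp only [Pi.smul_apply', lift_apply]
      rw [← map_smul]
      congr 1
      ext x
      rw [weyl_apply, smul_apply, phase_apply, transl_apply, smul_eq_mul, ← mul_assoc,
        ← Complex.exp_add, posPart_smul, momPart_smul]
      congr 2
      simp only [inner_smul_left, inner_smul_right, conj_trivial]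
      push_cast; ring
    · have h6 : (lift (phase (fun x => -(-(0 : ℝ)) * inner ℝ (posPart ξ) x) (by fun_prop)) :
          ModeUnitary n) = 1 := by
        rw [← hp.zero]
      rw [h6, linOp_eq]
      simp
      abel

/-! ### Weyl operators and quadratures -/

theorem Omega_mulVec_zero {n : ℕ} (ξ : QIdx n → ℝ) (j : Fin n) :
    (Omega n *ᵥ ξ) (j, 0) = ξ (j, 1) := by
  simp [Omega, Matrix.mulVec, dotProduct, Fintype.sum_prod_type, Matrix.one_apply]

theorem Omega_mulVec_one {n : ℕ} (ξ : QIdx n → ℝ) (j : Fin n) :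
    (Omega n *ᵥ ξ) (j, 1) = -ξ (j, 0) := by
  simp [Omega, Matrix.mulVec, dotProduct, Fintype.sum_prod_type, Matrix.one_apply]

theorem Omega_mulVec_mulVec {n : ℕ} (ξ : QIdx n → ℝ) : Omega n *ᵥ (Omega n *ᵥ ξ) = -ξ := by
  ext ⟨j, i⟩
  fin_cases i
  · exact (Omega_mulVec_zero _ j).trans (Omega_mulVec_one _ j)
  · exact (Omega_mulVec_one _ j).trans (congrArg Neg.neg (Omega_mulVec_zero _ j))

theorem omega_eq_dotProduct {n : ℕ} (ξ η : QIdx n → ℝ) :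
    omega ξ η = ξ ⬝ᵥ (Omega n *ᵥ η) := by
  simp only [omega, dotProduct, Fintype.sum_prod_type, Fin.sum_univ_two, Omega_mulVec_zero,
    Omega_mulVec_one, PiLp.inner_apply, posPart_apply, momPart_apply, ← Finset.sum_sub_distrib]
  refine Finset.sum_congr rfl fun j _ => ?_
  simp; ring

theorem quad_zero {n : ℕ} (j : Fin n) : quad (j, 0) = position j := rfl
theorem quad_one {n : ℕ} (j : Fin n) : quad (j, 1) = momentum j := rfl

theorem momentum_apply_fderiv {n : ℕ} (j : Fin n) (f : Core n) (x : EuclideanSpace ℝ (Fin n)) :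
    momentum j f x = -Complex.I * fderiv ℝ f x (EuclideanSpace.single j 1) := by
  rw [momentum_apply, f.differentiableAt.lineDeriv_eq_fderiv]

/-- Positions are shifted by the translation, momenta by the gradient of the linear phase. -/
theorem quad_weyl {n : ℕ} (k : QIdx n) (ξ : QIdx n → ℝ) (f : Core n) :
    quad k ((weyl ξ).1 f) = (weyl ξ).1 (quad k f - (((Omega n *ᵥ ξ) k : ℝ) : ℂ) • f) := by
  obtain ⟨j, i⟩ := k
  ext x
  rw [weyl_apply, sub_apply, smul_apply]
  fin_cases i
  · show position j _ x = _ * (position j f _ - (((Omega n *ᵥ ξ) (j, 0) : ℝ) : ℂ) • _)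
    rw [position_apply, position_apply, weyl_apply, Omega_mulVec_zero]
    simp
    ring
  · show momentum j _ x = _ * (momentum j f _ - (((Omega n *ᵥ ξ) (j, 1) : ℝ) : ℂ) • _)
    rw [Omega_mulVec_one, momentum_apply_fderiv, momentum_apply_fderiv]
    have h1 : HasFDerivAt (fun x : EuclideanSpace ℝ (Fin n) => inner ℝ (posPart ξ) x
        + inner ℝ (posPart ξ) (momPart ξ) / 2) (innerSL ℝ (posPart ξ)) x :=
      (innerSL ℝ (posPart ξ)).hasFDerivAt.add_const _
    have h2 := (((Complex.ofRealCLM.hasFDerivAt).comp x h1).const_mul Complex.I).cexp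
    have h3 : HasFDerivAt (fun x => f (x + momPart ξ)) (fderiv ℝ f (x + momPart ξ)) x :=
      (f.hasFDerivAt (x + momPart ξ)).comp x ((hasFDerivAt_id x).add_const (momPart ξ))
    have h4 := h2.mul h3
    have h5 : fderiv ℝ ((weyl ξ).1 f) x = _ := (h4.congr_of_eventuallyEq
      (Filter.Eventually.of_forall fun y => weyl_apply ξ f y)).fderiv
    rw [h5]
    have h6 : inner ℝ (posPart ξ) (EuclideanSpace.single j (1 : ℝ)) = ξ (j, 0) := by
      simp [PiLp.inner_apply]
    simp [h6, -Complex.ofReal_add]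
    have := Complex.I_mul_I
    linear_combination (-Complex.exp (Complex.I * ((inner ℝ (posPart ξ) x
      + inner ℝ (posPart ξ) (momPart ξ) / 2 : ℝ) : ℂ)) * f (x + momPart ξ) * ξ (j, 0)) * this

theorem linOp_apply {n : ℕ} (ξ : QIdx n → ℝ) (f : Core n) :
    linOp ξ f = ∑ k, (ξ k : ℂ) • quad k f := by
  simp [linOp, LinearMap.sum_apply]

theorem linOp_add {n : ℕ} (ξ η : QIdx n → ℝ) : linOp (ξ + η) = linOp ξ + linOp η := by
  simp [linOp, add_smul, Finset.sum_add_distrib]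

theorem linOp_smul {n : ℕ} (s : ℝ) (ξ : QIdx n → ℝ) : linOp (s • ξ) = (s : ℂ) • linOp ξ := by
  simp [linOp, Finset.smul_sum, mul_smul]

/-- Unitarity of the Weyl flow replaces an integration by parts. -/
theorem isSymm_linOp {n : ℕ} (ξ : QIdx n → ℝ) : IsSymm (linOp ξ) := by
  intro f g
  have := (isFlow_weyl ξ).isSymm f g
  simpa using this

theorem isSymm_quad {n : ℕ} (k : QIdx n) : IsSymm (quad k) := by
  have : linOp (Pi.single k 1) = quad k := by
    rw [linOp, Finset.sum_eq_single k] <;> simp +contextual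
  rw [← this]
  exact isSymm_linOp _

/-- A second-order remainder for all directions at once: quadratic in `ξ`, it upgrades derivatives
along rays to a Fréchet derivative at the origin. -/
theorem norm_weyl_sub_le {n : ℕ} (ξ : QIdx n → ℝ) (f : Core n) :
    ‖coreIncl n ((weyl ξ).1 f) - coreIncl n f - Complex.I • coreIncl n (linOp ξ f)‖
      ≤ ‖coreIncl n (linOp ξ (linOp ξ f))‖ := by
  have hfl := isFlow_weyl ξ
  have hd : ∀ s : ℝ, HasDerivAt (fun s : ℝ => lift (weyl (s • ξ)) (coreIncl n f)
      - s • (Complex.I • coreIncl n (linOp ξ f)))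
      (lift (weyl (s • ξ)) (-Complex.I • coreIncl n ((-linOp ξ) f))
        - (1 : ℝ) • (Complex.I • coreIncl n (linOp ξ f))) s := fun s =>
    (hfl.hasDerivAt f s).sub ((hasDerivAt_id s).smul_const _)
  have hb : ∀ s ∈ Set.Icc (0 : ℝ) 1, ‖lift (weyl (s • ξ)) (-Complex.I • coreIncl n ((-linOp ξ) f))
        - (1 : ℝ) • (Complex.I • coreIncl n (linOp ξ f))‖ ≤ ‖coreIncl n (linOp ξ (linOp ξ f))‖ := by
    intro s hs
    have h1 := norm_sub_le_of_flow hfl s (linOp ξ f)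
    have h2 : lift (weyl (s • ξ)) (-Complex.I • coreIncl n ((-linOp ξ) f))
        - (1 : ℝ) • (Complex.I • coreIncl n (linOp ξ f))
        = Complex.I • (lift (weyl (s • ξ)) (coreIncl n (linOp ξ f)) - coreIncl n (linOp ξ f)) := by
      rw [LinearMap.neg_apply, map_neg, smul_neg, neg_smul, neg_neg, map_smul, one_smul, smul_sub]
    rw [h2, norm_smul, Complex.norm_I, one_mul]
    refine h1.trans ?_
    rw [LinearMap.neg_apply, map_neg, norm_neg, abs_of_nonneg hs.1]
    exact mul_le_of_le_one_left (norm_nonneg _) hs.2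
  have := (convex_Icc (0 : ℝ) 1).norm_image_sub_le_of_norm_hasDerivWithin_le
    (fun s _ => (hd s).hasDerivWithinAt) hb (Set.left_mem_Icc.2 zero_le_one)
    (Set.right_mem_Icc.2 zero_le_one)
  simp only [one_smul, zero_smul, weyl_zero, map_one, sub_zero, norm_one, mul_one,
    lift_apply] at this
  refine le_trans (le_of_eq ?_) this
  congr 1
  change _ - _ - _ = _ - _ - coreIncl n f
  abel

/-- The derivative at the origin of `ξ ↦ weyl ξ f`. -/
def weylDeriv {n : ℕ} (f : Core n) : (QIdx n → ℝ) →L[ℝ] Modes n :=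
  LinearMap.toContinuousLinearMap
    { toFun := fun ξ => Complex.I • coreIncl n (linOp ξ f)
      map_add' := fun ξ η => by rw [linOp_add, LinearMap.add_apply, map_add, smul_add]
      map_smul' := fun s ξ => by
        rw [linOp_smul, LinearMap.smul_apply, map_smul, RingHom.id_apply, real_smul_modes,
          smul_comm] }

theorem hasFDerivAt_weyl_zero {n : ℕ} (f : Core n) :
    HasFDerivAt (fun ξ => lift (weyl ξ) (coreIncl n f)) (weylDeriv f) 0 := by
  have hC : ∃ C, ∀ ξ : QIdx n → ℝ, ‖coreIncl n (linOp ξ (linOp ξ f))‖ ≤ C * ‖ξ‖ ^ 2 := by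
    refine ⟨∑ k : QIdx n, ∑ l : QIdx n, ‖coreIncl n (quad l (quad k f))‖, fun ξ => ?_⟩
    have e : coreIncl n (linOp ξ (linOp ξ f))
        = ∑ k, ∑ l, ((ξ k : ℂ) * (ξ l : ℂ)) • coreIncl n (quad l (quad k f)) := by
      simp only [linOp_apply, map_sum, map_smul, Finset.smul_sum, smul_smul]
    rw [e, Finset.sum_mul]
    refine (norm_sum_le _ _).trans (Finset.sum_le_sum fun k _ => ?_)
    rw [Finset.sum_mul]
    refine (norm_sum_le _ _).trans (Finset.sum_le_sum fun l _ => ?_)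
    rw [norm_smul, norm_mul, Complex.norm_real, Complex.norm_real, mul_comm, sq]
    gcongr
    · exact norm_le_pi_norm ξ k
    · exact norm_le_pi_norm ξ l
  obtain ⟨C, hC⟩ := hC
  rw [hasFDerivAt_iff_isLittleO_nhds_zero]
  refine Asymptotics.IsBigO.trans_isLittleO (g := fun ξ : QIdx n → ℝ => ‖ξ‖ ^ 2) ?_ ?_
  · refine Asymptotics.IsBigO.of_bound C (Filter.Eventually.of_forall fun ξ => ?_)
    rw [Real.norm_of_nonneg (sq_nonneg _)]
    refine le_trans (le_of_eq ?_) ((norm_weyl_sub_le ξ f).trans (hC ξ))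
    rw [zero_add, lift_apply, lift_apply, weyl_zero]
    rfl
  · simpa using (Asymptotics.isLittleO_norm_pow_id (E' := QIdx n → ℝ) one_lt_two)

/-- The Weyl relation factors `weyl (ξ r)` into a scalar, `weyl (ξ s)` and `weyl (ξ r - ξ s)`. Only
the derivative at the origin is then needed, and the scalar produces the term with `omega`. -/
theorem hasDerivAt_weyl_curve {n : ℕ} {ξ : ℝ → QIdx n → ℝ} {ξ' : QIdx n → ℝ} {s : ℝ}
    (hξ : HasDerivAt ξ ξ' s) (f : Core n) :
    HasDerivAt (fun r => lift (weyl (ξ r)) (coreIncl n f))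
      (coreIncl n ((weyl (ξ s)).1
        ((Complex.I * (omega (ξ s) ξ' / 2 : ℝ)) • f + Complex.I • linOp ξ' f))) s := by
  have h1 : HasDerivAt (fun r => ξ r - ξ s) ξ' s := hξ.sub_const _
  have h2 := (hasFDerivAt_weyl_zero f).comp_hasDerivAt_of_eq s h1 (by simp)
  have h3 := ((lift (weyl (ξ s))).toContinuousLinearEquiv.toContinuousLinearMap.restrictScalars
      ℝ).hasFDerivAt.comp_hasDerivAt s h2
  have h4 : HasDerivAt (fun r => omega (ξ s) (ξ r - ξ s) / 2) (omega (ξ s) ξ' / 2) s := by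
    simp only [omega_eq_dotProduct]
    have : HasDerivAt (fun r => ξ s ⬝ᵥ (Omega n *ᵥ (ξ r - ξ s))) (ξ s ⬝ᵥ (Omega n *ᵥ ξ')) s :=
      (LinearMap.toContinuousLinearMap ((dotProductBilin ℝ ℝ (ξ s)) ∘ₗ
        (Omega n).mulVecLin)).hasFDerivAt.comp_hasDerivAt s h1
    exact this.div_const 2
  have h5 := (h4.ofReal_comp.const_mul Complex.I).cexp
  have h6 := h5.smul h3
  refine (h6.congr_of_eventuallyEq (Filter.Eventually.of_forall fun r => ?_)).congr_deriv ?_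
  · show lift (weyl (ξ r)) (coreIncl n f) = Complex.exp _ • lift (weyl (ξ s)) (lift (weyl (ξ r - ξ s)) (coreIncl n f))
    rw [← lift_weyl_add_apply, add_sub_cancel]
  · have h0 : omega (ξ s) (0 : QIdx n → ℝ) = 0 := by simp [omega_eq_dotProduct]
    simp only [sub_self, h0, Function.comp_apply, weyl_zero, map_one]
    show _ • lift (weyl (ξ s)) (Complex.I • coreIncl n (linOp ξ' f))
      + _ • lift (weyl (ξ s)) (coreIncl n f) = _
    simp only [map_add, map_smul, lift_apply]
    simp
    rw [add_comm]

/-! ### Gaussian Schwartz functions -/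

/-- Parameters `(τ, c)` of the quadratic polynomial `-½ xᵀ τ x + c`. -/
abbrev GaussParam (n : ℕ) : Type := (Fin n → Fin n → ℂ) × ℂ

/-- The quadratic polynomial `-½ xᵀ τ x + c`. -/
def gaussPoly {n : ℕ} (p : GaussParam n) (x : EuclideanSpace ℝ (Fin n)) : ℂ :=
  -(1 / 2) * ∑ i, ∑ j, p.1 i j * ((x i : ℝ) : ℂ) * ((x j : ℝ) : ℂ) + p.2

theorem hasTemperateGrowth_coord {n : ℕ} (i : Fin n) :
    (fun x : EuclideanSpace ℝ (Fin n) => ((x i : ℝ) : ℂ)).HasTemperateGrowth :=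
  (Complex.ofRealCLM.comp (EuclideanSpace.proj i :
      EuclideanSpace ℝ (Fin n) →L[ℝ] ℝ)).hasTemperateGrowth

theorem hasTemperateGrowth_gaussPoly {n : ℕ} (p : GaussParam n) :
    (gaussPoly p).HasTemperateGrowth := by
  unfold gaussPoly
  refine ((Function.HasTemperateGrowth.const _).mul (.sum fun i _ => .sum fun j _ =>
    ((Function.HasTemperateGrowth.const _).mul (hasTemperateGrowth_coord i)).mul
      (hasTemperateGrowth_coord j))).add (.const _)

theorem gaussPoly_add {n : ℕ} (p q : GaussParam n) (x : EuclideanSpace ℝ (Fin n)) :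
    gaussPoly (p + q) x = gaussPoly p x + gaussPoly q x := by
  simp only [gaussPoly, Prod.fst_add, Prod.snd_add, Pi.add_apply, add_mul, Finset.sum_add_distrib]
  ring

theorem gaussPoly_smul {n : ℕ} (s : ℝ) (p : GaussParam n) (x : EuclideanSpace ℝ (Fin n)) :
    gaussPoly (s • p) x = s * gaussPoly p x := by
  simp only [gaussPoly, Prod.smul_fst, Prod.smul_snd, Pi.smul_apply, Complex.real_smul, mul_assoc,
    ← Finset.mul_sum]
  ring

theorem norm_gaussPoly_le {n : ℕ} (p : GaussParam n) (x : EuclideanSpace ℝ (Fin n)) :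
    ‖gaussPoly p x‖ ≤ ((n : ℝ) ^ 2 + 1) * ‖p‖ * (1 + ‖x‖ ^ 2) := by
  have h1 : ∀ i j, ‖p.1 i j * ((x i : ℝ) : ℂ) * ((x j : ℝ) : ℂ)‖ ≤ ‖p‖ * ‖x‖ ^ 2 := by
    intro i j
    rw [norm_mul, norm_mul, Complex.norm_real, Complex.norm_real, mul_assoc, sq]
    have h2 : ‖p.1 i j‖ ≤ ‖p‖ :=
      (norm_le_pi_norm _ j).trans ((norm_le_pi_norm _ i).trans (norm_fst_le p))
    gcongr
    · exact PiLp.norm_apply_le x i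
    · exact PiLp.norm_apply_le x j
  have h3 : ‖∑ i, ∑ j, p.1 i j * ((x i : ℝ) : ℂ) * ((x j : ℝ) : ℂ)‖
      ≤ (n : ℝ) ^ 2 * (‖p‖ * ‖x‖ ^ 2) := by
    refine (norm_sum_le _ _).trans ((Finset.sum_le_sum fun i _ => (norm_sum_le _ _).trans
      (Finset.sum_le_sum fun j _ => h1 i j)).trans (le_of_eq ?_))
    simp; ring
  have h4 := norm_snd_le p
  have h5 : 0 ≤ (n : ℝ) ^ 2 * ‖p‖ := by positivity
  have h6 : 0 ≤ ‖p‖ * ‖x‖ ^ 2 := by positivity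
  have h7 : 0 ≤ (n : ℝ) ^ 2 * (‖p‖ * ‖x‖ ^ 2) := by positivity
  calc ‖gaussPoly p x‖ ≤ ‖-(1 / 2 : ℂ)‖ * ((n : ℝ) ^ 2 * (‖p‖ * ‖x‖ ^ 2)) + ‖p‖ := by
        unfold gaussPoly
        refine (norm_add_le _ _).trans (add_le_add ?_ h4)
        rw [norm_mul]
        gcongr
    _ ≤ _ := by
        have : ‖-(1 / 2 : ℂ)‖ = 1 / 2 := by simp
        rw [this]
        nlinarith

/-- The polynomial `-½ xᵀ τ x + c` has a negative definite real part. -/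
def IsDecaying {n : ℕ} (p : GaussParam n) : Prop :=
  ∃ ε > 0, ∃ c : ℝ, ∀ x, (gaussPoly p x).re ≤ -ε * ‖x‖ ^ 2 + c

open Classical in
/-- The Gaussian `exp (-½ xᵀ τ x + c)`. -/
def gauss {n : ℕ} (p : GaussParam n) : Core n :=
  if h : IsDecaying p then expSchwartz (gaussPoly p) (hasTemperateGrowth_gaussPoly p) h else 0

theorem gauss_apply {n : ℕ} {p : GaussParam n} (h : IsDecaying p) (x : EuclideanSpace ℝ (Fin n)) :
    gauss p x = Complex.exp (gaussPoly p x) := by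
  rw [gauss, dif_pos h]
  rfl

/-- Multiplication by `-½ xᵀ τ x + c`. -/
def polyMul {n : ℕ} (p : GaussParam n) (f : Core n) : Core n :=
  SchwartzMap.smulLeftCLM ℂ (gaussPoly p) f

theorem polyMul_apply {n : ℕ} (p : GaussParam n) (f : Core n) (x : EuclideanSpace ℝ (Fin n)) :
    polyMul p f x = gaussPoly p x * f x :=
  smulLeftCLM_apply_apply (hasTemperateGrowth_gaussPoly p) f x

/-- The derivative of `gauss` with respect to the parameters. -/
def gaussDeriv {n : ℕ} (f : Core n) : GaussParam n →L[ℝ] Modes n :=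
  LinearMap.toContinuousLinearMap
    { toFun := fun p => coreIncl n (polyMul p f)
      map_add' := fun p q => by
        rw [← map_add]
        congr 1
        ext x
        rw [add_apply, polyMul_apply, polyMul_apply, polyMul_apply, gaussPoly_add, add_mul]
      map_smul' := fun s p => by
        rw [RingHom.id_apply, real_smul_modes, ← map_smul]
        congr 1
        ext x
        rw [smul_apply, polyMul_apply, polyMul_apply, gaussPoly_smul, smul_eq_mul, mul_assoc] }

/-- The remainder is governed by `|exp z - 1 - z| ≤ |z|² exp |z|` with `z` the perturbing quadratic.
For small perturbations it is dominated by `‖q‖²` times one fixed Schwartz function, so the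
derivative exists in `L²`. -/
theorem hasFDerivAt_gauss {n : ℕ} {p : GaussParam n} (hp : IsDecaying p) :
    HasFDerivAt (fun q => coreIncl n (gauss q)) (gaussDeriv (gauss p)) p := by
  obtain ⟨ε, hε, c, h⟩ := id hp
  set K : ℝ := (n : ℝ) ^ 2 + 1 with hK
  have hKpos : 0 < K := by positivity
  have hg : (fun x : EuclideanSpace ℝ (Fin n) => ((-(ε / 2) * ‖x‖ ^ 2 : ℝ) : ℂ)).HasTemperateGrowth :=
    HasTemperateGrowth.ofReal_comp (by fun_prop)
  -- Half of the decay rate is kept; the other half pays for the factor `exp |z|`.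
  let G : Core n := expSchwartz (fun x => ((-(ε / 2) * ‖x‖ ^ 2 : ℝ) : ℂ)) hg
    ⟨ε / 2, by positivity, 0, fun x => by simp [-Complex.ofReal_mul, -Complex.ofReal_neg]⟩
  let B : Core n := mulOp (fun x => (1 + ‖x‖ ^ 2) ^ 2) G
  have hB : ∀ x, ‖B x‖ = (1 + ‖x‖ ^ 2) ^ 2 * Real.exp (-(ε / 2) * ‖x‖ ^ 2) := fun x => by
    show ‖mulOp _ G x‖ = _
    rw [mulOp_apply (by fun_prop), norm_mul, Complex.norm_real,
      Real.norm_of_nonneg (by positivity), expSchwartz_apply, Complex.norm_exp, Complex.ofReal_re]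
  have hsmall : ∀ᶠ q : GaussParam n in nhds 0, K * ‖q‖ < ε / 2 := by
    have : Filter.Tendsto (fun q : GaussParam n => K * ‖q‖) (nhds 0) (nhds (K * ‖(0 : GaussParam n)‖)) :=
      (by fun_prop : Continuous fun q : GaussParam n => K * ‖q‖).tendsto 0
    rw [norm_zero, mul_zero] at this
    exact this.eventually_lt_const (by positivity)
  rw [hasFDerivAt_iff_isLittleO_nhds_zero]
  refine Asymptotics.IsBigO.trans_isLittleO (g := fun q : GaussParam n => ‖q‖ ^ 2) ?_ ?_
  swap
  · simpa using (Asymptotics.isLittleO_norm_pow_id (E' := GaussParam n) one_lt_two)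
  refine Asymptotics.IsBigO.of_bound (K ^ 2 * Real.exp (c + ε / 2) * ‖coreIncl n B‖) ?_
  filter_upwards [hsmall] with q hq
  have hz : ∀ x, ‖gaussPoly q x‖ ≤ K * ‖q‖ * (1 + ‖x‖ ^ 2) := norm_gaussPoly_le q
  have hz2 : ∀ x : EuclideanSpace ℝ (Fin n), K * ‖q‖ * (1 + ‖x‖ ^ 2) ≤ ε / 2 * (1 + ‖x‖ ^ 2) :=
    fun x => by gcongr
  have hpq : IsDecaying (p + q) := by
    refine ⟨ε / 2, by positivity, c + ε / 2, fun x => ?_⟩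
    rw [gaussPoly_add, Complex.add_re]
    have h1 := h x
    have h2 := (Complex.re_le_norm (gaussPoly q x)).trans ((hz x).trans (hz2 x))
    linarith
  have e : coreIncl n (gauss (p + q)) - coreIncl n (gauss p) - gaussDeriv (gauss p) q
      = coreIncl n (gauss (p + q) - gauss p - polyMul q (gauss p)) := by
    rw [map_sub, map_sub]; rfl
  rw [e, Real.norm_of_nonneg (by positivity)]
  refine (norm_coreIncl_le (C := K ^ 2 * Real.exp (c + ε / 2) * ‖q‖ ^ 2) (g := B) fun x => ?_).trans_eq
    (by ring)
  have e2 : (gauss (p + q) - gauss p - polyMul q (gauss p)) x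
      = Complex.exp (gaussPoly p x) * (Complex.exp (gaussPoly q x) - 1 - gaussPoly q x) := by
    rw [sub_apply, sub_apply, polyMul_apply, gauss_apply hp, gauss_apply hpq, gaussPoly_add,
      Complex.exp_add]
    ring
  have e3 : ‖Complex.exp (gaussPoly q x) - 1 - gaussPoly q x‖
      ≤ ‖gaussPoly q x‖ ^ 2 * Real.exp ‖gaussPoly q x‖ := by
    have := Complex.norm_exp_sub_sum_le_norm_mul_exp (gaussPoly q x) 2
    simp only [Finset.sum_range_succ, Finset.sum_range_zero] at this
    simpa [sub_sub] using this
  rw [e2, norm_mul, Complex.norm_exp, hB]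
  calc Real.exp (gaussPoly p x).re * ‖Complex.exp (gaussPoly q x) - 1 - gaussPoly q x‖
      ≤ Real.exp (-ε * ‖x‖ ^ 2 + c) * ((K * ‖q‖ * (1 + ‖x‖ ^ 2)) ^ 2
          * Real.exp (ε / 2 * (1 + ‖x‖ ^ 2))) := by
        gcongr
        · exact h x
        · refine e3.trans ?_
          gcongr
          · exact hz x
          · exact (hz x).trans (hz2 x)
    _ = _ := by
        have : Real.exp (-ε * ‖x‖ ^ 2 + c) * Real.exp (ε / 2 * (1 + ‖x‖ ^ 2))
            = Real.exp (c + ε / 2) * Real.exp (-(ε / 2) * ‖x‖ ^ 2) := by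
          rw [← Real.exp_add, ← Real.exp_add]; congr 1; ring
        linear_combination ((K * ‖q‖ * (1 + ‖x‖ ^ 2)) ^ 2) * this

/-! ### Coherent functions -/

/-- The Gaussian `exp (-½ ‖x‖ ^ 2)`, proportional to the vacuum. -/
def coh0 (n : ℕ) : Core n := gauss (fun i j => if i = j then 1 else 0, 0)

theorem gaussPoly_one {n : ℕ} (x : EuclideanSpace ℝ (Fin n)) :
    gaussPoly (fun i j => if i = j then 1 else 0, 0) x = ((-‖x‖ ^ 2 / 2 : ℝ) : ℂ) := by
  rw [EuclideanSpace.real_norm_sq_eq]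
  simp only [gaussPoly, ite_mul, one_mul, zero_mul, Finset.sum_ite_eq, Finset.mem_univ, if_true]
  push_cast
  rw [neg_div, Finset.sum_congr rfl fun i _ => (sq ((x i : ℝ) : ℂ)).symm]
  ring

theorem isDecaying_one {n : ℕ} :
    IsDecaying (n := n) (fun i j => if i = j then 1 else 0, 0) :=
  ⟨1 / 2, by norm_num, 0, fun x => by rw [gaussPoly_one, Complex.ofReal_re]; linarith⟩

theorem coh0_apply {n : ℕ} (x : EuclideanSpace ℝ (Fin n)) :
    coh0 n x = Complex.exp ((-‖x‖ ^ 2 / 2 : ℝ) : ℂ) := by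
  rw [coh0, gauss_apply isDecaying_one, gaussPoly_one]

/-- The function `exp (-½ ‖x‖ ^ 2 + i ⟨a, x⟩)`. -/
def coh {n : ℕ} (a : EuclideanSpace ℝ (Fin n)) : Core n :=
  (phase (fun x => inner ℝ a x) (by fun_prop)).1 (coh0 n)

theorem coh_apply {n : ℕ} (a x : EuclideanSpace ℝ (Fin n)) :
    coh a x = Complex.exp (Complex.I * (inner ℝ a x : ℝ) + ((-‖x‖ ^ 2 / 2 : ℝ) : ℂ)) := by
  rw [coh, phase_apply, coh0_apply, Complex.exp_add]

/-- The pairings with coherent functions are the Fourier transform of the integrable function `conj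
ψ * exp (-‖x‖² / 2)`. If it vanishes, so does the function, and the Gaussian has no zeros. -/
theorem eq_zero_of_inner_coh {n : ℕ} {ψ : Modes n} (h : ∀ a, ⟪ψ, coreIncl n (coh a)⟫_ℂ = 0) :
    ψ = 0 := by
  set u : EuclideanSpace ℝ (Fin n) → ℂ := fun x => (starRingEnd ℂ) (ψ x) * coh0 n x with hu
  have hint : Integrable u := by
    have := L2.integrable_inner (𝕜 := ℂ) ψ (coreIncl n (coh0 n))
    refine this.congr ?_
    filter_upwards [(coh0 n).coeFn_toLp 2 volume] with x hx
    show inner ℂ (ψ x) ((coh0 n).toLp 2 volume x) = _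
    rw [hx, RCLike.inner_apply, mul_comm]
  have hf : ∀ ξ, FourierTransform.fourier u ξ = 0 := by
    intro ξ
    -- The factor converts the phase `⟨a, x⟩` of `coh a` into the phase `-2π ⟨ξ, x⟩` of the Fourier
    -- integral.
    have h1 := h (-(2 * Real.pi) • ξ)
    rw [L2.inner_def] at h1
    rw [Real.fourier_eq', ← h1]
    refine integral_congr_ae ?_
    filter_upwards [(coh (-(2 * Real.pi) • ξ)).coeFn_toLp 2 volume] with x hx
    show _ = inner ℂ (ψ x) ((coh (-(2 * Real.pi) • ξ)).toLp 2 volume x)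
    have hux : u x = (starRingEnd ℂ) (ψ x) * Complex.exp ((-‖x‖ ^ 2 / 2 : ℝ) : ℂ) := by
      rw [hu, ← coh0_apply]
    rw [hx, RCLike.inner_apply, coh_apply, Complex.exp_add, hux, smul_eq_mul,
      inner_smul_left, real_inner_comm, mul_comm Complex.I]
    simp only [conj_trivial, neg_mul]
    ring
  have hz : ∀ᵐ x, u x = 0 := by
    refine ae_eq_zero_of_integral_contDiff_smul_eq_zero hint.locallyIntegrable fun g hg hgs => ?_
    have hgs' : HasCompactSupport fun x => (g x : ℂ) := hgs.comp_left (g := Complex.ofReal) rfl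
    let G : Core n := hgs'.toSchwartzMap (Complex.ofRealCLM.contDiff.comp hg)
    -- The test function is itself a Fourier transform, so the multiplication formula turns its
    -- integral against `u` into one against the transform of `u`.
    have h2 := VectorFourier.integral_fourierIntegral_smul_eq_flip (V := EuclideanSpace ℝ (Fin n))
      (W := EuclideanSpace ℝ (Fin n)) (L := innerₗ (EuclideanSpace ℝ (Fin n)))
      (μ := volume) (ν := volume) Real.continuous_fourierChar continuous_inner hint
      (FourierTransform.fourierInv G : Core n).integrable
    have h3 : ∀ x, VectorFourier.fourierIntegral Real.fourierChar volume
        (innerₗ (EuclideanSpace ℝ (Fin n))).flip (FourierTransform.fourierInv G : Core n) x = G x := by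
      intro x
      rw [flip_innerₗ]
      have : FourierTransform.fourier (FourierTransform.fourierInv G : Core n) = G :=
        FourierTransform.fourier_fourierInv_eq G
      conv_rhs => rw [← this]
      rfl
    have h4 : ∀ ξ, VectorFourier.fourierIntegral Real.fourierChar volume
        (innerₗ (EuclideanSpace ℝ (Fin n))) u ξ = 0 := hf
    simp only [h3, h4, zero_smul, integral_zero] at h2
    rw [h2]
    refine integral_congr_ae (Filter.Eventually.of_forall fun x => ?_)
    show g x • u x = u x • (g x : ℂ)
    rw [Complex.real_smul, smul_eq_mul, mul_comm]
  rw [Lp.eq_zero_iff_ae_eq_zero]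
  filter_upwards [hz] with x hx
  have : (starRingEnd ℂ) (ψ x) = 0 := by
    refine (mul_eq_zero.1 hx).resolve_right ?_
    rw [coh0_apply]
    exact Complex.exp_ne_zero _
  simpa using this

/-- Continuous linear operators agreeing on coherent functions agree. -/
theorem ext_coh {n : ℕ} {F : Type*} [NormedAddCommGroup F] [NormedSpace ℂ F]
    {A B : Modes n →L[ℂ] F} (h : ∀ a, A (coreIncl n (coh a)) = B (coreIncl n (coh a))) : A = B := by
  have hd : (Submodule.span ℂ (Set.range fun a => coreIncl n (coh a))).topologicalClosure = ⊤ := by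
    rw [Submodule.topologicalClosure_eq_top_iff, Submodule.eq_bot_iff]
    intro v hv
    refine eq_zero_of_inner_coh fun a => ?_
    rw [← inner_conj_symm, hv _ (Submodule.subset_span ⟨a, rfl⟩), map_zero]
  refine ContinuousLinearMap.ext_on (s := Set.range fun a => coreIncl n (coh a)) ?_ ?_
  · rw [Submodule.dense_iff_topologicalClosure_eq_top]; exact hd
  · rintro _ ⟨a, rfl⟩; exact h a

/-! ### Quadratic Hamiltonians acting on Gaussians -/

/-- The coefficients of the linear form `ℓ_k` with `R_k g = ℓ_k g` for `g = exp (-½ xᵀ τ x + c)`. -/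
def ell {n : ℕ} (τ : Fin n → Fin n → ℂ) (k : QIdx n) (i : Fin n) : ℂ :=
  if k.2 = 0 then (if k.1 = i then 1 else 0) else Complex.I * ((τ k.1 i + τ i k.1) / 2)

/-- The constants with `R_k R_l g = (ℓ_k ℓ_l + κ_{kl}) g` for `g = exp (-½ xᵀ τ x + c)`. -/
def kap {n : ℕ} (τ : Fin n → Fin n → ℂ) (k l : QIdx n) : ℂ :=
  if k.2 = 0 then 0 else -Complex.I * ell τ l k.1

/-- The vector field on Gaussian parameters induced by the quadratic Hamiltonian `½ Rᵀ h R`. -/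
def gaussField {n : ℕ} (h : Matrix (QIdx n) (QIdx n) ℝ) (p : GaussParam n) : GaussParam n :=
  (fun i j => Complex.I * ∑ k, ∑ l, (h k l : ℂ) * (ell p.1 k i * ell p.1 l j),
    -(Complex.I / 2) * ∑ k, ∑ l, (h k l : ℂ) * kap p.1 k l)

theorem contDiff_ell {n : ℕ} (k : QIdx n) (i : Fin n) :
    ContDiff ℝ 1 fun p : GaussParam n => ell p.1 k i := by
  unfold ell
  split_ifs
  · exact contDiff_const
  · exact contDiff_const
  · fun_prop

theorem contDiff_gaussField {n : ℕ} (h : Matrix (QIdx n) (QIdx n) ℝ) :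
    ContDiff ℝ 1 (gaussField h) := by
  unfold gaussField
  refine ContDiff.prodMk ?_ ?_
  · refine contDiff_pi.2 fun i => contDiff_pi.2 fun j => contDiff_const.mul
      (ContDiff.sum fun k _ => ContDiff.sum fun l _ => contDiff_const.mul
        ((contDiff_ell k i).mul (contDiff_ell l j)))
  · refine contDiff_const.mul (ContDiff.sum fun k _ => ContDiff.sum fun l _ =>
      contDiff_const.mul ?_)
    unfold kap
    split_ifs
    · exact contDiff_const
    · exact contDiff_const.mul (contDiff_ell l k.1)

theorem hasFDerivAt_coord {n : ℕ} (i : Fin n) (x : EuclideanSpace ℝ (Fin n)) :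
    HasFDerivAt (fun x : EuclideanSpace ℝ (Fin n) => ((x i : ℝ) : ℂ))
      (Complex.ofRealCLM.comp (EuclideanSpace.proj i : EuclideanSpace ℝ (Fin n) →L[ℝ] ℝ)) x :=
  (Complex.ofRealCLM.comp (EuclideanSpace.proj i :
      EuclideanSpace ℝ (Fin n) →L[ℝ] ℝ)).hasFDerivAt

theorem fderiv_gaussPoly {n : ℕ} (p : GaussParam n) (x v : EuclideanSpace ℝ (Fin n)) :
    HasFDerivAt (gaussPoly p) (fderiv ℝ (gaussPoly p) x) x ∧
    fderiv ℝ (gaussPoly p) x v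
      = -(1 / 2) * ∑ i, ∑ j, p.1 i j * (((x i : ℝ) : ℂ) * ((v j : ℝ) : ℂ)
        + ((v i : ℝ) : ℂ) * ((x j : ℝ) : ℂ)) := by
  have h := (HasFDerivAt.fun_sum (u := Finset.univ) fun i _ =>
    HasFDerivAt.fun_sum (u := Finset.univ) fun j _ =>
      ((hasFDerivAt_coord i x).const_mul (p.1 i j)).mul
      (hasFDerivAt_coord j x)).const_mul (-(1 / 2) : ℂ) |>.add_const p.2
  have h' : HasFDerivAt (gaussPoly p) _ x := h
  refine ⟨h'.differentiableAt.hasFDerivAt, ?_⟩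
  rw [h'.fderiv]
  simp only [smul_apply, sum_apply,
    add_apply, smul_eq_mul, ContinuousLinearMap.comp_apply]
  congr 1
  refine Finset.sum_congr rfl fun i _ => Finset.sum_congr rfl fun j _ => ?_
  simp
  ring

/-- The linear form `ℓ_k`. -/
def ellForm {n : ℕ} (τ : Fin n → Fin n → ℂ) (k : QIdx n) (x : EuclideanSpace ℝ (Fin n)) : ℂ :=
  ∑ i, ell τ k i * ((x i : ℝ) : ℂ)

theorem fderiv_gauss {n : ℕ} {p : GaussParam n} (hp : IsDecaying p) (j : Fin n)
    (x : EuclideanSpace ℝ (Fin n)) :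
    -Complex.I * fderiv ℝ (gauss p) x (EuclideanSpace.single j 1)
      = ellForm p.1 (j, 1) x * gauss p x := by
  have h1 := (fderiv_gaussPoly p x (EuclideanSpace.single j 1)).1.cexp
  have h2 := (h1.congr_of_eventuallyEq
    (Filter.Eventually.of_forall fun y => gauss_apply hp y)).fderiv
  rw [h2, smul_apply, (fderiv_gaussPoly p x _).2, gauss_apply hp, smul_eq_mul]
  have e : ∑ i, ∑ l, p.1 i l * (((x i : ℝ) : ℂ) * (((EuclideanSpace.single j (1 : ℝ)) l : ℝ) : ℂ)
        + (((EuclideanSpace.single j (1 : ℝ)) i : ℝ) : ℂ) * ((x l : ℝ) : ℂ))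
      = ∑ i, (p.1 j i + p.1 i j) * ((x i : ℝ) : ℂ) := by
    have s1 : ∀ i, (((EuclideanSpace.single j (1 : ℝ)) i : ℝ) : ℂ) = if i = j then 1 else 0 := by
      intro i
      by_cases hij : i = j <;> simp [hij]
    simp only [s1, mul_add, Finset.sum_add_distrib, mul_ite, ite_mul, mul_one, mul_zero, zero_mul,
      one_mul, Finset.sum_ite_eq', Finset.mem_univ, if_true, add_mul]
    rw [add_comm]
    congr 1
    rw [Finset.sum_comm]
    simp
  rw [e, ellForm]
  have e2 : ∀ i, ell p.1 (j, 1) i = Complex.I / 2 * (p.1 j i + p.1 i j) := fun i => by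
    simp [ell]; ring
  simp only [e2, mul_assoc, ← Finset.mul_sum]
  ring

theorem quad_gauss {n : ℕ} {p : GaussParam n} (hp : IsDecaying p) (k : QIdx n)
    (x : EuclideanSpace ℝ (Fin n)) :
    quad k (gauss p) x = ellForm p.1 k x * gauss p x := by
  obtain ⟨j, i⟩ := k
  fin_cases i
  · show position j _ x = _
    rw [position_apply]
    simp [ellForm, ell]
  · show momentum j _ x = _
    rw [momentum_apply_fderiv, fderiv_gauss hp]
    rfl

theorem quad_quad_gauss {n : ℕ} {p : GaussParam n} (hp : IsDecaying p) (k l : QIdx n)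
    (x : EuclideanSpace ℝ (Fin n)) :
    quad k (quad l (gauss p)) x
      = (ellForm p.1 k x * ellForm p.1 l x + kap p.1 k l) * gauss p x := by
  obtain ⟨j, i⟩ := k
  fin_cases i
  · show position j _ x = _
    rw [position_apply, quad_gauss hp]
    simp [ellForm, ell, kap, mul_assoc]
  · show momentum j _ x = _
    rw [momentum_apply_fderiv]
    have h1 : HasFDerivAt (ellForm p.1 l) (∑ i, ell p.1 l i • (Complex.ofRealCLM.comp
        (EuclideanSpace.proj i : EuclideanSpace ℝ (Fin n) →L[ℝ] ℝ))) x :=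
      HasFDerivAt.fun_sum fun i _ => (hasFDerivAt_coord i x).const_mul _
    have h2 := h1.mul ((gauss p).hasFDerivAt x)
    rw [(h2.congr_of_eventuallyEq (Filter.Eventually.of_forall fun y => quad_gauss hp l y)).fderiv]
    have e : (∑ i, ell p.1 l i • (Complex.ofRealCLM.comp
        (EuclideanSpace.proj i : EuclideanSpace ℝ (Fin n) →L[ℝ] ℝ)))
          (EuclideanSpace.single j (1 : ℝ)) = ell p.1 l j := by
      rw [sum_apply, Finset.sum_eq_single j]
      · simp
      · intro b _ hb
        simp [hb]
      · simp
    have h3 := fderiv_gauss hp j x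
    simp only [add_apply, smul_apply, smul_eq_mul, e]
    have hk : kap p.1 (j, 1) l = -Complex.I * ell p.1 l j := by simp [kap]
    show _ = (ellForm p.1 (j, 1) x * _ + kap p.1 (j, 1) l) * _
    rw [hk]
    linear_combination ellForm p.1 l x * h3

theorem quadraticHam_zero_apply {n : ℕ} (h : Matrix (QIdx n) (QIdx n) ℝ) (f : Core n) :
    quadraticHam h 0 f = (1 / 2 : ℂ) • ∑ k, ∑ l, (h k l : ℂ) • quad k (quad l f) := by
  simp [quadraticHam, LinearMap.sum_apply]

/-- A quadratic Hamiltonian multiplies a Gaussian by a quadratic polynomial. The Schrödinger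
equation therefore closes on Gaussians and becomes an ordinary differential equation of Riccati type
for the parameters. -/
theorem polyMul_gaussField {n : ℕ} (h : Matrix (QIdx n) (QIdx n) ℝ) {p : GaussParam n}
    (hp : IsDecaying p) :
    polyMul (gaussField h p) (gauss p) = -Complex.I • quadraticHam h 0 (gauss p) := by
  ext x
  rw [polyMul_apply, quadraticHam_zero_apply, smul_apply, smul_apply, sum_apply]
  have e : ∀ k, (∑ l, (h k l : ℂ) • quad k (quad l (gauss p))) x
      = (∑ l, (h k l : ℂ) * (ellForm p.1 k x * ellForm p.1 l x + kap p.1 k l)) * gauss p x := by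
    intro k
    rw [sum_apply, Finset.sum_mul]
    refine Finset.sum_congr rfl fun l _ => ?_
    rw [smul_apply, quad_quad_gauss hp, smul_eq_mul, mul_assoc]
  simp only [e, ← Finset.sum_mul, smul_eq_mul, ← mul_assoc]
  congr 1
  have e2 : ∑ i, ∑ j, (∑ k, ∑ l, (h k l : ℂ) * (ell p.1 k i * ell p.1 l j)) * ((x i : ℝ) : ℂ)
      * ((x j : ℝ) : ℂ) = ∑ k, ∑ l, (h k l : ℂ) * (ellForm p.1 k x * ellForm p.1 l x) := by
    simp only [ellForm, Finset.sum_mul, Finset.mul_sum]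
    rw [Finset.sum_congr rfl fun i _ => Finset.sum_comm, Finset.sum_comm]
    refine Finset.sum_congr rfl fun k _ => ?_
    rw [Finset.sum_congr rfl fun i _ => Finset.sum_comm, Finset.sum_comm]
    refine Finset.sum_congr rfl fun l _ => ?_
    rw [Finset.sum_comm]
    refine Finset.sum_congr rfl fun i _ => Finset.sum_congr rfl fun j _ => ?_
    ring
  have e3 : ∑ i, ∑ j, (gaussField h p).1 i j * ((x i : ℝ) : ℂ) * ((x j : ℝ) : ℂ)
      = Complex.I * ∑ k, ∑ l, (h k l : ℂ) * (ellForm p.1 k x * ellForm p.1 l x) := by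
    rw [← e2]
    simp only [gaussField, mul_assoc, ← Finset.mul_sum]
  rw [gaussPoly, e3]
  simp only [gaussField, mul_add, Finset.sum_add_distrib]
  ring

theorem exists_isDecaying_nhds {n : ℕ} :
    ∀ᶠ p : GaussParam n in nhds (fun i j => if i = j then 1 else 0, 0), IsDecaying p := by
  set p₀ : GaussParam n := (fun i j => if i = j then 1 else 0, 0) with hp₀
  have h : ∀ᶠ p : GaussParam n in nhds p₀, ((n : ℝ) ^ 2 + 1) * ‖p - p₀‖ < 1 / 4 := by
    have : Filter.Tendsto (fun p : GaussParam n => ((n : ℝ) ^ 2 + 1) * ‖p - p₀‖) (nhds p₀)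
        (nhds (((n : ℝ) ^ 2 + 1) * ‖p₀ - p₀‖)) :=
      (by fun_prop : Continuous fun p : GaussParam n => ((n : ℝ) ^ 2 + 1) * ‖p - p₀‖).tendsto p₀
    rw [sub_self, norm_zero, mul_zero] at this
    exact this.eventually_lt_const (by norm_num)
  filter_upwards [h] with p hp
  refine ⟨1 / 4, by norm_num, 1 / 4, fun x => ?_⟩
  have e : gaussPoly p x = gaussPoly p₀ x + gaussPoly (p - p₀) x := by
    rw [← gaussPoly_add, add_sub_cancel]
  have h1 := (Complex.re_le_norm _).trans (norm_gaussPoly_le (p - p₀) x)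
  have h2 : ((n : ℝ) ^ 2 + 1) * ‖p - p₀‖ * (1 + ‖x‖ ^ 2) ≤ 1 / 4 * (1 + ‖x‖ ^ 2) := by gcongr
  rw [e, Complex.add_re, hp₀, gaussPoly_one, Complex.ofReal_re]
  linarith

/-- A short-time Gaussian solution of the Schrödinger equation of a quadratic Hamiltonian. -/
theorem exists_gauss_curve {n : ℕ} (h : Matrix (QIdx n) (QIdx n) ℝ) :
    ∃ ε > 0, ∃ g : ℝ → Core n, g 0 = coh0 n ∧ ∀ s ∈ Set.Ioo (-ε) ε,
      HasDerivAt (fun s => coreIncl n (g s)) (-Complex.I • coreIncl n (quadraticHam h 0 (g s))) s := by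
  set p₀ : GaussParam n := (fun i j => if i = j then 1 else 0, 0) with hp₀
  -- Picard–Lindelöf gives a solution for short times only; the interval is shrunk once more below
  -- to keep the parameter decaying.
  obtain ⟨α, h0, ε, hε, hα⟩ := ContDiffAt.exists_forall_mem_closedBall_exists_eq_forall_mem_Ioo_hasDerivAt₀
    (contDiff_gaussField h).contDiffAt (x₀ := p₀) 0
  simp only [zero_sub, zero_add] at hα
  have hc : ContinuousAt α 0 := (hα 0 ⟨by linarith, hε⟩).continuousAt
  have hd : ∀ᶠ s in nhds 0, IsDecaying (α s) :=
    hc.eventually (by rw [h0]; exact exists_isDecaying_nhds)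
  obtain ⟨δ, hδ, hd⟩ := Metric.eventually_nhds_iff.1 hd
  refine ⟨min ε δ, lt_min hε hδ, fun s => gauss (α s), by simp only [h0]; rfl, fun s hs => ?_⟩
  have hs1 : s ∈ Set.Ioo (-ε) ε :=
    ⟨by linarith [hs.1, min_le_left ε δ], by linarith [hs.2, min_le_left ε δ]⟩
  have hs2 : IsDecaying (α s) := hd (by
    rw [Real.dist_eq, sub_zero, abs_lt]
    exact ⟨by linarith [hs.1, min_le_right ε δ], by linarith [hs.2, min_le_right ε δ]⟩)
  refine ((hasFDerivAt_gauss hs2).comp_hasDerivAt s (hα s hs1)).congr_deriv ?_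
  show coreIncl n (polyMul _ _) = _
  rw [polyMul_gaussField h hs2, map_smul]

/-! ### Gaussian unitaries normalize the Weyl operators -/

/-- Conjugation by `W` maps the Weyl operator of `ξ` to a multiple of the Weyl operator of `A ξ`,
for a symplectic map `A`. -/
def NormalizesWeyl {n : ℕ} (W : ModeUnitary n) (A : (QIdx n → ℝ) →ₗ[ℝ] (QIdx n → ℝ))
    (d : (QIdx n → ℝ) →ₗ[ℝ] ℝ) : Prop :=
  (∀ ξ η, omega (A ξ) (A η) = omega ξ η) ∧
  ∀ ξ v, W (lift (weyl ξ) v) = Complex.exp (Complex.I * d ξ) • lift (weyl (A ξ)) (W v)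

theorem NormalizesWeyl.one {n : ℕ} : NormalizesWeyl (1 : ModeUnitary n) LinearMap.id 0 :=
  ⟨fun _ _ => rfl, fun ξ v => by simp⟩

theorem NormalizesWeyl.mul {n : ℕ} {W W' : ModeUnitary n}
    {A A' : (QIdx n → ℝ) →ₗ[ℝ] (QIdx n → ℝ)} {d d' : (QIdx n → ℝ) →ₗ[ℝ] ℝ}
    (h : NormalizesWeyl W A d) (h' : NormalizesWeyl W' A' d') :
    NormalizesWeyl (W * W') (A ∘ₗ A') (d' + d ∘ₗ A') := by
  refine ⟨fun ξ η => (h.1 _ _).trans (h'.1 _ _), fun ξ v => ?_⟩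
  rw [mul_apply', h'.2, map_smul, h.2, smul_smul, ← Complex.exp_add]
  simp [mul_apply', mul_add]

/-- Nondegeneracy of the form: paired with `-Ω ξ`, the vector `ξ` gives its own squared length. -/
theorem injective_of_omega {n : ℕ} {A : (QIdx n → ℝ) →ₗ[ℝ] (QIdx n → ℝ)}
    (h : ∀ ξ η, omega (A ξ) (A η) = omega ξ η) : Function.Injective A := by
  refine (injective_iff_map_eq_zero A).2 fun ξ hξ => ?_
  have h1 := h ξ (-(Omega n *ᵥ ξ))
  rw [hξ] at h1
  simp only [omega_eq_dotProduct, zero_dotProduct, Matrix.mulVec_neg, Omega_mulVec_mulVec,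
    neg_neg] at h1
  exact dotProduct_self_eq_zero.1 h1.symm

theorem NormalizesWeyl.exists_inv {n : ℕ} {W : ModeUnitary n}
    {A : (QIdx n → ℝ) →ₗ[ℝ] (QIdx n → ℝ)} {d : (QIdx n → ℝ) →ₗ[ℝ] ℝ}
    (h : NormalizesWeyl W A d) : ∃ A' d', NormalizesWeyl W⁻¹ A' d' := by
  let e := LinearEquiv.ofInjectiveEndo A (injective_of_omega h.1)
  have he : ∀ ξ, A (e.symm ξ) = ξ := fun ξ => e.apply_symm_apply ξ
  refine ⟨e.symm.toLinearMap, -(d ∘ₗ e.symm.toLinearMap), fun ξ η => ?_, fun ξ v => ?_⟩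
  · rw [← h.1]
    simp only [LinearEquiv.coe_coe, he]
  · have h1 := h.2 (e.symm ξ) (W⁻¹ v)
    rw [he, apply_inv_self'] at h1
    have h2 : lift (weyl ξ) v = Complex.exp (-(Complex.I * d (e.symm ξ))) •
        W (lift (weyl (e.symm ξ)) (W⁻¹ v)) := by
      rw [h1, smul_smul, ← Complex.exp_add]; simp
    rw [h2, map_smul, inv_apply_self']
    simp

theorem normalizesWeyl_weyl {n : ℕ} (ζ : QIdx n → ℝ) :
    ∃ d, NormalizesWeyl (lift (weyl ζ)) LinearMap.id d := by
  refine ⟨-(dotProductBilin ℝ ℝ ζ ∘ₗ (Omega n).mulVecLin), fun _ _ => rfl, fun ξ v => ?_⟩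
  have h1 := lift_weyl_add_apply ζ ξ v
  have h2 := lift_weyl_add_apply ξ ζ v
  have h3 : omega ξ ζ = -omega ζ ξ := by
    rw [omega, omega, real_inner_comm, real_inner_comm (posPart ζ) (momPart ξ)]; ring
  rw [add_comm, h2, h3] at h1
  have h4 : lift (weyl ζ) (lift (weyl ξ) v) = Complex.exp (-(Complex.I * (omega ζ ξ / 2 : ℝ))) •
      (Complex.exp (Complex.I * (omega ζ ξ / 2 : ℝ)) • lift (weyl ζ) (lift (weyl ξ) v)) := by
    rw [smul_smul, ← Complex.exp_add]; simp
  rw [h4, ← h1, smul_smul, ← Complex.exp_add]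
  congr 2
  simp only [LinearMap.neg_apply, LinearMap.comp_apply, Matrix.mulVecLin_apply,
    dotProductBilin_apply_apply, ← omega_eq_dotProduct]
  push_cast; ring

theorem sub_smul_one_apply {n : ℕ} (k : QIdx n) (c : ℂ) (f : Core n) :
    (quad k - c • (1 : Module.End ℂ (Core n))) f = quad k f - c • f := rfl

theorem quadraticHam_apply {n : ℕ} (h : Matrix (QIdx n) (QIdx n) ℝ) (m : QIdx n → ℝ)
    (f : Core n) :
    quadraticHam h m f = (1 / 2 : ℂ) • ∑ k, ∑ l, (h k l : ℂ) •
      (quad k (quad l f - (m l : ℂ) • f) - (m k : ℂ) • (quad l f - (m l : ℂ) • f)) := by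
  simp only [quadraticHam, LinearMap.smul_apply, LinearMap.sum_apply, Module.End.mul_apply,
    sub_smul_one_apply]

/-- Shifting the quadratures moves the centre of the quadratic form. This serves both to remove the
centre and to evolve displaced Gaussians. -/
theorem quadraticHam_weyl {n : ℕ} (h : Matrix (QIdx n) (QIdx n) ℝ) (m ξ : QIdx n → ℝ)
    (f : Core n) :
    quadraticHam h m ((weyl ξ).1 f) = (weyl ξ).1 (quadraticHam h (m + Omega n *ᵥ ξ) f) := by
  have h1 : ∀ (l : QIdx n) (f : Core n), quad l ((weyl ξ).1 f) - (m l : ℂ) • (weyl ξ).1 f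
      = (weyl ξ).1 (quad l f - ((m + Omega n *ᵥ ξ) l : ℂ) • f) := by
    intro l f
    rw [quad_weyl, ← map_smul, ← map_sub, sub_sub, ← add_smul, Pi.add_apply, add_comm,
      Complex.ofReal_add]
  rw [quadraticHam_apply, quadraticHam_apply]
  simp only [h1, map_smul, map_sum]

theorem quadraticHam_eq {n : ℕ} {h : Matrix (QIdx n) (QIdx n) ℝ} (hh : h.IsSymm)
    (m : QIdx n → ℝ) (f : Core n) :
    quadraticHam h m f = quadraticHam h 0 f - linOp (h *ᵥ m) f
      + ((m ⬝ᵥ (h *ᵥ m) / 2 : ℝ) : ℂ) • f := by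
  have e1 : ∑ k, ∑ l, ((h k l : ℂ) * (m l : ℂ)) • quad k f = linOp (h *ᵥ m) f := by
    rw [linOp_apply]
    refine Finset.sum_congr rfl fun k _ => ?_
    rw [← Finset.sum_smul]
    congr 1
    simp [Matrix.mulVec, dotProduct]
  have e2 : ∑ k, ∑ l, ((h k l : ℂ) * (m k : ℂ)) • quad l f = linOp (h *ᵥ m) f := by
    rw [Finset.sum_comm, ← e1]
    refine Finset.sum_congr rfl fun k _ => Finset.sum_congr rfl fun l _ => ?_
    rw [hh.apply]
  have e3 : ∑ k, ∑ l, ((h k l : ℂ) * ((m k : ℂ) * (m l : ℂ))) • f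
      = ((m ⬝ᵥ (h *ᵥ m) : ℝ) : ℂ) • f := by
    simp only [← Finset.sum_smul]
    congr 1
    simp only [Matrix.mulVec, dotProduct, Finset.mul_sum]
    push_cast
    refine Finset.sum_congr rfl fun k _ => Finset.sum_congr rfl fun l _ => ?_
    ring
  have e4 : ∀ k l, (h k l : ℂ) • (quad k (quad l f - (m l : ℂ) • f)
      - (m k : ℂ) • (quad l f - (m l : ℂ) • f))
      = (h k l : ℂ) • quad k (quad l f) - ((h k l : ℂ) * (m l : ℂ)) • quad k f
        - ((h k l : ℂ) * (m k : ℂ)) • quad l f + ((h k l : ℂ) * ((m k : ℂ) * (m l : ℂ))) • f := by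
    intro k l
    rw [map_sub, map_smul]
    module
  rw [quadraticHam_apply, quadraticHam_zero_apply]
  simp only [e4, Finset.sum_add_distrib, Finset.sum_sub_distrib, e1, e2, e3]
  push_cast
  module

/-- The generator of the symplectic flow of the Hamiltonian `½ Rᵀ h R`. -/
def flowGen {n : ℕ} (h : Matrix (QIdx n) (QIdx n) ℝ) : (QIdx n → ℝ) →L[ℝ] (QIdx n → ℝ) :=
  LinearMap.toContinuousLinearMap (h * Omega n).mulVecLin

theorem flowGen_apply {n : ℕ} (h : Matrix (QIdx n) (QIdx n) ℝ) (ξ : QIdx n → ℝ) :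
    flowGen h ξ = h *ᵥ (Omega n *ᵥ ξ) := by
  simp [flowGen]

/-- The symplectic flow of the Hamiltonian `½ Rᵀ h R` on linear forms. -/
def sympFlow {n : ℕ} (h : Matrix (QIdx n) (QIdx n) ℝ) (s : ℝ) :
    (QIdx n → ℝ) →L[ℝ] (QIdx n → ℝ) := NormedSpace.exp (s • flowGen h)

theorem sympFlow_zero {n : ℕ} (h : Matrix (QIdx n) (QIdx n) ℝ) : sympFlow h 0 = 1 := by
  simp [sympFlow]

theorem hasDerivAt_sympFlow {n : ℕ} (h : Matrix (QIdx n) (QIdx n) ℝ) (ξ : QIdx n → ℝ) (s : ℝ) :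
    HasDerivAt (fun s => sympFlow h s ξ) (h *ᵥ (Omega n *ᵥ (sympFlow h s ξ))) s := by
  have h1 := hasDerivAt_exp_smul_const' (𝕂 := ℝ) (flowGen h) s
  have h2 := ((ContinuousLinearMap.apply ℝ (QIdx n → ℝ) ξ).hasFDerivAt
    (x := sympFlow h s)).comp_hasDerivAt s h1
  refine h2.congr_deriv ?_
  rw [← flowGen_apply]
  rfl

theorem Omega_dotProduct {n : ℕ} (ξ η : QIdx n → ℝ) :
    (Omega n *ᵥ ξ) ⬝ᵥ η = -(ξ ⬝ᵥ (Omega n *ᵥ η)) := by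
  simp only [dotProduct, Fintype.sum_prod_type, Fin.sum_univ_two, Omega_mulVec_zero,
    Omega_mulVec_one, ← Finset.sum_neg_distrib]
  refine Finset.sum_congr rfl fun j _ => ?_
  ring

theorem symm_dotProduct {n : ℕ} {h : Matrix (QIdx n) (QIdx n) ℝ} (hh : h.IsSymm)
    (ξ η : QIdx n → ℝ) : (h *ᵥ ξ) ⬝ᵥ η = ξ ⬝ᵥ (h *ᵥ η) := by
  rw [dotProduct_comm, Matrix.dotProduct_mulVec, ← Matrix.mulVec_transpose, hh.eq,
    dotProduct_comm]

/-- Symmetry of `h` and antisymmetry of `Ω` make the two terms of the derivative cancel. -/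
theorem omega_sympFlow {n : ℕ} {h : Matrix (QIdx n) (QIdx n) ℝ} (hh : h.IsSymm) (s : ℝ)
    (ξ η : QIdx n → ℝ) : omega (sympFlow h s ξ) (sympFlow h s η) = omega ξ η := by
  have hd : ∀ s, HasDerivAt (fun s => omega (sympFlow h s ξ) (sympFlow h s η)) 0 s := by
    intro s
    simp only [omega_eq_dotProduct, dotProduct]
    have h1 := hasDerivAt_sympFlow h ξ s
    have h2 := ((LinearMap.toContinuousLinearMap (Omega n).mulVecLin).hasFDerivAt
      (x := sympFlow h s η)).comp_hasDerivAt s (hasDerivAt_sympFlow h η s)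
    have h3 := HasDerivAt.fun_sum (u := Finset.univ) fun k _ =>
      (hasDerivAt_pi.1 h1 k).mul (hasDerivAt_pi.1 h2 k)
    refine h3.congr_deriv ?_
    rw [Finset.sum_add_distrib]
    show (h *ᵥ (Omega n *ᵥ (sympFlow h s ξ))) ⬝ᵥ (Omega n *ᵥ (sympFlow h s η))
      + (sympFlow h s ξ) ⬝ᵥ (Omega n *ᵥ (h *ᵥ (Omega n *ᵥ (sympFlow h s η)))) = 0
    rw [symm_dotProduct hh, Omega_dotProduct, neg_add_cancel]
  have := is_const_of_deriv_eq_zero (fun r => (hd r).differentiableAt) (fun r => (hd r).deriv) s 0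
  simpa only [sympFlow_zero, one_apply_eq_self] using this

/-- Short-time evolution of displaced vacua under a quadratic Hamiltonian. -/
theorem exists_flow_weyl_coh0 {n : ℕ} {h : Matrix (QIdx n) (QIdx n) ℝ} (hh : h.IsSymm)
    {U : ℝ → ModeUnitary n} (hU : IsFlow (quadraticHam h 0) U) :
    ∃ ε > 0, ∀ s ∈ Set.Ioo (-ε) ε, ∀ ξ,
      U s (lift (weyl ξ) (coreIncl n (coh0 n)))
        = lift (weyl (sympFlow h s ξ)) (U s (coreIncl n (coh0 n))) := by
  obtain ⟨ε, hε, g, hg0, hg⟩ := exists_gauss_curve h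
  refine ⟨ε, hε, fun s hs ξ => ?_⟩
  have h1 := hU.eq_of_curve hg hs
  rw [hg0] at h1
  -- The displaced Gaussian also solves the Schrödinger equation. Recentring the Hamiltonian at `Ω
  -- ζ` produces a linear term, matched by `ζ' = h Ω ζ`, and a constant, matched by the phase `ω(ζ,
  -- ζ') / 2` of the Weyl curve.
  have h2 : ∀ r ∈ Set.Ioo (-ε) ε,
      HasDerivAt (fun r => coreIncl n ((weyl (sympFlow h r ξ)).1 (g r)))
        (-Complex.I • coreIncl n (quadraticHam h 0 ((weyl (sympFlow h r ξ)).1 (g r)))) r := by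
    intro r hr
    set ζ := sympFlow h r ξ with hζ
    have h3 := hasDerivAt_weyl_curve (hasDerivAt_sympFlow h ξ r) (g r)
    have h4 := hasDerivAt_unitary_apply (U := fun r => lift (weyl (sympFlow h r ξ))) (hg r hr) h3
      (continuous_unitary_of_core (U := fun r => lift (weyl (sympFlow h r ξ)))
        (fun f => continuous_iff_continuousAt.2 fun r =>
          (hasDerivAt_weyl_curve (hasDerivAt_sympFlow h ξ r) f).continuousAt) _).continuousAt
    simp only [lift_apply] at h4
    refine h4.congr_deriv ?_
    have e2 := quadraticHam_eq hh (Omega n *ᵥ ζ) (g r)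
    have e1 : omega ζ (h *ᵥ (Omega n *ᵥ ζ)) = -((Omega n *ᵥ ζ) ⬝ᵥ (h *ᵥ (Omega n *ᵥ ζ))) := by
      rw [omega_eq_dotProduct, Omega_dotProduct, neg_neg]
    rw [quadraticHam_weyl, zero_add, e2, ← hζ, e1, ← lift_apply]
    simp only [map_add, map_sub, map_smul, lift_apply]
    push_cast
    module
  have h5 := hU.eq_of_curve h2 hs
  rw [sympFlow_zero, one_apply_eq_self, hg0] at h5
  rw [lift_apply, ← h5, ← lift_apply, h1]

theorem ext_weyl_coh0 {n : ℕ} {A B : Modes n →L[ℂ] Modes n}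
    (h : ∀ ξ, A (lift (weyl ξ) (coreIncl n (coh0 n))) = B (lift (weyl ξ) (coreIncl n (coh0 n)))) :
    A = B := by
  refine ext_coh fun a => ?_
  have e : (weyl fun k : QIdx n => if k.2 = 0 then a k.1 else 0).1 (coh0 n) = coh a := by
    ext x
    have h1 : posPart (fun k : QIdx n => if k.2 = 0 then a k.1 else 0) = a := by ext j; simp
    have h2 : momPart (fun k : QIdx n => if k.2 = 0 then a k.1 else 0) = 0 := by ext j; simp
    rw [weyl_apply, coh, phase_apply, h1, h2]
    simp
  have := h fun k : QIdx n => if k.2 = 0 then a k.1 else 0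
  rwa [lift_apply, e] at this

/-- Displaced vacua are total, so the relation is checked on them. There it follows from their known
evolution at `η` and at `ξ + η`, since the symplectic flow preserves the Weyl cocycle. -/
theorem IsFlow.normalizesWeyl_small {n : ℕ} {h : Matrix (QIdx n) (QIdx n) ℝ} (hh : h.IsSymm)
    {U : ℝ → ModeUnitary n} (hU : IsFlow (quadraticHam h 0) U) :
    ∃ ε > 0, ∀ s ∈ Set.Ioo (-ε) ε, NormalizesWeyl (U s) (sympFlow h s).toLinearMap 0 := by
  obtain ⟨ε, hε, hs⟩ := exists_flow_weyl_coh0 hh hU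
  refine ⟨ε, hε, fun s hsε => ⟨omega_sympFlow hh s, fun ξ v => ?_⟩⟩
  have h1 : (U s).toContinuousLinearEquiv.toContinuousLinearMap.comp
      (lift (weyl ξ)).toContinuousLinearEquiv.toContinuousLinearMap
      = (lift (weyl (sympFlow h s ξ))).toContinuousLinearEquiv.toContinuousLinearMap.comp
      (U s).toContinuousLinearEquiv.toContinuousLinearMap := by
    refine ext_weyl_coh0 fun η => ?_
    show U s (lift (weyl ξ) (lift (weyl η) (coreIncl n (coh0 n))))
      = lift (weyl (sympFlow h s ξ)) (U s (lift (weyl η) (coreIncl n (coh0 n))))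
    have h2 := lift_weyl_add_apply ξ η (coreIncl n (coh0 n))
    have h3 := lift_weyl_add_apply (sympFlow h s ξ) (sympFlow h s η) (U s (coreIncl n (coh0 n)))
    rw [omega_sympFlow hh, ← map_add, ← hs s hsε, ← hs s hsε, h2, map_smul] at h3
    exact smul_right_injective _ (Complex.exp_ne_zero _) h3
  have := congrArg (fun A : Modes n →L[ℂ] Modes n => A v) h1
  simpa using this

theorem NormalizesWeyl.exists_pow {n : ℕ} {W : ModeUnitary n}
    (h : ∃ A d, NormalizesWeyl W A d) (N : ℕ) : ∃ A d, NormalizesWeyl (W ^ N) A d := by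
  induction N with
  | zero => exact ⟨_, _, by rw [pow_zero]; exact .one⟩
  | succ N ih =>
    obtain ⟨A, d, h⟩ := h
    obtain ⟨A', d', h'⟩ := ih
    exact ⟨_, _, by rw [pow_succ]; exact h'.mul h⟩

theorem IsFlow.pow {n : ℕ} {H : Module.End ℂ (Core n)} {U : ℝ → ModeUnitary n}
    (hU : IsFlow H U) (s : ℝ) (N : ℕ) : U s ^ N = U (N * s) := by
  induction N with
  | zero => simp [hU.zero]
  | succ N ih => rw [pow_succ, ih, ← hU.add]; congr 1; push_cast; ring

/-- Conjugation by the Weyl operator of `Ω m` removes the centre, as `Ω² = -1`. Time `1` is then a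
power of a short time step, and normalizing Weyl operators is stable under products and inverses. -/
theorem IsFlow.exists_normalizesWeyl {n : ℕ} {h : Matrix (QIdx n) (QIdx n) ℝ} (hh : h.IsSymm)
    {m : QIdx n → ℝ} {U : ℝ → ModeUnitary n} (hU : IsFlow (quadraticHam h m) U) :
    ∃ A d, NormalizesWeyl (U 1) A d := by
  set ζ := Omega n *ᵥ m with hζ
  have hm : m + Omega n *ᵥ ζ = 0 := by rw [hζ, Omega_mulVec_mulVec, add_neg_cancel]
  have hc := hU.conj (weyl ζ) (K := quadraticHam h 0) fun f => by rw [quadraticHam_weyl, hm]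
  obtain ⟨ε, hε, hs⟩ := hc.normalizesWeyl_small hh
  obtain ⟨N, hN⟩ := exists_nat_one_div_lt hε
  have h1 := NormalizesWeyl.exists_pow ⟨_, _, hs (1 / ((N : ℝ) + 1))
    ⟨by linarith [(by positivity : (0 : ℝ) < 1 / ((N : ℝ) + 1))], hN⟩⟩ (N + 1)
  rw [hc.pow] at h1
  have e : ((N + 1 : ℕ) : ℝ) * (1 / ((N : ℝ) + 1)) = 1 := by push_cast; field_simp
  rw [e] at h1
  obtain ⟨A, d, h2⟩ := h1
  obtain ⟨d', h3⟩ := normalizesWeyl_weyl ζ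
  obtain ⟨A'', d'', h4⟩ := h3.exists_inv
  exact ⟨_, _, by simpa [mul_assoc] using (h3.mul h2).mul h4⟩

theorem IsGaussian.exists_normalizesWeyl {n : ℕ} {G : ModeUnitary n} (hG : IsGaussian G) :
    ∃ A d, NormalizesWeyl G A d := by
  induction hG using Submonoid.closure_induction with
  | mem W hW =>
    obtain ⟨h, m, hh, hW⟩ := hW
    obtain ⟨U, hU, rfl⟩ := hW.exists_flow
    exact hU.exists_normalizesWeyl hh
  | one => exact ⟨_, _, .one⟩
  | mul a b _ _ ha hb =>
    obtain ⟨_, _, ha⟩ := ha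
    obtain ⟨_, _, hb⟩ := hb
    exact ⟨_, _, ha.mul hb⟩

/-! ### Tensor products -/

theorem tensor_ae {k n : ℕ} (h : k ≤ n) (φ : Modes k) (χ : Modes (n - k)) :
    tensor h φ χ =ᵐ[volume] fun x => φ (firstModes h x) * χ (lastModes h x) :=
  (memLp_tensor h φ χ).coeFn_toLp

theorem inner_tensor {k n : ℕ} (h : k ≤ n) (φ φ' : Modes k) (χ χ' : Modes (n - k)) :
    ⟪tensor h φ χ, tensor h φ' χ'⟫_ℂ = ⟪φ, φ'⟫_ℂ * ⟪χ, χ'⟫_ℂ := by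
  have hmp := measurePreserving_splitModes h
  have h1 : ⟪tensor h φ χ, tensor h φ' χ'⟫_ℂ
      = ∫ x, ⟪φ (firstModes h x), φ' (firstModes h x)⟫_ℂ
        * ⟪χ (lastModes h x), χ' (lastModes h x)⟫_ℂ := by
    rw [L2.inner_def]
    refine integral_congr_ae ?_
    filter_upwards [tensor_ae h φ χ, tensor_ae h φ' χ'] with x hx hx'
    rw [hx, hx']
    simp only [RCLike.inner_apply, map_mul]
    ring
  have h2 : ∫ z, ⟪φ z.1, φ' z.1⟫_ℂ * ⟪χ z.2, χ' z.2⟫_ℂ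
        ∂((volume : Measure (EuclideanSpace ℝ (Fin k))).prod
          (volume : Measure (EuclideanSpace ℝ (Fin (n - k)))))
      = ∫ x, ⟪φ (firstModes h x), φ' (firstModes h x)⟫_ℂ
        * ⟪χ (lastModes h x), χ' (lastModes h x)⟫_ℂ := by
    rw [← hmp.map_eq, integral_map hmp.measurable.aemeasurable]
    rw [hmp.map_eq]
    exact ((Lp.aestronglyMeasurable φ).inner (Lp.aestronglyMeasurable φ')).comp_fst.mul
      ((Lp.aestronglyMeasurable χ).inner (Lp.aestronglyMeasurable χ')).comp_snd
  rw [h1, ← h2, integral_prod_mul (fun x => ⟪φ x, φ' x⟫_ℂ) fun y => ⟪χ y, χ' y⟫_ℂ, L2.inner_def,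
    L2.inner_def]

theorem norm_tensor {k n : ℕ} (h : k ≤ n) (φ : Modes k) (χ : Modes (n - k)) :
    ‖tensor h φ χ‖ = ‖φ‖ * ‖χ‖ := by
  have h1 := inner_tensor h φ φ χ χ
  simp only [inner_self_eq_norm_sq_to_K] at h1
  have h2 : ‖tensor h φ χ‖ ^ 2 = (‖φ‖ * ‖χ‖) ^ 2 := by
    rw [mul_pow]
    exact_mod_cast h1
  exact (pow_left_inj₀ (norm_nonneg _) (by positivity) two_ne_zero).1 h2

/-- `φ ↦ φ ⊗ χ`. -/
def tensorLeft {k n : ℕ} (h : k ≤ n) (χ : Modes (n - k)) : Modes k →L[ℂ] Modes n :=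
  LinearMap.mkContinuous
    { toFun := fun φ => tensor h φ χ
      -- Linearity needs no almost-everywhere argument: by `inner_tensor`, the squared norm of the
      -- defect expands to zero.
      map_add' := fun φ φ' => by
        rw [← sub_eq_zero, ← inner_self_eq_zero (𝕜 := ℂ)]
        simp only [inner_sub_left, inner_sub_right, inner_add_left, inner_add_right, inner_tensor]
        ring
      map_smul' := fun c φ => by
        rw [← sub_eq_zero, ← inner_self_eq_zero (𝕜 := ℂ)]
        simp only [inner_sub_left, inner_sub_right, inner_smul_left, inner_smul_right,
          inner_tensor, RingHom.id_apply]
        ring }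
    ‖χ‖ fun φ => (norm_tensor h φ χ).le.trans_eq (mul_comm _ _)

/-- `χ ↦ φ ⊗ χ`. -/
def tensorRight {k n : ℕ} (h : k ≤ n) (φ : Modes k) : Modes (n - k) →L[ℂ] Modes n :=
  LinearMap.mkContinuous
    { toFun := fun χ => tensor h φ χ
      map_add' := fun χ χ' => by
        rw [← sub_eq_zero, ← inner_self_eq_zero (𝕜 := ℂ)]
        simp only [inner_sub_left, inner_sub_right, inner_add_left, inner_add_right, inner_tensor]
        ring
      map_smul' := fun c χ => by
        rw [← sub_eq_zero, ← inner_self_eq_zero (𝕜 := ℂ)]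
        simp only [inner_sub_left, inner_sub_right, inner_smul_left, inner_smul_right,
          inner_tensor, RingHom.id_apply]
        ring }
    ‖φ‖ fun χ => (norm_tensor h φ χ).le

@[simp] theorem tensorLeft_apply {k n : ℕ} (h : k ≤ n) (φ : Modes k) (χ : Modes (n - k)) :
    tensorLeft h χ φ = tensor h φ χ := rfl

@[simp] theorem tensorRight_apply {k n : ℕ} (h : k ≤ n) (φ : Modes k) (χ : Modes (n - k)) :
    tensorRight h φ χ = tensor h φ χ := rfl

theorem inner_splitModes {k n : ℕ} (h : k ≤ n) (x y : EuclideanSpace ℝ (Fin n)) :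
    ⟪x, y⟫_ℝ = ⟪firstModes h x, firstModes h y⟫_ℝ + ⟪lastModes h x, lastModes h y⟫_ℝ := by
  obtain ⟨m, rfl⟩ := Nat.exists_eq_add_of_le h
  simp only [PiLp.inner_apply, firstModes, lastModes]
  rw [Fin.sum_univ_add]
  congr 1
  refine Fintype.sum_equiv (finCongr (Nat.add_sub_cancel_left (n := k) (m := m)).symm) _ _
    fun i => rfl

theorem exists_splitModes {k n : ℕ} (h : k ≤ n) (a : EuclideanSpace ℝ (Fin k))
    (b : EuclideanSpace ℝ (Fin (n - k))) : ∃ c, firstModes h c = a ∧ lastModes h c = b := by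
  refine ⟨WithLp.toLp 2 fun i => if hi : (i : ℕ) < k then a ⟨i, hi⟩ else b ⟨i - k, by omega⟩,
    ?_, ?_⟩
  · ext i
    simp [firstModes]
  · ext i
    simp [lastModes]

theorem tensor_coh {k n : ℕ} (h : k ≤ n) (c : EuclideanSpace ℝ (Fin n)) :
    tensor h (coreIncl k (coh (firstModes h c))) (coreIncl (n - k) (coh (lastModes h c)))
      = coreIncl n (coh c) := by
  refine Lp.ext ?_
  have hmp := measurePreserving_splitModes h
  have h1 := (coh (firstModes h c)).coeFn_toLp 2 (volume : Measure (EuclideanSpace ℝ (Fin k)))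
  have h2 := (coh (lastModes h c)).coeFn_toLp 2
    (volume : Measure (EuclideanSpace ℝ (Fin (n - k))))
  have h3 := hmp.quasiMeasurePreserving.ae (Measure.quasiMeasurePreserving_fst.ae h1)
  have h4 := hmp.quasiMeasurePreserving.ae (Measure.quasiMeasurePreserving_snd.ae h2)
  filter_upwards [tensor_ae h (coreIncl k (coh (firstModes h c)))
    (coreIncl (n - k) (coh (lastModes h c))), h3, h4, (coh c).coeFn_toLp 2 volume] with x h5 h3 h4 h6
  refine h5.trans (Eq.trans ?_ h6.symm)
  refine (congrArg₂ _ h3 h4).trans ?_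
  have e : ‖x‖ ^ 2 = ‖firstModes h x‖ ^ 2 + ‖lastModes h x‖ ^ 2 := by
    simp only [← real_inner_self_eq_norm_sq, ← inner_splitModes]
  rw [coh_apply, coh_apply, coh_apply, ← Complex.exp_add, inner_splitModes h c x, e]
  congr 1
  push_cast
  ring

theorem vacuum_eq (n : ℕ) :
    vacuum n = ((Real.pi ^ (-(n : ℝ) / 4) : ℝ) : ℂ) • coreIncl n (coh 0) := by
  refine Lp.ext ?_
  filter_upwards [(memLp_vacuumFun n).coeFn_toLp, (coh (0 : EuclideanSpace ℝ (Fin n))).coeFn_toLp 2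
    volume, Lp.coeFn_smul ((Real.pi ^ (-(n : ℝ) / 4) : ℝ) : ℂ) (coreIncl n (coh 0))] with x h1 h2 h3
  refine h1.trans (Eq.trans ?_ h3.symm)
  rw [Pi.smul_apply]
  refine Eq.trans ?_ (congrArg _ h2.symm)
  rw [coh_apply, vacuumFun, smul_eq_mul]
  simp

theorem norm_coh_zero_sq (n : ℕ) : ‖coreIncl n (coh 0)‖ ^ 2 = Real.pi ^ ((n : ℝ) / 2) := by
  rw [norm_coreIncl_sq]
  have h1 := GaussianFourier.integral_rexp_neg_mul_sq_norm (V := EuclideanSpace ℝ (Fin n))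
    (b := 1) one_pos
  rw [div_one, finrank_euclideanSpace_fin] at h1
  rw [← h1]
  refine integral_congr_ae (Filter.Eventually.of_forall fun x => ?_)
  simp only [coh_apply, Complex.norm_exp]
  rw [← Real.exp_nat_mul]
  congr 1
  simp
  rw [← Complex.ofReal_pow, Complex.ofReal_re]
  ring

theorem norm_vacuum (n : ℕ) : ‖vacuum n‖ = 1 := by
  have h1 : ‖vacuum n‖ ^ 2 = 1 := by
    rw [vacuum_eq, norm_smul, mul_pow, norm_coh_zero_sq, Complex.norm_real, Real.norm_eq_abs,
      sq_abs, ← Real.rpow_natCast, ← Real.rpow_mul Real.pi_pos.le, ← Real.rpow_add Real.pi_pos]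
    rw [show -(n : ℝ) / 4 * ((2 : ℕ) : ℝ) + n / 2 = 0 by push_cast; ring, Real.rpow_zero]
  exact (pow_eq_one_iff_of_nonneg (norm_nonneg _) two_ne_zero).1 h1

/-! ### Ladder operators and coherent functions -/

/-- The linear form `∑ j, a_j x_j`. -/
def posForm {n : ℕ} (a : EuclideanSpace ℝ (Fin n)) : QIdx n → ℝ :=
  fun k => if k.2 = 0 then a k.1 else 0

theorem weyl_posForm_coh {n : ℕ} (a c : EuclideanSpace ℝ (Fin n)) :
    (weyl (posForm a)).1 (coh c) = coh (a + c) := by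
  ext x
  have h1 : posPart (posForm a) = a := by ext j; simp [posForm]
  have h2 : momPart (posForm a) = 0 := by ext j; simp [posForm]
  rw [weyl_apply, h1, h2, coh_apply, coh_apply, ← Complex.exp_add, inner_zero_right, add_zero,
    inner_add_left]
  congr 1
  push_cast
  ring

theorem quad_coh0 {n : ℕ} (j : Fin n) :
    quad (j, 0) (coh0 n) + Complex.I • quad (j, 1) (coh0 n) = 0 := by
  have h1 : ∀ i, (ell (fun i j : Fin n => if i = j then (1 : ℂ) else 0) (j, 1) i)
      = Complex.I * ell (fun i j : Fin n => if i = j then (1 : ℂ) else 0) (j, 0) i := by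
    intro i
    rcases eq_or_ne j i with rfl | hij <;> simp [ell, *, Ne.symm]
  ext x
  rw [add_apply, smul_apply, coh0, quad_gauss isDecaying_one, quad_gauss isDecaying_one, ellForm,
    ellForm]
  simp only [h1, mul_assoc, ← Finset.mul_sum, smul_eq_mul]
  rw [zero_apply]
  linear_combination (∑ i, ell (fun i j : Fin n => if i = j then (1 : ℂ) else 0) (j, 0) i
    * ((x i : ℝ) : ℂ)) * gauss (fun i j => if i = j then 1 else 0, 0) x * Complex.I_sq

/-- A coherent function is a displaced vacuum, and the displacement shifts the annihilation relation
by a scalar. -/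
theorem quad_coh {n : ℕ} (j : Fin n) (c : EuclideanSpace ℝ (Fin n)) :
    quad (j, 0) (coh c) + Complex.I • quad (j, 1) (coh c) = (Complex.I * (c j : ℝ)) • coh c := by
  have h0 : coh c = (weyl (posForm c)).1 (coh0 n) := by
    rw [show coh0 n = coh 0 by ext x; rw [coh_apply, coh0_apply]; simp, weyl_posForm_coh, add_zero]
  rw [h0, quad_weyl, quad_weyl, ← map_smul, ← map_add, ← map_smul, Omega_mulVec_zero,
    Omega_mulVec_one]
  congr 1
  have h1 := quad_coh0 j
  rw [smul_sub, ← sub_eq_zero, ← h1]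
  simp only [posForm]
  push_cast
  simp
  module

/-! ### Vectors in the vacuum state on the last modes -/

/-- The operator `∑ l, c_l R_l` annihilates `ψ` in the weak sense. -/
def WeakAnn {n : ℕ} (c : QIdx n → ℂ) (ψ : Modes n) : Prop :=
  ∀ f, ⟪ψ, coreIncl n (∑ l, (starRingEnd ℂ) (c l) • quad l f)⟫_ℂ = 0

/-- The coefficients of the annihilation operator `x_j + i p_j`. -/
def annVec {n : ℕ} (j : Fin n) : QIdx n → ℂ :=
  fun k => if k.1 = j then (if k.2 = 0 then 1 else Complex.I) else 0

theorem weakAnn_annVec {n : ℕ} {j : Fin n} {ψ : Modes n} :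
    WeakAnn (annVec j) ψ ↔
      ∀ f, ⟪ψ, coreIncl n (quad (j, 0) f - Complex.I • quad (j, 1) f)⟫_ℂ = 0 := by
  refine forall_congr' fun f => ?_
  have : ∑ l, (starRingEnd ℂ) (annVec j l) • quad l f
      = quad (j, 0) f - Complex.I • quad (j, 1) f := by
    rw [Fintype.sum_prod_type, Finset.sum_eq_single j (fun i _ hi => by simp [annVec, hi])
      (by simp)]
    simp [annVec, sub_eq_add_neg]
  rw [this]

theorem posForm_smul {n : ℕ} (s : ℝ) (a : EuclideanSpace ℝ (Fin n)) :
    posForm (s • a) = s • posForm a := by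
  ext k
  simp [posForm]

theorem hasDerivAt_coh {n : ℕ} (b c : EuclideanSpace ℝ (Fin n)) (s : ℝ) :
    HasDerivAt (fun r : ℝ => coreIncl n (coh (r • b + c)))
      (Complex.I • coreIncl n (linOp (posForm b) (coh (s • b + c)))) s := by
  have h1 := (isFlow_weyl (posForm b)).deriv_zero (coh (s • b + c))
  have h2 := h1.scomp_of_eq (x := s) (h := fun r => r - s) ((hasDerivAt_id s).sub_const s)
    (by simp)
  rw [one_smul, LinearMap.neg_apply, map_neg, smul_neg, neg_smul, neg_neg] at h2
  have e : ∀ r : ℝ, lift (weyl ((r - s) • posForm b)) (coreIncl n (coh (s • b + c)))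
      = coreIncl n (coh (r • b + c)) := by
    intro r
    rw [← posForm_smul, lift_apply, weyl_posForm_coh]
    congr 2
    module
  simpa only [Function.comp_def, e] using h2

/-- The derivative along `s ↦ coh (s b + c)` involves positions only. The hypothesis on `ψ`
evaluates pairings with `x - i p`, the eigenvalue relation those with `x + i p`; their half sum
gives a linear equation with rate `-s ‖b‖² / 2`. -/
theorem inner_coh_add {n : ℕ} {ψ : Modes n} {b c : EuclideanSpace ℝ (Fin n)}
    (hψ : ∀ j, b j ≠ 0 → WeakAnn (annVec j) ψ) (hc : ∀ j, b j ≠ 0 → c j = 0) :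
    ⟪ψ, coreIncl n (coh (b + c))⟫_ℂ
      = Complex.exp ((-‖b‖ ^ 2 / 4 : ℝ) : ℂ) * ⟪ψ, coreIncl n (coh c)⟫_ℂ := by
  have h1 : ∀ s : ℝ, HasDerivAt (fun s : ℝ => ⟪ψ, coreIncl n (coh (s • b + c))⟫_ℂ)
      (((-(s * ‖b‖ ^ 2 / 2) : ℝ) : ℂ) * ⟪ψ, coreIncl n (coh (s • b + c))⟫_ℂ) s := by
    intro s
    have h2 := ((innerSL ℂ ψ).restrictScalars ℝ).hasFDerivAt.comp_hasDerivAt s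
      (hasDerivAt_coh b c s)
    refine h2.congr_deriv ?_
    set g := coh (s • b + c) with hg
    have h3 : ∀ j, (b j : ℂ) * ⟪ψ, coreIncl n (quad (j, 0) g)⟫_ℂ
        = (b j ^ 2 : ℝ) * (Complex.I * s / 2) * ⟪ψ, coreIncl n g⟫_ℂ := by
      intro j
      by_cases hj : b j = 0
      · simp [hj]
      · have h4 := weakAnn_annVec.1 (hψ j hj) g
        have h5 := congrArg (fun f => ⟪ψ, coreIncl n f⟫_ℂ) (quad_coh j (s • b + c))
        simp only [map_add, map_smul, inner_add_right, inner_smul_right, map_sub,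
          inner_sub_right, ← hg] at h4 h5
        have h6 : (s • b + c) j = s * b j := by simp [hc j hj]
        rw [h6] at h5
        push_cast at h5 ⊢
        linear_combination (b j : ℂ) / 2 * (h4 + h5)
    show ⟪ψ, Complex.I • coreIncl n (linOp (posForm b) g)⟫_ℂ = _
    rw [linOp_apply, map_sum, inner_smul_right, inner_sum, Fintype.sum_prod_type]
    have h7 : ∀ j, ∑ i : Fin 2, ⟪ψ, coreIncl n (((posForm b (j, i) : ℝ) : ℂ) • quad (j, i) g)⟫_ℂ
        = (b j ^ 2 : ℝ) * (Complex.I * s / 2) * ⟪ψ, coreIncl n g⟫_ℂ := by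
      intro j
      rw [← h3]
      rw [Fin.sum_univ_two, map_smul, inner_smul_right]
      simp [posForm]
    rw [Finset.sum_congr rfl fun j _ => h7 j, ← Finset.sum_mul, ← Finset.sum_mul,
      EuclideanSpace.real_norm_sq_eq]
    push_cast
    linear_combination (∑ i, (b i : ℂ) ^ 2) * s / 2 * ⟪ψ, coreIncl n g⟫_ℂ * Complex.I_sq
  -- The Gaussian factor is the integrating factor of that equation.
  have h8 : ∀ s : ℝ, HasDerivAt (fun s : ℝ => Complex.exp (((s ^ 2 * ‖b‖ ^ 2 / 4 : ℝ)) : ℂ)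
      * ⟪ψ, coreIncl n (coh (s • b + c))⟫_ℂ) 0 s := by
    intro s
    have h9 : HasDerivAt (fun s : ℝ => (((s ^ 2 * ‖b‖ ^ 2 / 4 : ℝ)) : ℂ))
        ((s * ‖b‖ ^ 2 / 2 : ℝ) : ℂ) s := by
      refine HasDerivAt.ofReal_comp ?_
      refine ((((hasDerivAt_id s).pow 2).mul_const _).div_const _).congr_deriv ?_
      simp
      ring
    refine (h9.cexp.mul (h1 s)).congr_deriv ?_
    push_cast
    ring
  have h10 := is_const_of_deriv_eq_zero (fun s => (h8 s).differentiableAt)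
    (fun s => (h8 s).deriv) 1 0
  simp only [one_smul, zero_smul, zero_add, one_pow, one_mul] at h10
  have h11 : Complex.exp ((-‖b‖ ^ 2 / 4 : ℝ) : ℂ) * Complex.exp ((‖b‖ ^ 2 / 4 : ℝ) : ℂ) = 1 := by
    rw [← Complex.exp_add]
    push_cast
    rw [show -(‖b‖ : ℂ) ^ 2 / 4 + (‖b‖ : ℂ) ^ 2 / 4 = 0 by ring, Complex.exp_zero]
  have e0 : (0 : ℝ) ^ 2 * ‖b‖ ^ 2 / 4 = 0 := by ring
  rw [e0, Complex.ofReal_zero, Complex.exp_zero, one_mul] at h10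
  rw [← h10, ← mul_assoc, h11, one_mul]

theorem weakAnn_vacuum {n : ℕ} (j : Fin n) : WeakAnn (annVec j) (vacuum n) := by
  refine weakAnn_annVec.2 fun f => ?_
  have h1 := quad_coh j (0 : EuclideanSpace ℝ (Fin n))
  rw [vacuum_eq, inner_smul_left, map_sub, inner_sub_right, map_smul, inner_smul_right,
    ← isSymm_quad, ← isSymm_quad]
  have h2 := congrArg (fun g => ⟪coreIncl n g, coreIncl n f⟫_ℂ) h1
  simp [inner_add_left, inner_smul_left] at h2
  linear_combination _ * h2

theorem firstModes_add {k n : ℕ} (h : k ≤ n) (x y : EuclideanSpace ℝ (Fin n)) :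
    firstModes h (x + y) = firstModes h x + firstModes h y := rfl

theorem lastModes_add {k n : ℕ} (h : k ≤ n) (x y : EuclideanSpace ℝ (Fin n)) :
    lastModes h (x + y) = lastModes h x + lastModes h y := rfl

theorem apply_of_firstModes_eq_zero {k n : ℕ} (h : k ≤ n) {x : EuclideanSpace ℝ (Fin n)}
    (hx : firstModes h x = 0) {j : Fin n} (hj : (j : ℕ) < k) : x j = 0 :=
  congrArg (fun y : EuclideanSpace ℝ (Fin k) => y ⟨j, hj⟩) hx

theorem apply_of_lastModes_eq_zero {k n : ℕ} (h : k ≤ n) {x : EuclideanSpace ℝ (Fin n)}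
    (hx : lastModes h x = 0) {j : Fin n} (hj : k ≤ (j : ℕ)) : x j = 0 := by
  have := congrArg (fun y : EuclideanSpace ℝ (Fin (n - k)) => y ⟨j - k, by omega⟩) hx
  have e : (⟨k + (j - k), by omega⟩ : Fin n) = j := Fin.ext (by simp; omega)
  simp only [lastModes, e] at this
  exact this

/-- `ψ` is in the vacuum state on the modes from `k` on, in the weak sense. -/
def WeakVac {n : ℕ} (k : ℕ) (ψ : Modes n) : Prop := ∀ j : Fin n, k ≤ (j : ℕ) → WeakAnn (annVec j) ψ

theorem inner_vacuum_coh {n : ℕ} (b : EuclideanSpace ℝ (Fin n)) :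
    ⟪vacuum n, coreIncl n (coh b)⟫_ℂ
      = Complex.exp ((-‖b‖ ^ 2 / 4 : ℝ) : ℂ) * ⟪vacuum n, coreIncl n (coh 0)⟫_ℂ := by
  have := inner_coh_add (ψ := vacuum n) (b := b) (c := 0) (fun j _ => weakAnn_vacuum j)
    fun _ _ => rfl
  rwa [add_zero] at this

/-- With the isometry `V φ = φ ⊗ |0⟩`, the claim is `V V* ψ = ψ`. Tested on coherent functions, it
says that `ψ` sees their last-mode parameter only through the Gaussian factor that the vacuum sees,
which is `inner_coh_add`. -/
theorem WeakVac.exists_tensor {k n : ℕ} (h : k ≤ n) {ψ : Modes n} (hψ : WeakVac k ψ) :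
    ∃ φ : Modes k, ψ = tensor h φ (vacuum (n - k)) := by
  set m := n - k with hm
  set V := tensorLeft h (vacuum m) with hV
  refine ⟨V.adjoint ψ, ?_⟩
  show ψ = V (V.adjoint ψ)
  rw [← sub_eq_zero]
  refine eq_zero_of_inner_coh fun a => ?_
  -- The parameter is split as `a = b + c`, with `c` in the first `k` modes and `b` in the others.
  obtain ⟨c, hc1, hc2⟩ := exists_splitModes h (firstModes h a) 0
  obtain ⟨b, hb1, hb2⟩ := exists_splitModes h 0 (lastModes h a)
  have hadj : ∀ φ χ, V.adjoint (tensor h φ χ) = ⟪vacuum m, χ⟫_ℂ • φ := by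
    intro φ χ
    refine ext_inner_left ℂ fun φ' => ?_
    rw [ContinuousLinearMap.adjoint_inner_right, hV, tensorLeft_apply, inner_tensor,
      inner_smul_right, mul_comm]
  have hab : a = b + c := by
    have e : a - (b + c) = 0 := by
      rw [← inner_self_eq_zero (𝕜 := ℝ), inner_splitModes h]
      have e1 : firstModes h (a - (b + c)) = firstModes h a - (firstModes h b + firstModes h c) :=
        rfl
      have e2 : lastModes h (a - (b + c)) = lastModes h a - (lastModes h b + lastModes h c) := rfl
      rw [e1, e2, hb1, hb2, hc1, hc2]
      simp
    exact sub_eq_zero.1 e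
  have hnb : ‖b‖ ^ 2 = ‖lastModes h a‖ ^ 2 := by
    rw [← real_inner_self_eq_norm_sq, inner_splitModes h, hb1, hb2]
    simp
  have h1 : ⟪ψ, coreIncl n (coh a)⟫_ℂ
      = Complex.exp ((-‖lastModes h a‖ ^ 2 / 4 : ℝ) : ℂ) * ⟪ψ, coreIncl n (coh c)⟫_ℂ := by
    rw [hab, inner_coh_add, ← hab, ← hnb]
    · exact fun j hj => hψ j (not_lt.1 fun hjk => hj (apply_of_firstModes_eq_zero h hb1 hjk))
    · exact fun j hj => apply_of_lastModes_eq_zero h hc2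
        (not_lt.1 fun hjk => hj (apply_of_firstModes_eq_zero h hb1 hjk))
  have h2 : V (V.adjoint (coreIncl n (coh a)))
      = Complex.exp ((-‖lastModes h a‖ ^ 2 / 4 : ℝ) : ℂ) • coreIncl n (coh c) := by
    have h3 : ⟪vacuum m, coreIncl m (coh 0)⟫_ℂ * ((Real.pi ^ (-(m : ℝ) / 4) : ℝ) : ℂ) = 1 := by
      have h4 : ⟪vacuum m, vacuum m⟫_ℂ = 1 := by
        rw [inner_self_eq_norm_sq_to_K, norm_vacuum]; simp
      nth_rw 2 [vacuum_eq] at h4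
      rw [inner_smul_right] at h4
      rw [mul_comm, h4]
    have h5 : tensor h (coreIncl k (coh (firstModes h a))) (vacuum m)
        = ((Real.pi ^ (-(m : ℝ) / 4) : ℝ) : ℂ) • coreIncl n (coh c) := by
      rw [vacuum_eq, ← tensorRight_apply, map_smul, tensorRight_apply, ← hc1, ← hc2, tensor_coh]
    rw [← tensor_coh h a, hadj, inner_vacuum_coh, map_smul, hV, tensorLeft_apply, h5,
      smul_smul, mul_assoc, h3, mul_one]
  rw [inner_sub_left, ← ContinuousLinearMap.adjoint_inner_right,
    ContinuousLinearMap.adjoint_inner_left, h2, h1, inner_smul_right, sub_self]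

/-- Linear forms in the quadratures of the modes from `k` on. -/
def LastForm {n : ℕ} (k : ℕ) (ξ : QIdx n → ℝ) : Prop := ∀ l : QIdx n, (l.1 : ℕ) < k → ξ l = 0

/-- `T` acts trivially on the modes from `k` on. -/
def CommutesLast {n : ℕ} (k : ℕ) (T : ModeUnitary n) : Prop :=
  ∀ ξ, LastForm k ξ → ∀ v, T (lift (weyl ξ) v) = lift (weyl ξ) (T v)

theorem CommutesLast.inv {n k : ℕ} {T : ModeUnitary n} (hT : CommutesLast k T) :
    CommutesLast k T⁻¹ := by
  intro ξ hξ v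
  refine T.injective ?_
  rw [hT ξ hξ, apply_inv_self', apply_inv_self']

theorem hasDerivAt_inner_weyl {n : ℕ} (ξ : QIdx n → ℝ) (ψ : Modes n) (f : Core n) :
    HasDerivAt (fun s : ℝ => ⟪ψ, lift (weyl (s • ξ)) (coreIncl n f)⟫_ℂ)
      (Complex.I * ⟪ψ, coreIncl n (linOp ξ f)⟫_ℂ) 0 := by
  have h2 := ((innerSL ℂ ψ).restrictScalars ℝ).hasFDerivAt.comp_hasDerivAt (0 : ℝ)
    ((isFlow_weyl ξ).deriv_zero f)
  refine h2.congr_deriv ?_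
  show ⟪ψ, -Complex.I • coreIncl n ((-linOp ξ) f)⟫_ℂ = _
  rw [inner_smul_right, LinearMap.neg_apply, map_neg, inner_neg_right]
  ring

theorem weyl_neg {n : ℕ} (ξ : QIdx n → ℝ) : lift (weyl (-ξ)) = (lift (weyl ξ))⁻¹ := by
  have := (isFlow_weyl ξ).mul_neg 1
  simpa using this

/-- The image of a Schwartz function under `T` need not be one, so commutation with linear forms is
only available weakly, by differentiating commutation with their Weyl operators. -/
theorem CommutesLast.inner_linOp {n k : ℕ} {T : ModeUnitary n} (hT : CommutesLast k T)
    {ξ : QIdx n → ℝ} (hξ : LastForm k ξ) (f g : Core n) :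
    ⟪T (coreIncl n g), coreIncl n (linOp ξ f)⟫_ℂ
      = ⟪T (coreIncl n (linOp ξ g)), coreIncl n f⟫_ℂ := by
  have h1 := hasDerivAt_inner_weyl ξ (T (coreIncl n g)) f
  have h2 := hasDerivAt_inner_weyl (-ξ) (T⁻¹ (coreIncl n f)) g
  have h3 := (Complex.conjCLE.toContinuousLinearMap.hasFDerivAt.comp_hasDerivAt (0 : ℝ) h2)
  have e : ∀ s : ℝ, (starRingEnd ℂ) ⟪T⁻¹ (coreIncl n f), lift (weyl (s • -ξ)) (coreIncl n g)⟫_ℂ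
      = ⟪T (coreIncl n g), lift (weyl (s • ξ)) (coreIncl n f)⟫_ℂ := by
    intro s
    rw [inner_conj_symm, inner_inv_right, smul_neg, hT (-(s • ξ)) (fun l hl => by simp [hξ l hl]),
      weyl_neg, inner_inv_left]
  have h4 := h3.congr_of_eventuallyEq (Filter.Eventually.of_forall fun s => (e s).symm)
  have h5 := h1.unique h4
  have h6 : linOp (-ξ) g = -linOp ξ g := by simp [linOp]
  rw [h6] at h5
  have h7 : Complex.I * ⟪T (coreIncl n g), coreIncl n (linOp ξ f)⟫_ℂ
      = Complex.I * ⟪T (coreIncl n (linOp ξ g)), coreIncl n f⟫_ℂ := by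
    refine h5.trans ?_
    show (starRingEnd ℂ) _ = _
    rw [map_mul, inner_conj_symm, inner_inv_right]
    simp
  exact mul_left_cancel₀ Complex.I_ne_zero h7

theorem linOp_single {n : ℕ} (k : QIdx n) : linOp (Pi.single k 1) = quad k := by
  rw [linOp, Finset.sum_eq_single k] <;> simp +contextual

theorem CommutesLast.inner_quad {n k : ℕ} {T : ModeUnitary n} (hT : CommutesLast k T)
    {l : QIdx n} (hl : k ≤ (l.1 : ℕ)) (f g : Core n) :
    ⟪T (coreIncl n g), coreIncl n (quad l f)⟫_ℂ = ⟪T (coreIncl n (quad l g)), coreIncl n f⟫_ℂ := by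
  have := hT.inner_linOp (ξ := Pi.single l 1)
    (fun i hi => Pi.single_eq_of_ne (by rintro rfl; omega) 1) f g
  rwa [linOp_single] at this

/-- For coherent `φ` the product is a multiple of a coherent function killed by the last
annihilation operators, which pass through `T` weakly. Totality of coherent functions gives all `φ`.
-/
theorem CommutesLast.weakVac_tensor {n k : ℕ} (h : k ≤ n) {T : ModeUnitary n}
    (hT : CommutesLast k T) (φ : Modes k) : WeakVac k (T (tensor h φ (vacuum (n - k)))) := by
  refine fun j hj => weakAnn_annVec.2 fun f => ?_
  rw [← inner_conj_symm]
  have h1 : (innerSL ℂ (coreIncl n (quad (j, 0) f - Complex.I • quad (j, 1) f))).comp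
      (T.toContinuousLinearEquiv.toContinuousLinearMap.comp (tensorLeft h (vacuum (n - k)))) = 0 := by
    refine ext_coh fun a => ?_
    obtain ⟨c, hc1, hc2⟩ := exists_splitModes h a 0
    have h5 : tensor h (coreIncl k (coh a)) (vacuum (n - k))
        = ((Real.pi ^ (-((n - k : ℕ) : ℝ) / 4) : ℝ) : ℂ) • coreIncl n (coh c) := by
      rw [vacuum_eq, ← tensorRight_apply, map_smul, tensorRight_apply, ← hc1, ← hc2, tensor_coh]
    show ⟪coreIncl n (quad (j, 0) f - Complex.I • quad (j, 1) f),
      T (tensor h (coreIncl k (coh a)) (vacuum (n - k)))⟫_ℂ = 0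
    rw [h5, map_smul, inner_smul_right, ← inner_conj_symm]
    have h6 := congrArg (fun g => ⟪T (coreIncl n g), coreIncl n f⟫_ℂ) (quad_coh j c)
    simp only [apply_of_lastModes_eq_zero h hc2 hj, map_add, map_smul, inner_add_left,
      inner_smul_left] at h6
    rw [map_sub, inner_sub_right, map_smul, inner_smul_right, hT.inner_quad hj, hT.inner_quad hj]
    have h7 : ⟪T (coreIncl n (quad (j, 0) (coh c))), coreIncl n f⟫_ℂ
        - Complex.I * ⟪T (coreIncl n (quad (j, 1) (coh c))), coreIncl n f⟫_ℂ = 0 := by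
      simpa [sub_eq_add_neg] using h6
    rw [h7, map_zero, mul_zero]
  have h2 := congrArg (fun A : Modes k →L[ℂ] ℂ => A φ) h1
  exact (congrArg (starRingEnd ℂ) h2).trans (map_zero _)

theorem CommutesLast.exists_vacuum {n k : ℕ} (h : k ≤ n) {T : ModeUnitary n}
    (hT : CommutesLast k T) :
    ∃ u : Modes k →ₗ[ℂ] Modes k,
      ∀ φ, T (tensor h φ (vacuum (n - k))) = tensor h (u φ) (vacuum (n - k)) := by
  have hinj : Function.Injective (tensorLeft h (vacuum (n - k))) := by
    refine (injective_iff_map_eq_zero _).2 fun φ hφ => ?_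
    rw [← norm_eq_zero, tensorLeft_apply, norm_tensor, norm_vacuum, mul_one] at hφ
    exact norm_eq_zero.1 hφ
  choose u hu using fun φ => (hT.weakVac_tensor h φ).exists_tensor h
  refine ⟨⟨⟨u, fun φ φ' => hinj ?_⟩, fun c φ => hinj ?_⟩, hu⟩
  · rw [map_add]
    simp only [tensorLeft_apply]
    rw [← hu, ← hu, ← hu, ← map_add, ← tensorLeft_apply, map_add]
    rfl
  · rw [map_smul]
    simp only [tensorLeft_apply]
    rw [← hu, RingHom.id_apply, ← hu, ← map_smul, ← tensorLeft_apply, map_smul]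
    rfl

/-- An operator commuting with the Weyl operators of the last modes acts on the first modes. -/
theorem CommutesLast.exists_amplification {n k : ℕ} (h : k ≤ n) {T : ModeUnitary n}
    (hT : CommutesLast k T) : ∃ u, IsAmplification h u T := by
  obtain ⟨u, hu⟩ := hT.exists_vacuum h
  obtain ⟨u', hu'⟩ := hT.inv.exists_vacuum h
  have hinj : ∀ φ φ' : Modes k, tensor h φ (vacuum (n - k)) = tensor h φ' (vacuum (n - k)) →
      φ = φ' := by
    intro φ φ' he
    have h1 : tensorLeft h (vacuum (n - k)) (φ - φ') = 0 := by
      rw [map_sub, tensorLeft_apply, tensorLeft_apply, he, sub_self]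
    rw [← norm_eq_zero, tensorLeft_apply, norm_tensor, norm_vacuum, mul_one] at h1
    exact sub_eq_zero.1 (norm_eq_zero.1 h1)
  have h1 : ∀ φ, u (u' φ) = φ := fun φ => hinj _ _ (by rw [← hu, ← hu', apply_inv_self'])
  have h2 : ∀ φ, u' (u φ) = φ := fun φ => hinj _ _ (by rw [← hu', ← hu, inv_apply_self'])
  have h3 : ∀ φ, ‖u φ‖ = ‖φ‖ := fun φ => by
    have := congrArg norm (hu φ)
    rw [LinearIsometryEquiv.norm_map, norm_tensor, norm_tensor, norm_vacuum, mul_one, mul_one]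
      at this
    exact this.symm
  let U : ModeUnitary k :=
    { u with invFun := u', left_inv := h2, right_inv := h1, norm_map' := h3 }
  have hU : ∀ φ, T (tensor h φ (coreIncl (n - k) (coh 0)))
      = tensor h (U φ) (coreIncl (n - k) (coh 0)) := by
    intro φ
    have h4 := hu φ
    rw [vacuum_eq, ← tensorRight_apply, ← tensorRight_apply, map_smul, map_smul, map_smul] at h4
    exact smul_right_injective _
      (Complex.ofReal_ne_zero.2 (Real.rpow_pos_of_pos Real.pi_pos _).ne') h4
  -- Weyl operators of the last modes turn the vacuum there into any coherent function. As they
  -- commute with `T`, the action known on the vacuum extends to a total set of second factors.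
  have hW : ∀ b : EuclideanSpace ℝ (Fin n), firstModes h b = 0 → ∀ φ : Modes k,
      lift (weyl (posForm b)) (tensor h φ (coreIncl (n - k) (coh 0)))
        = tensor h φ (coreIncl (n - k) (coh (lastModes h b))) := by
    intro b hb φ
    have h5 : (lift (weyl (posForm b))).toContinuousLinearEquiv.toContinuousLinearMap.comp
        (tensorLeft h (coreIncl (n - k) (coh 0)))
        = tensorLeft h (coreIncl (n - k) (coh (lastModes h b))) := by
      refine ext_coh fun a => ?_
      obtain ⟨c, hc1, hc2⟩ := exists_splitModes h a 0
      show lift (weyl (posForm b)) (tensor h (coreIncl k (coh a)) (coreIncl (n - k) (coh 0)))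
        = tensor h (coreIncl k (coh a)) (coreIncl (n - k) (coh (lastModes h b)))
      have h6 := tensor_coh h (b + c)
      rw [firstModes_add, lastModes_add, hb, hc1, hc2, zero_add, add_zero] at h6
      rw [h6, ← hc1, ← hc2, tensor_coh, lift_apply, weyl_posForm_coh]
    exact congrArg (fun A : Modes k →L[ℂ] Modes n => A φ) h5
  refine ⟨U, fun φ χ => ?_⟩
  have h7 : T.toContinuousLinearEquiv.toContinuousLinearMap.comp (tensorRight h φ)
      = tensorRight h (U φ) := by
    refine ext_coh fun b' => ?_
    obtain ⟨b, hb1, hb2⟩ := exists_splitModes h 0 b'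
    show T (tensor h φ (coreIncl (n - k) (coh b'))) = tensor h (U φ) (coreIncl (n - k) (coh b'))
    rw [← hb2, ← hW b hb1, hT, hU, hW b hb1]
    intro l hl
    simp [posForm, apply_of_firstModes_eq_zero h hb1 hl]
  exact congrArg (fun A : Modes (n - k) →L[ℂ] Modes n => A χ) h7

/-! ### Generators of the symplectic group -/

/-- The matrix with position-position block `a`, position-momentum block `b`, momentum-position
block `c` and momentum-momentum block `d`. -/
def blk {n : ℕ} (a b c d : Matrix (Fin n) (Fin n) ℝ) : Matrix (QIdx n) (QIdx n) ℝ :=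
  Matrix.of fun k l => (!![a k.1 l.1, b k.1 l.1; c k.1 l.1, d k.1 l.1] : Matrix _ _ ℝ) k.2 l.2

theorem blk_mul {n : ℕ} (a b c d a' b' c' d' : Matrix (Fin n) (Fin n) ℝ) :
    blk a b c d * blk a' b' c' d'
      = blk (a * a' + b * c') (a * b' + b * d') (c * a' + d * c') (c * b' + d * d') := by
  ext ⟨i, r⟩ ⟨j, s⟩
  rw [Matrix.mul_apply, Fintype.sum_prod_type]
  fin_cases r <;> fin_cases s <;> simp [blk, Matrix.mul_apply, Finset.sum_add_distrib]

theorem blk_one {n : ℕ} : blk (1 : Matrix (Fin n) (Fin n) ℝ) 0 0 1 = 1 := by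
  ext ⟨i, r⟩ ⟨j, s⟩
  fin_cases r <;> fin_cases s <;> simp [blk, Matrix.one_apply]

theorem blk_transpose {n : ℕ} (a b c d : Matrix (Fin n) (Fin n) ℝ) :
    (blk a b c d)ᵀ = blk aᵀ cᵀ bᵀ dᵀ := by
  ext ⟨i, r⟩ ⟨j, s⟩
  fin_cases r <;> fin_cases s <;> simp [blk]

theorem Omega_eq_blk {n : ℕ} : Omega n = blk 0 1 (-1) 0 := by
  ext ⟨i, r⟩ ⟨j, s⟩
  fin_cases r <;> fin_cases s <;> simp [blk, Omega]

theorem exists_eq_blk {n : ℕ} (S : Matrix (QIdx n) (QIdx n) ℝ) : ∃ a b c d, S = blk a b c d := by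
  refine ⟨Matrix.of fun i j => S (i, 0) (j, 0), Matrix.of fun i j => S (i, 0) (j, 1),
    Matrix.of fun i j => S (i, 1) (j, 0), Matrix.of fun i j => S (i, 1) (j, 1), ?_⟩
  ext ⟨i, r⟩ ⟨j, s⟩
  fin_cases r <;> fin_cases s <;> simp [blk]

theorem blk_inj {n : ℕ} {a b c d a' b' c' d' : Matrix (Fin n) (Fin n) ℝ} :
    blk a b c d = blk a' b' c' d' ↔ a = a' ∧ b = b' ∧ c = c' ∧ d = d' := by
  refine ⟨fun h => ?_, by rintro ⟨rfl, rfl, rfl, rfl⟩; rfl⟩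
  have h1 : ∀ i j r s, blk a b c d (i, r) (j, s) = blk a' b' c' d' (i, r) (j, s) :=
    fun i j r s => by rw [h]
  refine ⟨Matrix.ext fun i j => h1 i j 0 0, Matrix.ext fun i j => h1 i j 0 1,
    Matrix.ext fun i j => h1 i j 1 0, Matrix.ext fun i j => h1 i j 1 1⟩

theorem isSymplectic_blk {n : ℕ} {a b c d : Matrix (Fin n) (Fin n) ℝ} :
    IsSymplectic (blk a b c d) ↔
      a * bᵀ = b * aᵀ ∧ a * dᵀ - b * cᵀ = 1 ∧ c * bᵀ - d * aᵀ = -1 ∧ c * dᵀ = d * cᵀ := by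
  rw [IsSymplectic, Omega_eq_blk, blk_transpose, blk_mul, blk_mul, blk_inj]
  simp only [mul_zero, mul_neg, mul_one, zero_add, add_zero, neg_mul]
  constructor
  · rintro ⟨h1, h2, h3, h4⟩
    refine ⟨?_, ?_, ?_, ?_⟩
    · rw [← sub_eq_zero, ← h1]; abel
    · rw [← h2]; abel
    · rw [← h3]; abel
    · rw [← sub_eq_zero, ← h4]; abel
  · rintro ⟨h1, h2, h3, h4⟩
    refine ⟨?_, ?_, ?_, ?_⟩
    · rw [h1]; abel
    · rw [← h2]; abel
    · rw [← h3]; abel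
    · rw [h4]; abel

theorem IsSymplectic.mul {n : ℕ} {S S' : Matrix (QIdx n) (QIdx n) ℝ} (h : IsSymplectic S)
    (h' : IsSymplectic S') : IsSymplectic (S * S') := by
  unfold IsSymplectic at *
  calc S * S' * Omega n * (S * S')ᵀ = S * (S' * Omega n * S'ᵀ) * Sᵀ := by
        simp only [Matrix.transpose_mul, Matrix.mul_assoc]
    _ = Omega n := by rw [h', h]

/-- The polynomial `det (a + X b)` is nonzero because its value at `X = i` is. For a left null
vector `x + i y` of `a + i b`, the relation `a bᵀ = b aᵀ` yields `|x a|² + |x b|² = 0`, so `x` and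
`y` are killed by both `a` and `b`, against `a dᵀ - b cᵀ = 1`. -/
theorem exists_det_add_ne_zero {n : ℕ} {a b c d : Matrix (Fin n) (Fin n) ℝ}
    (h : IsSymplectic (blk a b c d)) : ∃ r : ℝ, (a + r • b).det ≠ 0 := by
  by_contra! h0
  obtain ⟨h1, h2, -, -⟩ := isSymplectic_blk.1 h
  let p : Polynomial ℝ := (a.map (Polynomial.C : ℝ →+* Polynomial ℝ)
    + (Polynomial.X : Polynomial ℝ) • b.map (Polynomial.C : ℝ →+* Polynomial ℝ)).det
  have hp : p = 0 := by
    refine Polynomial.funext fun r => ?_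
    rw [Polynomial.eval_zero, ← h0 r, ← Polynomial.coe_evalRingHom, RingHom.map_det]
    congr 1
    ext i j
    simp
    ring
  have h3 : (a.map Complex.ofReal + Complex.I • b.map Complex.ofReal).det = 0 := by
    have h4 := congrArg (Polynomial.eval₂RingHom Complex.ofRealHom Complex.I) hp
    rw [map_zero, RingHom.map_det] at h4
    rw [← h4]
    congr 1
    ext i j
    simp
    ring
  obtain ⟨v, hv, hv0⟩ := Matrix.exists_vecMul_eq_zero_iff.2 h3
  set x : Fin n → ℝ := fun i => (v i).re with hx
  set y : Fin n → ℝ := fun i => (v i).im with hy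
  have e1 : x ᵥ* a = y ᵥ* b := by
    ext j
    have := congrArg Complex.re (congrFun hv0 j)
    simp [Matrix.vecMul, dotProduct, mul_add, Finset.sum_add_distrib] at this
    simp only [Matrix.vecMul, dotProduct, hx, hy]
    linarith
  have e2 : x ᵥ* b = -(y ᵥ* a) := by
    ext j
    have := congrArg Complex.im (congrFun hv0 j)
    simp [Matrix.vecMul, dotProduct, mul_add, Finset.sum_add_distrib] at this
    simp only [Matrix.vecMul, dotProduct, hx, hy, Pi.neg_apply]
    linarith
  have e3 : (x ᵥ* a) ⬝ᵥ (y ᵥ* b) = (x ᵥ* b) ⬝ᵥ (y ᵥ* a) := by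
    have h5 : ∀ M N : Matrix (Fin n) (Fin n) ℝ, (x ᵥ* M) ⬝ᵥ (y ᵥ* N) = x ⬝ᵥ ((M * Nᵀ) *ᵥ y) := by
      intro M N
      rw [← Matrix.dotProduct_mulVec, ← Matrix.mulVec_transpose, Matrix.mulVec_mulVec]
    rw [h5, h5, h1]
  have e4 : y ᵥ* a = -(x ᵥ* b) := by rw [e2, neg_neg]
  rw [← e1, e4, dotProduct_neg] at e3
  have p1 : 0 ≤ (x ᵥ* a) ⬝ᵥ (x ᵥ* a) := Finset.sum_nonneg fun i _ => mul_self_nonneg _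
  have p2 : 0 ≤ (x ᵥ* b) ⬝ᵥ (x ᵥ* b) := Finset.sum_nonneg fun i _ => mul_self_nonneg _
  have xa : x ᵥ* a = 0 := dotProduct_self_eq_zero.1 (by linarith)
  have xb : x ᵥ* b = 0 := dotProduct_self_eq_zero.1 (by linarith)
  have h6 : ∀ z : Fin n → ℝ, z ᵥ* a = 0 → z ᵥ* b = 0 → z = 0 := by
    intro z za zb
    have := congrArg (fun M : Matrix (Fin n) (Fin n) ℝ => z ᵥ* M) h2
    simpa [Matrix.vecMul_sub, ← Matrix.vecMul_vecMul, za, zb] using this.symm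
  refine hv (funext fun i => Complex.ext ?_ ?_)
  · exact congrFun (h6 x xa xb) i
  · exact congrFun (h6 y (by rw [e4, xb, neg_zero]) (by rw [← e1, xa])) i

/-- Three shears multiply to the antidiagonal block matrix `(0, Y; -Y⁻¹, 0)`, and two of these, with
`Y = X` and `Y = -1`, multiply to the block diagonal one. -/
theorem blk_lower_induction {n : ℕ} {P : Matrix (QIdx n) (QIdx n) ℝ → Prop}
    (hmul : ∀ S S', P S → P S' → P (S * S')) (hlow : ∀ A : Matrix _ _ ℝ, A.IsSymm → P (blk 1 0 A 1))
    (hup : ∀ A : Matrix _ _ ℝ, A.IsSymm → P (blk 1 A 0 1)) {X : Matrix (Fin n) (Fin n) ℝ}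
    (hX : X.IsSymm) (hdet : X.det ≠ 0) : P (blk X 0 0 X⁻¹ᵀ) := by
  have hw : ∀ Y : Matrix (Fin n) (Fin n) ℝ, Y.IsSymm → Y.det ≠ 0 → P (blk 0 Y (-Y⁻¹) 0) := by
    intro Y hY hd
    have hu := (Matrix.isUnit_iff_isUnit_det Y).2 hd.isUnit
    have e : blk 1 Y 0 1 * blk 1 0 (-Y⁻¹) 1 * blk 1 Y 0 1 = blk 0 Y (-Y⁻¹) 0 := by
      rw [blk_mul, blk_mul]
      simp [Matrix.mul_nonsing_inv Y hd.isUnit, Matrix.nonsing_inv_mul Y hd.isUnit]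
    rw [← e]
    exact hmul _ _ (hmul _ _ (hup _ hY) (hlow _ (by rw [Matrix.IsSymm, Matrix.transpose_neg, 
      Matrix.transpose_nonsing_inv, hY.eq]))) (hup _ hY)
  have h1 := hmul _ _ (hw X hX hdet) (hw (-1) (by simp [Matrix.IsSymm]) (by simp [Matrix.det_neg]))
  rw [blk_mul] at h1
  rw [Matrix.transpose_nonsing_inv, hX.eq]
  have e : (-1 : Matrix (Fin n) (Fin n) ℝ)⁻¹ = -1 := Matrix.inv_eq_left_inv (by simp)
  simpa [e] using h1

/-- Invertible matrices are products of symmetric invertible ones: diagonal matrices are symmetric,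
and so is a transvection multiplied by the swap of its two indices. -/
theorem blk_diag_induction {n : ℕ} {P : Matrix (QIdx n) (QIdx n) ℝ → Prop}
    (hmul : ∀ S S', P S → P S' → P (S * S')) (hlow : ∀ A : Matrix _ _ ℝ, A.IsSymm → P (blk 1 0 A 1))
    (hup : ∀ A : Matrix _ _ ℝ, A.IsSymm → P (blk 1 A 0 1)) {X : Matrix (Fin n) (Fin n) ℝ}
    (hdet : X.det ≠ 0) : P (blk X 0 0 X⁻¹ᵀ) := by
  have hm : ∀ A B : Matrix (Fin n) (Fin n) ℝ, P (blk A 0 0 A⁻¹ᵀ) → P (blk B 0 0 B⁻¹ᵀ) →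
      P (blk (A * B) 0 0 (A * B)⁻¹ᵀ) := by
    intro A B hA hB
    have := hmul _ _ hA hB
    rw [blk_mul] at this
    simpa [Matrix.mul_inv_rev, Matrix.transpose_mul] using this
  refine Matrix.diagonal_transvection_induction_of_det_ne_zero (fun X => P (blk X 0 0 X⁻¹ᵀ)) X hdet
    (fun D hD => ?_) (fun t => ?_) fun A B _ _ hA hB => hm A B hA hB
  · exact blk_lower_induction hmul hlow hup (Matrix.diagonal_transpose D) hD
  · obtain ⟨i, j, hij, c⟩ := t
    have hs := Matrix.isSymm_swap (R := ℝ) i j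
    have ht : (Matrix.transvection i j c * Matrix.swap ℝ i j).IsSymm := by
      have e : Matrix.single i j c * Matrix.swap ℝ i j = Matrix.single i i c := by
        ext p q
        by_cases hp : p = i
        · subst hp
          rw [Matrix.mul_apply, Finset.sum_eq_single j (fun x _ hx => by
            simp [Ne.symm hx]) (by simp)]
          simp [Matrix.single_apply, Matrix.swap, PEquiv.toMatrix_apply]
        · simp [Matrix.mul_apply, Ne.symm hp]
      rw [Matrix.transvection, add_mul, one_mul, e]
      exact hs.add (by simp [Matrix.IsSymm])
    have e : Matrix.transvection i j c
        = Matrix.transvection i j c * Matrix.swap ℝ i j * Matrix.swap ℝ i j := by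
      rw [mul_assoc, Matrix.swap_mul_self, mul_one]
    show P (blk (Matrix.transvection i j c) 0 0 (Matrix.transvection i j c)⁻¹ᵀ)
    have hsd : (Matrix.swap ℝ i j).det ≠ 0 := by
      intro h0
      have := congrArg Matrix.det (Matrix.swap_mul_self (R := ℝ) i j)
      rw [Matrix.det_mul, h0] at this
      simp at this
    rw [e]
    refine hm _ _ (blk_lower_induction hmul hlow hup ht ?_) (blk_lower_induction hmul hlow hup hs hsd)
    rw [Matrix.det_mul, Matrix.det_transvection_of_ne i j hij, one_mul]
    exact hsd

/-- Induction on symplectic matrices. -/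
theorem IsSymplectic.induction {n : ℕ} {P : Matrix (QIdx n) (QIdx n) ℝ → Prop}
    (hmul : ∀ S S', P S → P S' → P (S * S')) (hlow : ∀ A : Matrix _ _ ℝ, A.IsSymm → P (blk 1 0 A 1))
    (hup : ∀ A : Matrix _ _ ℝ, A.IsSymm → P (blk 1 A 0 1)) {S : Matrix (QIdx n) (QIdx n) ℝ}
    (hS : IsSymplectic S) : P S := by
  obtain ⟨a, b, c, d, rfl⟩ := exists_eq_blk S
  -- Multiplying by a lower shear with parameter `r` makes the upper left block invertible and opens
  -- the way to a block LDU factorization.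
  obtain ⟨r, hr⟩ := exists_det_add_ne_zero hS
  set a' := a + r • b with ha'
  have hl : IsSymplectic (blk 1 0 (r • (1 : Matrix (Fin n) (Fin n) ℝ)) 1) := by
    rw [isSymplectic_blk]; simp
  have h1 := hS.mul hl
  rw [blk_mul] at h1
  simp only [mul_one, mul_zero, zero_add, Matrix.mul_smul] at h1
  rw [← ha'] at h1
  set c' := c + r • d with hc'
  obtain ⟨h2, h3, -, -⟩ := isSymplectic_blk.1 h1
  have hu := hr.isUnit
  have hut : IsUnit a'ᵀ.det := by rwa [Matrix.det_transpose]
  set X := a'⁻¹ * b with hX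
  have hXs : X.IsSymm := by
    have h4 : bᵀ = X * a'ᵀ := by
      rw [hX, mul_assoc, ← h2, ← mul_assoc, Matrix.nonsing_inv_mul _ hu, one_mul]
    rw [Matrix.IsSymm, hX, Matrix.transpose_mul, h4, Matrix.transpose_nonsing_inv, mul_assoc,
      Matrix.mul_nonsing_inv _ hut, mul_one]
  set Y := c' * a'⁻¹ with hY
  have haX : a' * X = b := by rw [hX, ← mul_assoc, Matrix.mul_nonsing_inv _ hu, one_mul]
  have hYa : Y * a' = c' := by rw [hY, mul_assoc, Matrix.nonsing_inv_mul _ hu, mul_one]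
  -- After clearing the upper right block and normalizing the upper left one, the symplectic
  -- relations force what remains to be a lower shear.
  have h5 : blk a' b c' d * (blk 1 (-X) 0 1 * blk a'⁻¹ 0 0 a'ᵀ)
      = blk 1 0 Y ((d - c' * X) * a'ᵀ) := by
    rw [blk_mul, blk_mul]
    simp only [mul_zero, zero_add, add_zero, one_mul, zero_mul, neg_mul, mul_neg,
      Matrix.mul_nonsing_inv _ hu, ← mul_assoc, haX, neg_add_cancel]
    rw [sub_mul, neg_add_eq_sub]
  have h6 : IsSymplectic (blk 1 0 Y ((d - c' * X) * a'ᵀ)) := by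
    rw [← h5]
    refine h1.mul (IsSymplectic.mul ?_ ?_)
    · rw [isSymplectic_blk]; simp [hXs.eq]
    · rw [isSymplectic_blk]
      simp [Matrix.nonsing_inv_mul _ hu, ← Matrix.transpose_mul]
  obtain ⟨-, h7, -, h8⟩ := isSymplectic_blk.1 h6
  simp only [one_mul, zero_mul, sub_zero] at h7
  have h9 : (d - c' * X) * a'ᵀ = 1 := by rw [← Matrix.transpose_inj, h7, Matrix.transpose_one]
  rw [h7, h9, mul_one, one_mul] at h8
  have h10 : d - c' * X = a'⁻¹ᵀ := by
    rw [Matrix.transpose_nonsing_inv]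
    exact (Matrix.inv_eq_left_inv h9).symm
  have h11 : blk a b c d = blk 1 0 Y 1 * blk a' 0 0 a'⁻¹ᵀ * blk 1 X 0 1
      * blk 1 0 (-(r • (1 : Matrix (Fin n) (Fin n) ℝ))) 1 := by
    have ea : a = a' - r • b := by rw [ha', add_sub_cancel_right]
    have ec : c = c' - r • d := by rw [hc', add_sub_cancel_right]
    clear_value a' c' X Y
    rw [blk_mul, blk_mul, blk_mul, ← h10, ea, ec]
    simp [haX, hYa, sub_eq_add_neg]
  rw [h11]
  exact hmul _ _ (hmul _ _ (hmul _ _ (hlow _ h8.symm) (blk_diag_induction hmul hlow hup hr))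
    (hup _ hXs)) (hlow _ (by simp [Matrix.IsSymm]))

/-! ### Existence of symplectic unitaries -/

/-- The Gaussian unitaries whose inverse is Gaussian. -/
def gaussSubgroup (n : ℕ) : Subgroup (ModeUnitary n) where
  carrier := {W | IsGaussian W ∧ IsGaussian W⁻¹}
  mul_mem' h h' := ⟨Submonoid.mul_mem _ h.1 h'.1, by
    rw [mul_inv_rev]; exact Submonoid.mul_mem _ h'.2 h.2⟩
  one_mem' := ⟨Submonoid.one_mem _, by rw [inv_one]; exact Submonoid.one_mem _⟩
  inv_mem' h := ⟨h.2, by rw [inv_inv]; exact h.1⟩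

/-- `e† R_k e = ∑ l, S k l R_l`. -/
def Intertwines {n : ℕ} (S : Matrix (QIdx n) (QIdx n) ℝ) (e : coreUnitary n) : Prop :=
  ∀ k f, quad k (e.1 f) = e.1 (∑ l, ((S k l : ℝ) : ℂ) • quad l f)

theorem Intertwines.mul {n : ℕ} {S S' : Matrix (QIdx n) (QIdx n) ℝ} {e e' : coreUnitary n}
    (h : Intertwines S e) (h' : Intertwines S' e') : Intertwines (S * S') (e * e') := by
  intro k f
  simp only [coreUnitary_mul_apply, h _ _, h' _ _, map_sum, map_smul, Finset.smul_sum, smul_smul,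
    Matrix.mul_apply]
  rw [Finset.sum_comm]
  simp only [Complex.ofReal_sum, Complex.ofReal_mul, Finset.sum_smul]

theorem Intertwines.inv {n : ℕ} {S S' : Matrix (QIdx n) (QIdx n) ℝ} {e : coreUnitary n}
    (h : Intertwines S e) (hS : S' * S = 1) : Intertwines S' e⁻¹ := by
  intro k f
  obtain ⟨g, rfl⟩ := e.1.surjective f
  have h1 : ∀ g, (e⁻¹).1 (e.1 g) = g := fun g => e.1.symm_apply_apply g
  simp only [h _ _, h1, map_sum, map_smul, Finset.smul_sum, smul_smul]
  rw [Finset.sum_comm]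
  have h2 : ∀ l, ∑ m, (((S' k m : ℝ) : ℂ) * ((S m l : ℝ) : ℂ)) • quad l g
      = if k = l then quad l g else 0 := by
    intro l
    rw [← Finset.sum_smul]
    have := congrFun (congrFun hS k) l
    rw [Matrix.mul_apply, Matrix.one_apply] at this
    have h3 : ∑ m, ((S' k m : ℝ) : ℂ) * ((S m l : ℝ) : ℂ) = ((if k = l then 1 else 0 : ℝ) : ℂ) := by
      rw [← this]; push_cast; rfl
    rw [h3]
    split_ifs <;> simp
  simp [h2]

theorem Intertwines.isSymplecticUnitary {n : ℕ} {S : Matrix (QIdx n) (QIdx n) ℝ}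
    {e : coreUnitary n} (h : Intertwines S e) (he : lift e ∈ gaussSubgroup n) :
    IsSymplecticUnitary S (lift e) :=
  ⟨he.1, fun f => ⟨e.1 f, (lift_apply e f).symm, fun k => by rw [h, lift_apply]⟩⟩

/-- The quadratic form `½ ⟨x - m, A (x - m)⟩`. -/
def quadForm {n : ℕ} (A : Matrix (Fin n) (Fin n) ℝ) (m : Fin n → ℝ)
    (x : EuclideanSpace ℝ (Fin n)) : ℝ := (1 / 2) * ∑ i, ∑ j, A i j * ((x i - m i) * (x j - m j))

theorem hasTemperateGrowth_quadForm {n : ℕ} (A : Matrix (Fin n) (Fin n) ℝ) (m : Fin n → ℝ) :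
    (quadForm A m).HasTemperateGrowth := by
  have hc : ∀ i, (fun x : EuclideanSpace ℝ (Fin n) => x i).HasTemperateGrowth := fun i =>
    (EuclideanSpace.proj i : EuclideanSpace ℝ (Fin n) →L[ℝ] ℝ).hasTemperateGrowth
  exact (Function.HasTemperateGrowth.const _).mul (.sum fun i _ => .sum fun j _ =>
    (Function.HasTemperateGrowth.const _).mul (((hc i).sub (.const _)).mul ((hc j).sub (.const _))))

theorem quadraticHam_blk_pos {n : ℕ} (A : Matrix (Fin n) (Fin n) ℝ) (m : QIdx n → ℝ) :
    quadraticHam (blk A 0 0 0) m = mulOp (quadForm A fun i => m (i, 0)) := by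
  refine LinearMap.ext fun f => SchwartzMap.ext fun x => ?_
  rw [quadraticHam_apply, mulOp_apply (hasTemperateGrowth_quadForm A _)]
  simp only [Fintype.sum_prod_type, Fin.sum_univ_two]
  simp [blk, quad_zero, position_apply, quadForm, mul_assoc, Finset.mul_sum, Finset.sum_mul,
    smul_apply, sum_apply]
  exact Finset.sum_congr rfl fun i _ => Finset.sum_congr rfl fun j _ => by ring

/-- Multiplication by `exp (½ i ⟨x - m, A (x - m)⟩)`. -/
def chirp {n : ℕ} (A : Matrix (Fin n) (Fin n) ℝ) (m : Fin n → ℝ) : coreUnitary n :=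
  phase (quadForm A m) (hasTemperateGrowth_quadForm A m)

theorem quadForm_neg {n : ℕ} (A : Matrix (Fin n) (Fin n) ℝ) (m : Fin n → ℝ)
    (x : EuclideanSpace ℝ (Fin n)) : quadForm (-A) m x = -quadForm A m x := by
  simp [quadForm]

theorem chirp_neg {n : ℕ} (A : Matrix (Fin n) (Fin n) ℝ) (m : Fin n → ℝ) :
    chirp (-A) m = (chirp A m)⁻¹ := by
  refine eq_inv_of_mul_eq_one_left (coreUnitary_ext fun f x => ?_)
  rw [coreUnitary_mul_apply, chirp, chirp, phase_apply, phase_apply, ← mul_assoc, ← Complex.exp_add,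
    quadForm_neg]
  simp

theorem phase_neg_quadForm {n : ℕ} (A : Matrix (Fin n) (Fin n) ℝ) (m : Fin n → ℝ)
    (h : Function.HasTemperateGrowth fun x => -1 * quadForm (-A) m x) :
    phase (fun x => -1 * quadForm (-A) m x) h = chirp A m := by
  refine coreUnitary_ext fun f x => ?_
  rw [chirp, phase_apply, phase_apply, quadForm_neg, neg_one_mul, neg_neg]

theorem isGaussian_chirp {n : ℕ} {A : Matrix (Fin n) (Fin n) ℝ} (hA : A.IsSymm) (m : Fin n → ℝ) :
    IsGaussian (lift (chirp A m)) := by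
  refine Submonoid.subset_closure ⟨blk (-A) 0 0 0, fun k => if k.2 = 0 then m k.1 else 0, ?_, ?_⟩
  · rw [Matrix.IsSymm, blk_transpose, Matrix.transpose_neg, hA.eq]; simp
  · have h1 := (isFlow_phase (hasTemperateGrowth_quadForm (-A) m)).isGeneratedBy
    rw [phase_neg_quadForm] at h1
    rw [quadraticHam_blk_pos]
    simpa using h1

theorem chirp_mem {n : ℕ} {A : Matrix (Fin n) (Fin n) ℝ} (hA : A.IsSymm) (m : Fin n → ℝ) :
    lift (chirp A m) ∈ gaussSubgroup n :=
  ⟨isGaussian_chirp hA m, by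
    rw [← map_inv, ← chirp_neg]
    exact isGaussian_chirp (by rw [Matrix.IsSymm, Matrix.transpose_neg, hA.eq]) m⟩

theorem momentum_phase {n : ℕ} {q : EuclideanSpace ℝ (Fin n) → ℝ} (hq : q.HasTemperateGrowth)
    (j : Fin n) {q' : ℝ} {x : EuclideanSpace ℝ (Fin n)}
    (h : HasLineDerivAt ℝ q q' x (EuclideanSpace.single j 1)) (f : Core n) :
    momentum j ((phase q hq).1 f) x
      = Complex.exp (Complex.I * q x) * (q' * f x + momentum j f x) := by
  have h1 : HasDerivAt (fun t : ℝ => f (x + t • EuclideanSpace.single j 1)) _ 0 :=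
    (f.differentiableAt (x := x)).hasFDerivAt.hasLineDerivAt (EuclideanSpace.single j 1)
  have h2 : HasDerivAt (fun t : ℝ => q (x + t • EuclideanSpace.single j 1)) q' 0 := h
  have h3 := ((h2.ofReal_comp.const_mul Complex.I).cexp.mul h1)
  have h4 : HasLineDerivAt ℝ ((phase q hq).1 f) _ x (EuclideanSpace.single j 1) :=
    h3.congr_of_eventuallyEq (Filter.Eventually.of_forall fun t => phase_apply hq f _)
  rw [momentum_apply, h4.lineDeriv, momentum_apply_fderiv]
  simp only [zero_smul, add_zero]
  linear_combination -Complex.exp (Complex.I * q x) * q' * f x * Complex.I_sq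

theorem hasLineDerivAt_quadForm {n : ℕ} {A : Matrix (Fin n) (Fin n) ℝ} (hA : A.IsSymm) (j : Fin n)
    (x : EuclideanSpace ℝ (Fin n)) :
    HasLineDerivAt ℝ (quadForm A 0) (∑ l, A j l * x l) x (EuclideanSpace.single j 1) := by
  have h0 : ∀ i, HasDerivAt (fun t : ℝ => (x + t • EuclideanSpace.single j (1 : ℝ)) i - 0)
      (if i = j then 1 else 0) 0 := by
    intro i
    have := ((hasDerivAt_id (0 : ℝ)).mul_const (if i = j then (1 : ℝ) else 0)).const_add (x i)
    simpa [Pi.single_apply] using this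
  have h1 : HasDerivAt (fun t : ℝ => quadForm A 0 (x + t • EuclideanSpace.single j (1 : ℝ))) _ 0 :=
    (HasDerivAt.fun_sum fun i _ => HasDerivAt.fun_sum fun l _ =>
      ((h0 i).mul (h0 l)).const_mul (A i l)).const_mul (1 / 2 : ℝ)
  refine HasDerivAt.congr_deriv h1 ?_
  simp [mul_add, Finset.sum_add_distrib]
  have h2 : ∑ i, A i j * x i = ∑ l, A j l * x l :=
    Finset.sum_congr rfl fun i _ => by rw [hA.apply]
  rw [h2]
  ring

theorem intertwines_chirp {n : ℕ} {A : Matrix (Fin n) (Fin n) ℝ} (hA : A.IsSymm) :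
    Intertwines (blk 1 0 A 1) (chirp A 0) := by
  rintro ⟨j, i⟩ f
  rw [Fintype.sum_prod_type]
  ext x
  rw [chirp]
  fin_cases i
  · show position j _ x = _
    rw [position_apply, phase_apply, phase_apply]
    simp [blk, Matrix.one_apply, quad_zero, position_apply]
    ring
  · show momentum j _ x = _
    rw [momentum_phase _ j (hasLineDerivAt_quadForm hA j x), phase_apply]
    simp [blk, Matrix.one_apply, quad_zero, quad_one, position_apply, Finset.sum_add_distrib,
      Finset.sum_mul, mul_assoc, sum_apply, smul_apply]

theorem momentumAlong_single {n : ℕ} (j : Fin n) :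
    momentumAlong (EuclideanSpace.single j (1 : ℝ)) = momentum (n := n) j := rfl

theorem fourierCore_momentum {n : ℕ} (j : Fin n) (f : Core n) :
    (fourierCore n).1 (momentum j f) = (2 * Real.pi : ℂ) • position j ((fourierCore n).1 f) := by
  rw [← momentumAlong_single, fourierCore_momentumAlong]
  ext x
  rw [mulOp_apply (by fun_prop), smul_apply, position_apply, EuclideanSpace.inner_single_left]
  simp
  ring

theorem fourierCore_position {n : ℕ} (j : Fin n) (f : Core n) :
    momentum j ((fourierCore n).1 f) = (fourierCore n).1 (-(2 * Real.pi : ℂ) • position j f) := by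
  show -Complex.I • ∂_{EuclideanSpace.single j (1 : ℝ)} (FourierTransform.fourier f : Core n) = _
  rw [SchwartzMap.lineDerivOp_fourier_eq, fourierCore_apply, ← FourierTransform.fourier_smul]
  congr 1
  ext x
  rw [smul_apply, smul_apply, smul_apply, position_apply, smulLeftCLM_apply_apply (by fun_prop),
    EuclideanSpace.inner_single_right]
  simp
  linear_combination (2 * Real.pi : ℂ) * (x j : ℝ) * f x * Complex.I_sq

/-- The factors `2π` come from the normalization of the Fourier transform; `fourierChirp` is scaled
so that they cancel. -/
theorem intertwines_fourier {n : ℕ} :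
    Intertwines (blk 0 ((2 * Real.pi)⁻¹ • (1 : Matrix (Fin n) (Fin n) ℝ)) (-(2 * Real.pi) • 1) 0)
      (fourierCore n) := by
  rintro ⟨j, i⟩ f
  rw [Fintype.sum_prod_type]
  fin_cases i
  · show position j _ = _
    have h1 : ∑ l, ∑ r : Fin 2, ((blk 0 ((2 * Real.pi)⁻¹ • (1 : Matrix (Fin n) (Fin n) ℝ))
        (-(2 * Real.pi) • 1) 0 (j, 0) (l, r) : ℝ) : ℂ) • quad (l, r) f
        = (2 * Real.pi : ℂ)⁻¹ • momentum j f := by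
      rw [Finset.sum_eq_single j (by intro l _ hl; simp [blk, Ne.symm hl]) (by simp)]
      simp [blk, quad_one, -Complex.coe_smul]
    refine Eq.trans ?_ (congrArg (fourierCore n).1 h1.symm)
    rw [map_smul, fourierCore_momentum, smul_smul, inv_mul_cancel₀, one_smul]
    simp
  · show momentum j _ = _
    have h1 : ∑ l, ∑ r : Fin 2, ((blk 0 ((2 * Real.pi)⁻¹ • (1 : Matrix (Fin n) (Fin n) ℝ))
        (-(2 * Real.pi) • 1) 0 (j, 1) (l, r) : ℝ) : ℂ) • quad (l, r) f
        = -(2 * Real.pi : ℂ) • position j f := by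
      rw [Finset.sum_eq_single j (by intro l _ hl; simp [blk, Ne.symm hl]) (by simp)]
      simp [blk, quad_zero, -Complex.coe_smul]
    refine Eq.trans ?_ (congrArg (fourierCore n).1 h1.symm)
    rw [fourierCore_position]

theorem quadraticHam_blk_mom {n : ℕ} (B : Matrix (Fin n) (Fin n) ℝ) (f : Core n) :
    (fourierCore n).1 (quadraticHam (blk 0 0 0 B) 0 f)
      = mulOp (quadForm ((2 * Real.pi) ^ 2 • B) 0) ((fourierCore n).1 f) := by
  have h0 := hasTemperateGrowth_quadForm ((2 * Real.pi) ^ 2 • B) 0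
  rw [quadraticHam_apply]
  simp only [Fintype.sum_prod_type, Fin.sum_univ_two]
  simp [blk, quad_one, fourierCore_momentum, -Complex.coe_smul]
  ext x
  rw [mulOp_apply h0]
  simp [quadForm, smul_apply, sum_apply, position_apply, Finset.mul_sum, Finset.sum_mul]
  exact Finset.sum_congr rfl fun i _ => Finset.sum_congr rfl fun j _ => by ring

/-- The chirp in momentum space. -/
def fourierChirp {n : ℕ} (A : Matrix (Fin n) (Fin n) ℝ) : coreUnitary n :=
  (fourierCore n)⁻¹ * chirp (-(2 * Real.pi) ^ 2 • A) 0 * fourierCore n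

theorem intertwines_fourierChirp {n : ℕ} {A : Matrix (Fin n) (Fin n) ℝ} (hA : A.IsSymm) :
    Intertwines (blk 1 A 0 1) (fourierChirp A) := by
  have h0 : 2 * Real.pi * (2 * Real.pi)⁻¹ = 1 := mul_inv_cancel₀ (by positivity)
  have hi := intertwines_fourier (n := n)
  have hc := intertwines_chirp (A := -(2 * Real.pi) ^ 2 • A) (hA.smul _)
  rw [fourierChirp]
  -- Only `2π * (2π)⁻¹ = 1` matters from here on; what is left is algebra of blocks.
  generalize (2 * Real.pi)⁻¹ = α at *
  generalize 2 * Real.pi = β at *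
  have h1 := ((hi.inv (S' := blk 0 (-α • 1) (β • 1) 0) (by
      rw [blk_mul, ← blk_one]
      simp [smul_smul, h0, mul_comm α])).mul hc).mul hi
  have e : blk 0 (-α • 1) (β • 1) 0 * blk 1 0 (-β ^ 2 • A) 1 * blk 0 (α • 1) (-β • 1) 0
      = blk 1 A 0 1 := by
    rw [blk_mul, blk_mul]
    have e2 : α * (β ^ 2 * α) = 1 := by linear_combination (β * α + 1) * h0
    simp [smul_smul, h0, mul_comm α β, e2]
  rwa [e] at h1

theorem isGaussian_fourierChirp {n : ℕ} {A : Matrix (Fin n) (Fin n) ℝ} (hA : A.IsSymm) :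
    IsGaussian (lift (fourierChirp A)) := by
  refine Submonoid.subset_closure ⟨blk 0 0 0 A, 0, ?_, ?_⟩
  · rw [Matrix.IsSymm, blk_transpose, hA.eq]; simp
  · have h1 := (isFlow_phase (hasTemperateGrowth_quadForm ((2 * Real.pi) ^ 2 • A) 0)).conj
      (fourierCore n) (quadraticHam_blk_mom A)
    simp only [← map_mul, ← map_inv] at h1
    have h2 := h1.isGeneratedBy
    have h3 : (2 * Real.pi) ^ 2 • A = -(-(2 * Real.pi) ^ 2 • A) := by rw [neg_smul, neg_neg]
    simp only [h3, phase_neg_quadForm] at h2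
    exact h2

theorem fourierChirp_neg {n : ℕ} (A : Matrix (Fin n) (Fin n) ℝ) :
    fourierChirp (-A) = (fourierChirp A)⁻¹ := by
  rw [fourierChirp, fourierChirp, smul_neg, chirp_neg]
  group

/-- Shears generate the symplectic group. Lower ones are realised by quadratic phases in position,
upper ones by quadratic phases in momentum, and inverses are of the same type. -/
theorem exists_intertwines {n : ℕ} {S : Matrix (QIdx n) (QIdx n) ℝ} (hS : IsSymplectic S) :
    ∃ e : coreUnitary n, lift e ∈ gaussSubgroup n ∧ Intertwines S e := by
  refine hS.induction (P := fun S => ∃ e : coreUnitary n, lift e ∈ gaussSubgroup n ∧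
    Intertwines S e) ?_ (fun A hA => ⟨_, chirp_mem hA 0, intertwines_chirp hA⟩)
    fun A hA => ⟨_, ⟨isGaussian_fourierChirp hA, ?_⟩, intertwines_fourierChirp hA⟩
  · rintro S S' ⟨e, he, h⟩ ⟨e', he', h'⟩
    exact ⟨e * e', by rw [map_mul]; exact mul_mem he he', h.mul h'⟩
  · rw [← map_inv, ← fourierChirp_neg]
    exact isGaussian_fourierChirp (by rw [Matrix.IsSymm, Matrix.transpose_neg, hA.eq])

/-! ### Symplectic unitaries and displacements on Weyl operators -/

theorem linOp_weyl {n : ℕ} (ξ ζ : QIdx n → ℝ) (f : Core n) :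
    linOp ξ ((weyl ζ).1 f) = (weyl ζ).1 (linOp ξ f - ((omega ξ ζ : ℝ) : ℂ) • f) := by
  rw [omega_eq_dotProduct, linOp_apply, linOp_apply]
  simp only [quad_weyl, ← map_smul (weyl ζ).1, ← map_sum (weyl ζ).1]
  congr 1
  simp only [smul_sub, Finset.sum_sub_distrib, smul_smul, ← Finset.sum_smul, dotProduct,
    Complex.ofReal_sum, Complex.ofReal_mul]

theorem IsSymplecticUnitary.coreIncl_linOp {n : ℕ} {S : Matrix (QIdx n) (QIdx n) ℝ}
    {W : ModeUnitary n} (hW : IsSymplecticUnitary S W) (f : Core n) :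
    ∃ g, coreIncl n g = W (coreIncl n f) ∧
      ∀ η, coreIncl n (linOp η g) = W (coreIncl n (linOp (Sᵀ *ᵥ η) f)) := by
  obtain ⟨g, hg, hk⟩ := hW.2 f
  refine ⟨g, hg, fun η => ?_⟩
  rw [linOp_apply, linOp_apply]
  simp only [map_sum, map_smul, hk, Finset.smul_sum, smul_smul, Matrix.mulVec, dotProduct,
    Matrix.transpose_apply, Complex.ofReal_sum, Complex.ofReal_mul, Finset.sum_smul]
  rw [Finset.sum_comm]
  exact Finset.sum_congr rfl fun l _ => Finset.sum_congr rfl fun k _ => by rw [mul_comm]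

theorem omega_self {n : ℕ} (ξ : QIdx n → ℝ) : omega ξ ξ = 0 := by
  have := omega_smul_smul_self 1 1 ξ
  simpa using this

/-- Since `W` keeps Schwartz functions in the core and intertwines linear forms, the image under `W`
of the orbit of `f` along `Sᵀ η` solves the Schrödinger equation for the form `η`; uniqueness
identifies it. -/
theorem IsSymplecticUnitary.weyl_apply {n : ℕ} {S : Matrix (QIdx n) (QIdx n) ℝ}
    {W : ModeUnitary n} (hW : IsSymplecticUnitary S W) (η : QIdx n → ℝ) (v : Modes n) :
    W (lift (weyl (Sᵀ *ᵥ η)) v) = lift (weyl η) (W v) := by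
  suffices h : W * lift (weyl (Sᵀ *ᵥ η)) = lift (weyl η) * W from
    congrArg (fun U : ModeUnitary n => U v) h
  refine modeUnitary_ext fun f => ?_
  set ξ := Sᵀ *ᵥ η with hξ
  choose g hg hη using fun s : ℝ => hW.coreIncl_linOp ((weyl (s • ξ)).1 f)
  have h1 : ∀ s ∈ Set.Ioo (-2 : ℝ) 2, HasDerivAt (fun s => coreIncl n (g s))
      (-Complex.I • coreIncl n ((-linOp η) (g s))) s := by
    intro s _
    have h2 := ((W.toContinuousLinearEquiv.toContinuousLinearMap).restrictScalars
      ℝ).hasFDerivAt.comp_hasDerivAt s ((isFlow_weyl ξ).hasDerivAt f s)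
    have e : ∀ s, W (lift (weyl (s • ξ)) (coreIncl n f)) = coreIncl n (g s) := fun s => by
      rw [hg, lift_apply]
    have h3 : HasDerivAt (fun s => W (lift (weyl (s • ξ)) (coreIncl n f)))
      (W (lift (weyl (s • ξ)) (-Complex.I • coreIncl n ((-linOp ξ) f)))) s := h2
    simp only [e] at h3
    refine h3.congr_deriv ?_
    have h4 : linOp ξ ((weyl (s • ξ)).1 f) = (weyl (s • ξ)).1 (linOp ξ f) := by
      have : omega ξ (s • ξ) = 0 := by
        rw [omega_eq_dotProduct, Matrix.mulVec_smul, dotProduct_smul, ← omega_eq_dotProduct,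
          omega_self, smul_zero]
      rw [linOp_weyl, this]
      simp
    rw [LinearMap.neg_apply, LinearMap.neg_apply, map_neg, map_neg, hη, ← hξ, h4, map_smul,
      map_smul, map_neg, map_neg, lift_apply]
  have h5 := (isFlow_weyl η).eq_of_curve h1 (s := 1) ⟨by norm_num, by norm_num⟩
  rw [hg, hg, one_smul, one_smul, zero_smul, weyl_zero] at h5
  rw [mul_apply', mul_apply', lift_apply, h5]
  rfl

/-- Multiplication by `exp (i θ)`. -/
def scal (n : ℕ) (θ : ℝ) : coreUnitary n := phase (fun _ => θ) (.const θ)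

theorem scal_apply {n : ℕ} (θ : ℝ) (f : Core n) :
    (scal n θ).1 f = Complex.exp (Complex.I * θ) • f := by
  ext x
  rw [scal, phase_apply, smul_apply, smul_eq_mul]

theorem lift_scal_apply {n : ℕ} (θ : ℝ) (v : Modes n) :
    lift (scal n θ) v = Complex.exp (Complex.I * θ) • v :=
  congrFun ((denseRange_coreIncl n).equalizer (lift (scal n θ)).continuous
    (continuous_const_smul (Complex.exp (Complex.I * θ)))
    (funext fun f => by rw [Function.comp_apply, Function.comp_apply, lift_apply, scal_apply,
      map_smul])) v

theorem lift_scal_comm {n : ℕ} (θ : ℝ) (W : ModeUnitary n) :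
    lift (scal n θ) * W = W * lift (scal n θ) :=
  LinearIsometryEquiv.ext fun v => by
    rw [mul_apply', mul_apply', lift_scal_apply, lift_scal_apply, map_smul]

/-- Two chirps of opposite curvature and different centres multiply to a linear phase, by `|x|² / 2
- |x - a|² / 2 = ⟨a, x⟩ - |a|² / 2`. -/
theorem exists_scal_weyl_posForm_mem {n : ℕ} (a : EuclideanSpace ℝ (Fin n)) :
    ∃ θ, lift (scal n θ * weyl (posForm a)) ∈ gaussSubgroup n := by
  refine ⟨-(‖a‖ ^ 2 / 2), ?_⟩
  have e : scal n (-(‖a‖ ^ 2 / 2)) * weyl (posForm a) = chirp (-1) a * chirp 1 0 := by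
    refine coreUnitary_ext fun f x => ?_
    have h1 : posPart (posForm a) = a := by ext j; simp [posForm]
    have h2 : momPart (posForm a) = 0 := by ext j; simp [posForm]
    rw [coreUnitary_mul_apply, scal_apply, smul_apply, weyl_apply, h1, h2, coreUnitary_mul_apply,
      chirp, chirp, phase_apply, phase_apply, ← mul_assoc, ← Complex.exp_add, smul_eq_mul,
      ← mul_assoc, ← Complex.exp_add, inner_zero_right, zero_div, add_zero, add_zero, quadForm_neg]
    have h3 : -(‖a‖ ^ 2 / 2) + inner ℝ a x = -quadForm 1 a x + quadForm 1 0 x := by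
      rw [EuclideanSpace.real_norm_sq_eq]
      simp only [PiLp.inner_apply, quadForm, Matrix.one_apply, ite_mul, one_mul, zero_mul,
        Finset.sum_ite_eq, Finset.mem_univ, if_true]
      rw [Finset.sum_div, ← Finset.sum_neg_distrib, ← Finset.sum_add_distrib, Finset.mul_sum,
        Finset.mul_sum, ← Finset.sum_neg_distrib, ← Finset.sum_add_distrib]
      refine Finset.sum_congr rfl fun i _ => ?_
      simp
      ring
    rw [← mul_add, ← mul_add, ← Complex.ofReal_add, ← Complex.ofReal_add, h3]
  rw [e, map_mul]
  exact mul_mem (chirp_mem (by simp [Matrix.IsSymm]) _) (chirp_mem Matrix.isSymm_one _)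

theorem Omega_transpose (n : ℕ) : (Omega n)ᵀ = -Omega n := by
  rw [Omega_eq_blk, blk_transpose]
  ext ⟨i, r⟩ ⟨j, s⟩
  fin_cases r <;> fin_cases s <;> simp [blk, Matrix.one_apply, eq_comm]

theorem isSymplectic_Omega (n : ℕ) : IsSymplectic (Omega n) := by
  rw [Omega_eq_blk, isSymplectic_blk]
  simp

/-- Conjugation by a symplectic unitary of `Ω` turns position Weyl operators into momentum ones;
combining the two kinds costs a phase. -/
theorem exists_scal_weyl_mem {n : ℕ} (ξ : QIdx n → ℝ) :
    ∃ θ, lift (scal n θ * weyl ξ) ∈ gaussSubgroup n := by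
  obtain ⟨e, he, hS⟩ := exists_intertwines (isSymplectic_Omega n)
  have hW := hS.isSymplecticUnitary he
  obtain ⟨θ, hθ⟩ := exists_scal_weyl_posForm_mem (posPart ξ)
  obtain ⟨τ, hτ⟩ := exists_scal_weyl_posForm_mem (-momPart ξ)
  set η : QIdx n → ℝ := Omega n *ᵥ posForm (-momPart ξ) with hη
  have h1 : (Omega n)ᵀ *ᵥ η = posForm (-momPart ξ) := by
    rw [Omega_transpose, Matrix.neg_mulVec, hη, Omega_mulVec_mulVec, neg_neg]
  have h2 : lift e * lift (weyl (posForm (-momPart ξ))) = lift (weyl η) * lift e :=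
    LinearIsometryEquiv.ext fun v => by rw [← h1]; exact hW.weyl_apply η v
  have h3 : lift (scal n τ * weyl η) ∈ gaussSubgroup n := by
    have h4 : lift (scal n τ * weyl η)
        = lift e * lift (scal n τ * weyl (posForm (-momPart ξ))) * (lift e)⁻¹ := by
      rw [eq_mul_inv_iff_mul_eq, map_mul, map_mul, mul_assoc, ← h2, ← mul_assoc, ← mul_assoc,
        lift_scal_comm]
    rw [h4]
    exact mul_mem (mul_mem he hτ) (inv_mem he)
  have h5 : ξ = posForm (posPart ξ) + η := by
    ext ⟨j, i⟩
    fin_cases i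
    · show ξ (j, 0) = posForm (posPart ξ) (j, 0) + η (j, 0)
      rw [hη, Omega_mulVec_zero]
      simp [posForm]
    · show ξ (j, 1) = posForm (posPart ξ) (j, 1) + η (j, 1)
      rw [hη, Omega_mulVec_one]
      simp [posForm]
  refine ⟨θ + τ - omega (posForm (posPart ξ)) η / 2, ?_⟩
  have h6 := mul_mem hθ h3
  rw [← map_mul] at h6
  convert h6 using 2
  refine coreUnitary_ext fun f x => ?_
  nth_rw 2 [h5]
  simp only [coreUnitary_mul_apply, scal_apply, map_smul, weyl_add_apply, smul_smul,
    ← Complex.exp_add]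
  congr 3
  push_cast
  ring

/-- A commutator of Weyl operators in conjugate quadratures of mode `j` is a scalar of any
prescribed phase, and the unknown phases `α` and `β` drop out of it. -/
theorem lift_scal_mem {n : ℕ} (j : Fin n) (θ : ℝ) : lift (scal n θ) ∈ gaussSubgroup n := by
  set ξ : QIdx n → ℝ := Pi.single (j, 0) (-θ) with hξ
  set η : QIdx n → ℝ := Pi.single (j, 1) 1 with hη
  have hω : omega ξ η = -θ := by
    rw [omega_eq_dotProduct, hξ, single_dotProduct, Omega_mulVec_zero, hη]
    simp
  have hω' : omega η ξ = θ := by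
    rw [omega_eq_dotProduct, hη, single_dotProduct, Omega_mulVec_one, hξ]
    simp
  obtain ⟨α, hα⟩ := exists_scal_weyl_mem ξ
  obtain ⟨β, hβ⟩ := exists_scal_weyl_mem η
  have h1 := mul_mem (mul_mem hα hβ) (inv_mem (mul_mem hβ hα))
  convert h1 using 1
  rw [eq_mul_inv_iff_mul_eq, ← map_mul, ← map_mul, ← map_mul]
  congr 1
  refine coreUnitary_ext fun f x => ?_
  have h2 := weyl_add_apply ξ η f
  have h3 := weyl_add_apply η ξ f
  rw [add_comm η ξ, h2, hω, hω'] at h3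
  have h4 := congrArg (fun g => Complex.exp (Complex.I * (θ / 2 + α + β)) • g x) h3
  simp only [coreUnitary_mul_apply, scal_apply, map_smul, smul_smul, smul_apply, smul_eq_mul,
    ← mul_assoc, ← Complex.exp_add] at h4 ⊢
  convert h4.symm using 3
  · push_cast; ring
  · push_cast; ring

/-- Weyl operators are Gaussian. -/
theorem lift_weyl_mem {n : ℕ} (ξ : QIdx n → ℝ) : lift (weyl ξ) ∈ gaussSubgroup n := by
  -- Without modes no scalar arises as a commutator, but then `ξ = 0`.
  rcases Nat.eq_zero_or_pos n with rfl | hn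
  · have : ξ = 0 := funext fun k => k.1.elim0
    rw [this, weyl_zero, map_one]
    exact one_mem _
  · obtain ⟨θ, hθ⟩ := exists_scal_weyl_mem ξ
    rw [map_mul] at hθ
    exact (mul_mem_cancel_left (lift_scal_mem ⟨0, hn⟩ θ)).1 hθ

theorem isDisplacement_weyl {n : ℕ} (r : QIdx n → ℝ) :
    IsDisplacement r (lift (weyl (Omega n *ᵥ r))) := by
  have h1 := (isFlow_weyl (Omega n *ᵥ r)).isGeneratedBy
  rw [one_smul] at h1
  rw [IsDisplacement]
  convert h1 using 1
  refine LinearMap.ext fun f => ?_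
  rw [LinearMap.neg_apply, linOp_apply, ← Finset.sum_neg_distrib]
  simp only [LinearMap.sum_apply, LinearMap.smul_apply]
  rw [Finset.sum_comm]
  refine Finset.sum_congr rfl fun l _ => ?_
  rw [← Finset.sum_smul, ← neg_smul]
  congr 1
  have h2 : (Omega n *ᵥ r) l = -∑ k, r k * Omega n k l := by
    have h3 := congrFun (congrFun (Omega_transpose n) l)
    simp only [Matrix.mulVec, dotProduct, ← Finset.sum_neg_distrib]
    refine Finset.sum_congr rfl fun k _ => ?_
    have := h3 k
    simp only [Matrix.transpose_apply, Matrix.neg_apply] at this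
    rw [this]
    ring
  rw [h2]
  push_cast
  rw [neg_neg]

/-! ### Normal forms of skew-symmetric operators -/

section Skew

variable {E : Type*} [NormedAddCommGroup E] [InnerProductSpace ℝ E]
  {A : E →ₗ[ℝ] E}

/-- The square of `A` is symmetric and negative definite, so it has an eigenvector `v` in `F` with
eigenvalue `-r²`; then `v` and `A v` are orthogonal and span an invariant plane. -/
theorem exists_skew_pair [FiniteDimensional ℝ E] (hA : ∀ x y, ⟪A x, y⟫_ℝ = -⟪x, A y⟫_ℝ) (hinj : Function.Injective A)
    {F : Submodule ℝ E} (hF : ∀ x ∈ F, A x ∈ F) (hF0 : F ≠ ⊥) :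
    ∃ v ∈ F, ∃ w ∈ F, ∃ r : ℝ, 0 < r ∧ A v = -r • w ∧ A w = r • v ∧
      ⟪v, v⟫_ℝ = r⁻¹ ∧ ⟪w, w⟫_ℝ = r⁻¹ ∧ ⟪v, w⟫_ℝ = 0 := by
  have hT : (A ∘ₗ A).IsSymmetric := fun x y => by
    rw [LinearMap.comp_apply, LinearMap.comp_apply, hA, hA, neg_neg]
  have hFT : ∀ x ∈ F, (A ∘ₗ A) x ∈ F := fun x hx => hF _ (hF _ hx)
  have : Nontrivial F := Submodule.nontrivial_iff_ne_bot.2 hF0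
  obtain ⟨c, v, hv⟩ : ∃ c v, Module.End.HasEigenvector ((A ∘ₗ A).restrict hFT) c v :=
    ⟨_, (hT.restrict_invariant hFT).hasEigenvalue_iSup_of_finiteDimensional.exists_hasEigenvector⟩
  have hv0 : (v : E) ≠ 0 := fun h => hv.2 (Subtype.ext h)
  have hc : A (A v) = c • (v : E) := congrArg Subtype.val hv.apply_eq_smul
  have hp : 0 < ⟪(v : E), v⟫_ℝ := real_inner_self_pos.2 hv0
  have hpA : 0 < ⟪A v, A v⟫_ℝ :=
    real_inner_self_pos.2 fun h => hv0 (hinj (by rw [h, map_zero]))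
  have h1 : c * ⟪(v : E), v⟫_ℝ = -⟪A v, A v⟫_ℝ := by
    rw [← real_inner_smul_left, ← hc, hA]
  have hc0 : c < 0 := by
    by_contra! h
    nlinarith [mul_nonneg h hp.le]
  set r := Real.sqrt (-c) with hr
  have hr0 : 0 < r := Real.sqrt_pos.2 (by linarith)
  have hr2 : r * r = -c := Real.mul_self_sqrt (by linarith)
  -- This scaling gives both vectors squared norm `r⁻¹`.
  set t := Real.sqrt ((r * ⟪(v : E), v⟫_ℝ)⁻¹) with ht
  have ht2 : t * t = (r * ⟪(v : E), v⟫_ℝ)⁻¹ := Real.mul_self_sqrt (by positivity)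
  have hvA : ⟪(v : E), A v⟫_ℝ = 0 := by
    have := hA v v
    rw [real_inner_comm] at this
    linarith
  refine ⟨t • v, F.smul_mem _ v.2, -(t * r⁻¹) • A v, F.smul_mem _ (hF _ v.2), r, hr0, ?_, ?_, ?_,
    ?_, ?_⟩
  · rw [map_smul, smul_smul]
    congr 1
    field_simp
  · rw [map_smul, hc, smul_smul, smul_smul]
    congr 1
    field_simp
    linear_combination -t * hr2
  · rw [real_inner_smul_left, real_inner_smul_right, ← mul_assoc, ht2]
    field_simp
  · rw [real_inner_smul_left, real_inner_smul_right, ← neg_neg ⟪A v, A v⟫_ℝ, ← h1]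
    have : -(t * r⁻¹) * (-(t * r⁻¹) * -(c * ⟪(v : E), v⟫_ℝ))
        = t * t * (r⁻¹ * r⁻¹) * (-c) * ⟪(v : E), v⟫_ℝ := by ring
    rw [this, ← hr2, ht2]
    field_simp
  · rw [real_inner_smul_left, real_inner_smul_right, hvA, mul_zero, mul_zero]

/-- A family of pairs in normal position with respect to a skew-symmetric operator. -/
structure IsSkewFamily {ι : Type*} [DecidableEq ι] (A : E →ₗ[ℝ] E) (t : Finset ι)
    (w : ι → Fin 2 → E) (r : ι → ℝ) : Prop where
  pos : ∀ i ∈ t, 0 < r i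
  apply_zero : ∀ i ∈ t, A (w i 0) = -r i • w i 1
  apply_one : ∀ i ∈ t, A (w i 1) = r i • w i 0
  inner_eq : ∀ i ∈ t, ∀ j ∈ t, ∀ a b,
    ⟪w i a, w j b⟫_ℝ = if i = j ∧ a = b then (r i)⁻¹ else 0

/-- The new pair is taken in the orthogonal complement of `K` and of the pairs already present:
invariant since `A` is skew, nonzero by the dimension count. -/
theorem IsSkewFamily.exists_insert [FiniteDimensional ℝ E] {ι : Type*} [DecidableEq ι]
    (hA : ∀ x y, ⟪A x, y⟫_ℝ = -⟪x, A y⟫_ℝ) (hinj : Function.Injective A) {K : Submodule ℝ E}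
    (hK : ∀ x ∈ K, A x ∈ K) {t : Finset ι} {w : ι → Fin 2 → E} {r : ι → ℝ}
    (h : IsSkewFamily A t w r) {j : ι} (hj : j ∉ t)
    (hcard : 2 * t.card + Module.finrank ℝ K < Module.finrank ℝ E) :
    ∃ w' r', (∀ i ≠ j, w' i = w i ∧ r' i = r i) ∧ (∀ a, w' j a ∈ Kᗮ) ∧
      IsSkewFamily A (insert j t) w' r' := by
  set L : Submodule ℝ E := Submodule.span ℝ (Set.range fun p : t × Fin 2 => w p.1 p.2) with hL
  have hwL : ∀ i ∈ t, ∀ a, w i a ∈ L := fun i hi a =>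
    Submodule.subset_span ⟨(⟨i, hi⟩, a), rfl⟩
  have hLA : ∀ x ∈ L, A x ∈ L := by
    intro x hx
    induction hx using Submodule.span_induction with
    | mem x hx =>
      obtain ⟨⟨⟨i, hi⟩, a⟩, rfl⟩ := hx
      fin_cases a
      · exact (h.apply_zero i hi).symm ▸ L.smul_mem _ (hwL i hi 1)
      · exact (h.apply_one i hi).symm ▸ L.smul_mem _ (hwL i hi 0)
    | zero => rw [map_zero]; exact zero_mem _
    | add x y _ _ hx hy => rw [map_add]; exact add_mem hx hy
    | smul c x _ hx => rw [map_smul]; exact L.smul_mem c hx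
  have hLc : Module.finrank ℝ L ≤ 2 * t.card := by
    refine (finrank_range_le_card _).trans ?_
    rw [Fintype.card_prod, Fintype.card_coe, Fintype.card_fin, mul_comm]
  have hFA : ∀ x ∈ (L ⊔ K)ᗮ, A x ∈ (L ⊔ K)ᗮ := by
    intro x hx y hy
    obtain ⟨l, hl, k, hk, rfl⟩ := Submodule.mem_sup.1 hy
    have := hx _ (Submodule.add_mem_sup (hLA l hl) (hK k hk))
    rw [← map_add, hA] at this
    linarith
  have hF0 : (L ⊔ K)ᗮ ≠ ⊥ := by
    intro h0
    have h1 := Submodule.finrank_add_finrank_orthogonal (L ⊔ K)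
    have h2 := Submodule.finrank_add_le_finrank_add_finrank L K
    rw [h0, finrank_bot] at h1
    omega
  obtain ⟨v, hv, u, hu, s, hs, hAv, hAu, hvv, huu, hvu⟩ := exists_skew_pair hA hinj hFA hF0
  have hmem : ∀ x ∈ (L ⊔ K)ᗮ, x ∈ Kᗮ := fun x hx =>
    Submodule.orthogonal_le le_sup_right hx
  have hort : ∀ x ∈ (L ⊔ K)ᗮ, ∀ i ∈ t, ∀ a, ⟪w i a, x⟫_ℝ = 0 := fun x hx i hi a =>
    hx _ (Submodule.mem_sup_left (hwL i hi a))
  have hw' : ∀ i ∈ t, Function.update w j ![v, u] i = w i := fun i hi =>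
    Function.update_of_ne (by rintro rfl; exact hj hi) _ _
  have hr' : ∀ i ∈ t, Function.update r j s i = r i := fun i hi =>
    Function.update_of_ne (by rintro rfl; exact hj hi) _ _
  have hx : ∀ a, (![v, u] : Fin 2 → E) a ∈ (L ⊔ K)ᗮ := by
    intro a; fin_cases a
    · exact hv
    · exact hu
  refine ⟨Function.update w j ![v, u], Function.update r j s, fun i hi =>
    ⟨Function.update_of_ne hi _ _, Function.update_of_ne hi _ _⟩, fun a => ?_, ?_, ?_, ?_, ?_⟩
  · rw [Function.update_self]
    exact hmem _ (hx a)
  · intro i hi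
    rcases Finset.mem_insert.1 hi with rfl | hi
    · rwa [Function.update_self]
    · rw [hr' i hi]; exact h.pos i hi
  · intro i hi
    rcases Finset.mem_insert.1 hi with rfl | hi
    · simpa using hAv
    · rw [hr' i hi, hw' i hi]; exact h.apply_zero i hi
  · intro i hi
    rcases Finset.mem_insert.1 hi with rfl | hi
    · simpa using hAu
    · rw [hr' i hi, hw' i hi]; exact h.apply_one i hi
  · intro i hi' l hl' a b
    rcases Finset.mem_insert.1 hi' with rfl | hi
    · rcases Finset.mem_insert.1 hl' with rfl | hl
      · rw [Function.update_self, Function.update_self]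
        fin_cases a <;> fin_cases b <;> simp [(real_inner_self_eq_norm_sq v).symm.trans hvv,
          (real_inner_self_eq_norm_sq u).symm.trans huu, hvu, real_inner_comm v u]
      · have : i ≠ l := by rintro rfl; exact hj hl
        rw [Function.update_self, hw' l hl, real_inner_comm, hort _ (hx a) l hl]
        simp [this]
    · rcases Finset.mem_insert.1 hl' with rfl | hl
      · have : i ≠ l := by rintro rfl; exact hj hi
        rw [Function.update_self, hw' i hi, hort _ (hx b) i hi]
        simp [this]
      · rw [hw' i hi, hw' l hl, hr' i hi, h.inner_eq i hi l hl]

theorem IsSkewFamily.exists_union [FiniteDimensional ℝ E] {ι : Type*} [DecidableEq ι]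
    (hA : ∀ x y, ⟪A x, y⟫_ℝ = -⟪x, A y⟫_ℝ) (hinj : Function.Injective A) {K : Submodule ℝ E}
    (hK : ∀ x ∈ K, A x ∈ K) {t : Finset ι} {w : ι → Fin 2 → E} {r : ι → ℝ}
    (h : IsSkewFamily A t w r) (u : Finset ι) (hu : Disjoint t u)
    (hcard : 2 * (t.card + u.card) + Module.finrank ℝ K ≤ Module.finrank ℝ E) :
    ∃ w' r', (∀ i ∈ t, w' i = w i ∧ r' i = r i) ∧ (∀ j ∈ u, ∀ a, w' j a ∈ Kᗮ) ∧
      IsSkewFamily A (t ∪ u) w' r' := by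
  induction u using Finset.induction_on with
  | empty => exact ⟨w, r, fun _ _ => ⟨rfl, rfl⟩, by simp, by simpa using h⟩
  | insert j u hj ih =>
    rw [Finset.card_insert_of_notMem hj] at hcard
    rw [Finset.disjoint_insert_right] at hu
    obtain ⟨w', r', h1, h2, h3⟩ := ih hu.2 (by omega)
    have hj' : j ∉ t ∪ u := by simp [hj, hu.1]
    obtain ⟨w'', r'', h4, h5, h6⟩ := h3.exists_insert hA hinj hK hj'
      (by rw [Finset.card_union_of_disjoint hu.2]; omega)
    refine ⟨w'', r'', fun i hi => ?_, fun i hi' a => ?_, by rwa [Finset.union_insert]⟩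
    · have : i ≠ j := by rintro rfl; exact hu.1 hi
      rw [(h4 i this).1, (h4 i this).2]
      exact h1 i hi
    · rcases Finset.mem_insert.1 hi' with rfl | hi
      · exact h5 a
      · have : i ≠ j := by rintro rfl; exact hj hi
        rw [(h4 i this).1]
        exact h2 i hi a

end Skew

/-! ### Symplectic normal forms -/

theorem inner_eq_dotProduct {ι : Type*} [Fintype ι] (x y : EuclideanSpace ℝ ι) :
    ⟪x, y⟫_ℝ = x.ofLp ⬝ᵥ y.ofLp := by
  rw [EuclideanSpace.inner_eq_star_dotProduct, star_trivial, dotProduct_comm]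

theorem rows_mul_mul_transpose {ι : Type*} [Fintype ι] (f : ι → ι → ℝ) (N : Matrix ι ι ℝ)
    (k l : ι) : (Matrix.of f * N * (Matrix.of f)ᵀ) k l = f k ⬝ᵥ (N *ᵥ f l) := by
  rw [Matrix.mul_assoc]
  rfl

/-- The squared norm `r⁻¹` cancels the factor `r` of `A`, so a full family is a symplectic basis for
`⟪x, A y⟫`. -/
theorem IsSkewFamily.inner_apply {E : Type*} [NormedAddCommGroup E] [InnerProductSpace ℝ E]
    {A : E →ₗ[ℝ] E} {n : ℕ} {w : Fin n → Fin 2 → E} {r : Fin n → ℝ}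
    (h : IsSkewFamily A Finset.univ w r) (k l : QIdx n) :
    ⟪w k.1 k.2, A (w l.1 l.2)⟫_ℝ = Omega n k l := by
  obtain ⟨i, a⟩ := k
  obtain ⟨j, b⟩ := l
  have hp := (h.pos j (Finset.mem_univ j)).ne'
  have h0 : ∀ b, ⟪w i a, w j b⟫_ℝ = _ := h.inner_eq i (Finset.mem_univ i) j (Finset.mem_univ j) a
  rw [Omega_eq_blk]
  fin_cases b
  · show ⟪w i a, A (w j 0)⟫_ℝ = _
    rw [h.apply_zero j (Finset.mem_univ j), real_inner_smul_right, h0]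
    rcases eq_or_ne i j with rfl | hij
    · fin_cases a <;> simp [blk, hp]
    · fin_cases a <;> simp [blk, hij]
  · show ⟪w i a, A (w j 1)⟫_ℝ = _
    rw [h.apply_one j (Finset.mem_univ j), real_inner_smul_right, h0]
    rcases eq_or_ne i j with rfl | hij
    · fin_cases a <;> simp [blk, hp]
    · fin_cases a <;> simp [blk, hij]

theorem card_filter_le (n k : ℕ) :
    (Finset.univ.filter fun j : Fin n => k ≤ (j : ℕ)).card = n - k := by
  have h : (Finset.univ.filter fun j : Fin n => k ≤ (j : ℕ)).map Fin.valEmbedding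
      = Finset.Ico k n := by
    ext i
    simp only [Finset.mem_map, Finset.mem_filter, Finset.mem_univ, true_and, Finset.mem_Ico]
    exact ⟨fun ⟨j, hj, e⟩ => e ▸ ⟨hj, j.2⟩, fun hi => ⟨⟨i, hi.2⟩, hi.1, rfl⟩⟩
  rw [← Finset.card_map Fin.valEmbedding, h, Nat.card_Ico]

theorem finrank_qidx (n : ℕ) : Module.finrank ℝ (EuclideanSpace ℝ (QIdx n)) = 2 * n := by
  rw [finrank_euclideanSpace, Fintype.card_prod, Fintype.card_fin, Fintype.card_fin, mul_comm]

/-- The span `K` of `s` and `Ω s` is invariant of dimension at most `2 k`, which leaves room for `n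
- k` invariant planes orthogonal to it. They supply the rows of the last modes, and any completion
supplies the others. -/
theorem exists_orthogonal_symplectic {n k : ℕ} (hk : k ≤ n) (s : Finset (QIdx n → ℝ))
    (hs : s.card ≤ k) : ∃ O : Matrix (QIdx n) (QIdx n) ℝ, IsSymplectic O ∧ O * Oᵀ = 1 ∧
      ∀ v ∈ s, ∀ l : QIdx n, k ≤ (l.1 : ℕ) → (O *ᵥ v) l = 0 := by
  set A := Matrix.toEuclideanLin (Omega n) with hAdef
  have hA' : ∀ x, (A x).ofLp = Omega n *ᵥ x.ofLp := fun x => rfl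
  have hA : ∀ x y, ⟪A x, y⟫_ℝ = -⟪x, A y⟫_ℝ := fun x y => by
    rw [inner_eq_dotProduct, inner_eq_dotProduct, hA', hA', Omega_dotProduct]
  have hAA : ∀ x, A (A x) = -x := fun x => (WithLp.ofLp_injective 2) (by
    rw [hA', hA', Omega_mulVec_mulVec]; rfl)
  have hinj : Function.Injective A := fun x y h => by
    have := congrArg A h
    rwa [hAA, hAA, neg_inj] at this
  set f : s × Fin 2 → EuclideanSpace ℝ (QIdx n) := fun p =>
    if p.2 = 0 then WithLp.toLp 2 p.1.1 else A (WithLp.toLp 2 p.1.1) with hf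
  set K := Submodule.span ℝ (Set.range f) with hKdef
  have hK : ∀ x ∈ K, A x ∈ K := by
    intro x hx
    induction hx using Submodule.span_induction with
    | mem x hx =>
      obtain ⟨⟨v, a⟩, rfl⟩ := hx
      fin_cases a
      · exact Submodule.subset_span ⟨(v, 1), by simp [hf]⟩
      · have : A (f (v, 1)) = -f (v, 0) := by simp [hf, hAA]
        show A (f (v, 1)) ∈ K
        rw [this]
        exact K.neg_mem (Submodule.subset_span ⟨(v, 0), rfl⟩)
    | zero => rw [map_zero]; exact zero_mem _
    | add x y _ _ hx hy => rw [map_add]; exact add_mem hx hy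
    | smul c x _ hx => rw [map_smul]; exact K.smul_mem c hx
  have hKc : Module.finrank ℝ K ≤ 2 * k := by
    refine (finrank_range_le_card _).trans ?_
    rw [Fintype.card_prod, Fintype.card_coe, Fintype.card_fin]
    omega
  have h0 : IsSkewFamily A (∅ : Finset (Fin n)) (fun _ _ => 0) fun _ => 0 :=
    ⟨by simp, by simp, by simp, by simp⟩
  set t := Finset.univ.filter fun j : Fin n => k ≤ (j : ℕ) with ht
  have htc : t.card = n - k := card_filter_le n k
  obtain ⟨w, r, -, h1, h2⟩ := h0.exists_union hA hinj hK t (Finset.disjoint_empty_left t)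
    (by rw [finrank_qidx, htc, Finset.card_empty]; omega)
  rw [Finset.empty_union] at h2
  obtain ⟨w', r', h3, -, h4⟩ := h2.exists_union hA hinj (K := ⊥) (by simp) tᶜ
    disjoint_compl_right (by
      rw [finrank_qidx, Finset.card_compl, Fintype.card_fin, finrank_bot, htc]; omega)
  rw [Finset.union_compl] at h4
  -- `Ω² = -1` forces unit frequencies, so the rows are orthonormal and not merely orthogonal.
  have hr : ∀ j, r' j = 1 := by
    intro j
    have hp := h4.pos j (Finset.mem_univ j)
    have h5 := hAA (w' j 0)
    rw [h4.apply_zero j (Finset.mem_univ j), map_smul, h4.apply_one j (Finset.mem_univ j),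
      smul_smul] at h5
    have h6 := congrArg (fun x => ⟪w' j 0, x⟫_ℝ) h5
    simp only [inner_smul_right, inner_neg_right,
      h4.inner_eq j (Finset.mem_univ j) j (Finset.mem_univ j)] at h6
    simp at h6
    have h7 : r' j * r' j = 1 := by
      nth_rw 2 [h6]
      exact mul_inv_cancel₀ hp.ne'
    nlinarith
  refine ⟨Matrix.of fun k l => w' k.1 k.2 l, ?_, ?_, ?_⟩
  · ext k l
    rw [rows_mul_mul_transpose (fun k l => w' k.1 k.2 l), ← h4.inner_apply k l,
      inner_eq_dotProduct]
    rfl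
  · ext k l
    have := rows_mul_mul_transpose (fun k l => w' k.1 k.2 l) 1 k l
    rw [Matrix.mul_one, Matrix.one_mulVec] at this
    rw [this]
    refine (inner_eq_dotProduct _ _).symm.trans ((h4.inner_eq k.1 (Finset.mem_univ _) l.1
      (Finset.mem_univ _) k.2 l.2).trans ?_)
    rw [hr, Matrix.one_apply, inv_one]
    simp only [Prod.ext_iff]
  · intro v hv l hl
    have hl' : l.1 ∈ t := by simp [ht, hl]
    have h5 := h1 l.1 hl' l.2 (f (⟨v, hv⟩, 0)) (Submodule.subset_span ⟨_, rfl⟩)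
    rw [← (h3 l.1 hl').1, real_inner_comm, inner_eq_dotProduct] at h5
    exact h5

open MatrixOrder Matrix.Norms.L2Operator in
theorem exists_eq_transpose_mul_self {ι : Type*} [Fintype ι] [DecidableEq ι] {V : Matrix ι ι ℝ}
    (hV : V.PosDef) : ∃ B : Matrix ι ι ℝ, IsUnit B ∧ V = Bᵀ * B := by
  obtain ⟨B, hB, h⟩ := CStarAlgebra.isStrictlyPositive_iff_eq_star_mul_self.mp
    hV.isStrictlyPositive
  exact ⟨B, hB, h⟩

/-- With `V = Bᵀ B`, Williamson's theorem is the normal form of the skew matrix `B⁻ᵀ Ω B⁻¹`. The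
hypotheses say that the vectors `B u_p` already form normalized pairs of frequency `1`; they are
kept when the family is completed. -/
theorem exists_williamson {n k : ℕ} (hk : k ≤ n) {V : Matrix (QIdx n) (QIdx n) ℝ} (hV : V.PosDef)
    {u : QIdx n → QIdx n → ℝ}
    (hu0 : ∀ j : Fin n, k ≤ (j : ℕ) → V *ᵥ u (j, 0) = Omega n *ᵥ u (j, 1))
    (hu1 : ∀ j : Fin n, k ≤ (j : ℕ) → V *ᵥ u (j, 1) = -(Omega n *ᵥ u (j, 0)))
    (hu : ∀ p q : QIdx n, k ≤ (p.1 : ℕ) → k ≤ (q.1 : ℕ) → omega (u p) (u q) = Omega n p q) :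
    ∃ (S : Matrix (QIdx n) (QIdx n) ℝ) (d : Fin n → ℝ), IsSymplectic S ∧ (∀ j, 0 < d j) ∧
      (∀ j : Fin n, k ≤ (j : ℕ) → d j = 1) ∧
      V = S * Matrix.diagonal (fun k : QIdx n => d k.1) * Sᵀ := by
  obtain ⟨B, hB, hVB⟩ := exists_eq_transpose_mul_self hV
  have hu' : IsUnit B.det := (Matrix.isUnit_iff_isUnit_det B).1 hB
  have hut : IsUnit Bᵀ.det := by rwa [Matrix.det_transpose]
  set M := (Bᵀ)⁻¹ * Omega n * B⁻¹ with hM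
  set A := Matrix.toEuclideanLin M with hAdef
  have hA' : ∀ x, (A x).ofLp = M *ᵥ x.ofLp := fun x => rfl
  have hMt : Mᵀ = -M := by
    rw [hM, Matrix.transpose_mul, Matrix.transpose_mul, Omega_transpose,
      Matrix.transpose_nonsing_inv, Matrix.transpose_nonsing_inv, Matrix.transpose_transpose]
    simp [Matrix.mul_assoc]
  have hA : ∀ x y, ⟪A x, y⟫_ℝ = -⟪x, A y⟫_ℝ := fun x y => by
    rw [inner_eq_dotProduct, inner_eq_dotProduct, hA', hA', dotProduct_comm,
      Matrix.dotProduct_mulVec, ← Matrix.mulVec_transpose, hMt, Matrix.neg_mulVec, neg_dotProduct,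
      dotProduct_comm]
  have hBM : Bᵀ * M * B = Omega n := by
    rw [hM]
    calc Bᵀ * ((Bᵀ)⁻¹ * Omega n * B⁻¹) * B = (Bᵀ * (Bᵀ)⁻¹) * Omega n * (B⁻¹ * B) := by
          simp only [Matrix.mul_assoc]
      _ = Omega n := by
          rw [Matrix.mul_nonsing_inv _ hut, Matrix.nonsing_inv_mul _ hu', one_mul, mul_one]
  have hinj : Function.Injective A := by
    refine (injective_iff_map_eq_zero A).2 fun x hx => ?_
    have h1 : M *ᵥ x.ofLp = 0 := congrArg WithLp.ofLp hx
    have h2 : Omega n *ᵥ (B⁻¹ *ᵥ x.ofLp) = 0 := by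
      rw [← hBM, Matrix.mulVec_mulVec, Matrix.mul_assoc, Matrix.mul_assoc,
        Matrix.mul_nonsing_inv _ hu', mul_one, ← Matrix.mulVec_mulVec, h1, Matrix.mulVec_zero]
    have h3 := Omega_mulVec_mulVec (B⁻¹ *ᵥ x.ofLp)
    rw [h2, Matrix.mulVec_zero] at h3
    have h4 : B *ᵥ (B⁻¹ *ᵥ x.ofLp) = 0 := by rw [neg_eq_zero.1 h3.symm, Matrix.mulVec_zero]
    rw [Matrix.mulVec_mulVec, Matrix.mul_nonsing_inv _ hu', Matrix.one_mulVec] at h4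
    exact WithLp.ofLp_injective 2 h4
  have hV' : ∀ x y : QIdx n → ℝ, (B *ᵥ x) ⬝ᵥ (B *ᵥ y) = x ⬝ᵥ (V *ᵥ y) := fun x y => by
    rw [hVB, ← Matrix.mulVec_mulVec, Matrix.dotProduct_mulVec x, Matrix.vecMul_transpose]
  have hMB : ∀ x, M *ᵥ (B *ᵥ x) = (Bᵀ)⁻¹ *ᵥ (Omega n *ᵥ x) := fun x => by
    rw [hM, Matrix.mulVec_mulVec, Matrix.mulVec_mulVec, Matrix.mul_assoc,
      Matrix.nonsing_inv_mul _ hu', mul_one]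
  have hBV : ∀ x, (Bᵀ)⁻¹ *ᵥ (V *ᵥ x) = B *ᵥ x := fun x => by
    rw [hVB, Matrix.mulVec_mulVec, ← Matrix.mul_assoc, Matrix.nonsing_inv_mul _ hut, one_mul]
  set t := Finset.univ.filter fun j : Fin n => k ≤ (j : ℕ) with ht
  have htk : ∀ j ∈ t, k ≤ (j : ℕ) := fun j hj => (Finset.mem_filter.1 hj).2
  have htc : t.card = n - k := card_filter_le n k
  have h0 : IsSkewFamily A t (fun j a => WithLp.toLp 2 (B *ᵥ u (j, a))) fun _ => 1 := by
    refine ⟨fun _ _ => one_pos, fun j hj => ?_, fun j hj => ?_, fun i hi j hj a b => ?_⟩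
    · refine WithLp.ofLp_injective 2 ?_
      show M *ᵥ (B *ᵥ u (j, 0)) = (-1 : ℝ) • (B *ᵥ u (j, 1))
      rw [hMB, ← hBV (u (j, 1)), hu1 j (htk j hj), Matrix.mulVec_neg, neg_smul, one_smul, neg_neg]
    · refine WithLp.ofLp_injective 2 ?_
      show M *ᵥ (B *ᵥ u (j, 1)) = (1 : ℝ) • (B *ᵥ u (j, 0))
      rw [hMB, ← hBV (u (j, 0)), hu0 j (htk j hj), one_smul]
    · rw [inner_eq_dotProduct]
      show (B *ᵥ u (i, a)) ⬝ᵥ (B *ᵥ u (j, b)) = _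
      have h1 : ∀ b, omega (u (i, a)) (u (j, b)) = Omega n (i, a) (j, b) := fun b =>
        hu (i, a) (j, b) (htk i hi) (htk j hj)
      rw [hV', inv_one]
      fin_cases b
      · show u (i, a) ⬝ᵥ (V *ᵥ u (j, 0)) = _
        rw [hu0 j (htk j hj), ← omega_eq_dotProduct, h1, Omega_eq_blk]
        fin_cases a <;> simp [blk, Matrix.one_apply]
      · show u (i, a) ⬝ᵥ (V *ᵥ u (j, 1)) = _
        rw [hu1 j (htk j hj), dotProduct_neg, ← omega_eq_dotProduct, h1, Omega_eq_blk]
        fin_cases a <;> simp [blk, Matrix.one_apply]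
  obtain ⟨w, r, h3, -, h4⟩ := h0.exists_union hA hinj (K := ⊥) (by simp) tᶜ
    disjoint_compl_right (by
      rw [finrank_qidx, Finset.card_compl, Fintype.card_fin, finrank_bot, htc]; omega)
  rw [Finset.union_compl] at h4
  set R : Matrix (QIdx n) (QIdx n) ℝ := (Matrix.of fun k l => w k.1 k.2 l) * (B⁻¹)ᵀ with hR
  have h5 : ∀ N, R * N * Rᵀ
      = (Matrix.of fun k l => w k.1 k.2 l) * ((B⁻¹)ᵀ * N * B⁻¹)
        * (Matrix.of fun k l : QIdx n => w k.1 k.2 l)ᵀ := fun N => by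
    rw [hR, Matrix.transpose_mul, Matrix.transpose_transpose]
    simp only [Matrix.mul_assoc]
  have h6 : R * Omega n * Rᵀ = Omega n := by
    ext k l
    rw [h5, rows_mul_mul_transpose (fun k l => w k.1 k.2 l), ← h4.inner_apply k l,
      inner_eq_dotProduct, Matrix.transpose_nonsing_inv]
    rfl
  have h7 : R * V * Rᵀ = Matrix.diagonal fun k : QIdx n => (r k.1)⁻¹ := by
    ext k l
    have h8 : (B⁻¹)ᵀ * V * B⁻¹ = 1 := by
      rw [hVB, Matrix.transpose_nonsing_inv, ← Matrix.mul_assoc, Matrix.nonsing_inv_mul _ hut,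
        one_mul, Matrix.mul_nonsing_inv _ hu']
    rw [h5, h8, rows_mul_mul_transpose (fun k l => w k.1 k.2 l), Matrix.one_mulVec]
    refine (inner_eq_dotProduct _ _).symm.trans ((h4.inner_eq k.1 (Finset.mem_univ _) l.1
      (Finset.mem_univ _) k.2 l.2).trans ?_)
    rw [Matrix.diagonal_apply]
    simp only [Prod.ext_iff]
  have hΩ : Omega n * Omega n = -1 := by
    rw [Omega_eq_blk, blk_mul]
    ext ⟨i, r⟩ ⟨j, s⟩
    fin_cases r <;> fin_cases s <;> simp [blk, Matrix.one_apply]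
  -- For symplectic `R` the inverse is `-Ω Rᵀ Ω`; this inverse is the required `S`.
  have h9 : R * (-(Omega n * Rᵀ * Omega n)) = 1 := by
    rw [Matrix.mul_neg, ← Matrix.mul_assoc, ← Matrix.mul_assoc, h6, hΩ, neg_neg]
  have h10 : -(Omega n * Rᵀ * Omega n) * R = 1 := mul_eq_one_comm.1 h9
  refine ⟨-(Omega n * Rᵀ * Omega n), fun j => (r j)⁻¹, ?_, fun j => inv_pos.2
    (h4.pos j (Finset.mem_univ j)), fun j hj => ?_, ?_⟩
  · have h11 := congrArg (fun N => -(Omega n * Rᵀ * Omega n) * N * (-(Omega n * Rᵀ * Omega n))ᵀ) h6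
    have h12 : Rᵀ * (-(Omega n * Rᵀ * Omega n))ᵀ = 1 := by
      rw [← Matrix.transpose_mul, h10, Matrix.transpose_one]
    rw [IsSymplectic, ← h11]
    calc _ = (-(Omega n * Rᵀ * Omega n) * R) * Omega n * (Rᵀ * (-(Omega n * Rᵀ * Omega n))ᵀ) := by
          simp only [Matrix.mul_assoc]
      _ = _ := by rw [h10, h12, one_mul, mul_one]
  · show (r j)⁻¹ = 1
    rw [(h3 j (by simp [ht, hj])).2, inv_one]
  · have h12 : Rᵀ * (-(Omega n * Rᵀ * Omega n))ᵀ = 1 := by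
      rw [← Matrix.transpose_mul, h10, Matrix.transpose_one]
    rw [← h7]
    calc V = (-(Omega n * Rᵀ * Omega n) * R) * V * (Rᵀ * (-(Omega n * Rᵀ * Omega n))ᵀ) := by
          rw [h10, h12, one_mul, mul_one]
      _ = _ := by simp only [Matrix.mul_assoc]

/-! ### Doped Gaussian unitaries -/

/-- A Weyl operator shifts each quadrature by a scalar. If the shifts of those in the polynomial
vanish, it is a symmetry of the Hamiltonian, hence commutes with the generated unitary. -/
theorem IsLocal.exists_commute {n κ : ℕ} {W : ModeUnitary n} (hW : IsLocal κ W) :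
    ∃ μ : Fin κ → QIdx n, ∀ ζ, (∀ r, (Omega n *ᵥ ζ) (μ r) = 0) →
      Commute (lift (weyl ζ)) W := by
  obtain ⟨μ, P, h⟩ := hW
  refine ⟨μ, fun ζ hζ => h.commute_lift fun f => ?_⟩
  clear h
  induction P using FreeAlgebra.induction generalizing f with
  | grade0 c => simp [Module.algebraMap_end_apply]
  | grade1 r =>
    rw [FreeAlgebra.lift_ι_apply, quad_weyl, hζ]
    simp
  | mul a b ha hb => simp only [map_mul, Module.End.mul_apply, hb, ha]
  | add a b ha hb => simp only [map_add, LinearMap.add_apply, ha, hb]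

/-- In `G W F B = (G F) (F⁻¹ W F) B`, the conjugate of `W` commutes with the Weyl operator of `ξ` as
soon as `A ξ` meets the `κ` linear conditions of `W`, where `A` is the symplectic map of `F`. Each
local factor thus adds at most `κ` vectors. -/
theorem IsDoped.exists_factorization {n κ t : ℕ} {U : ModeUnitary n} (hU : IsDoped κ t U) :
    ∃ (F B : ModeUnitary n) (s : Finset (QIdx n → ℝ)), U = F * B ∧ IsGaussian F ∧
      s.card ≤ κ * t ∧ ∀ ξ, (∀ w ∈ s, w ⬝ᵥ ξ = 0) → ∀ v,
        B (lift (weyl ξ) v) = lift (weyl ξ) (B v) := by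
  classical
  induction hU with
  | zero G hG => exact ⟨G, 1, ∅, by simp, hG, by simp, fun _ _ _ => rfl⟩
  | succ t U W G _ hW hG ih =>
    obtain ⟨F, B, s, rfl, hF, hs, hB⟩ := ih
    obtain ⟨μ, hμ⟩ := hW.exists_commute
    obtain ⟨A, d, hA⟩ := hF.exists_normalizesWeyl
    -- The coefficient vectors of the functionals `ξ ↦ (Ω A ξ)_{μ r}`.
    let w : Fin κ → QIdx n → ℝ := fun r l => (Omega n *ᵥ A (Pi.single l 1)) (μ r)
    have hw : ∀ r ξ, w r ⬝ᵥ ξ = (Omega n *ᵥ A ξ) (μ r) := by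
      intro r ξ
      have h1 : ξ = ∑ l, ξ l • Pi.single l (1 : ℝ) := by
        ext i; simp [Finset.sum_apply, Pi.single_apply]
      conv_rhs => rw [h1]
      simp only [map_sum, map_smul, Matrix.mulVec_sum, Matrix.mulVec_smul, Finset.sum_apply,
        Pi.smul_apply, smul_eq_mul, dotProduct, w]
      exact Finset.sum_congr rfl fun l _ => mul_comm _ _
    refine ⟨G * F, F⁻¹ * W * F * B, s ∪ Finset.univ.image w, by group,
      Submonoid.mul_mem _ hG hF, ?_, fun ξ hξ v => ?_⟩
    · refine (Finset.card_union_le _ _).trans ?_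
      have := (Finset.card_image_le (s := Finset.univ) (f := w))
      rw [Finset.card_univ, Fintype.card_fin] at this
      rw [mul_add_one]; omega
    · have h1 := hB ξ (fun x hx => hξ x (Finset.mem_union_left _ hx)) v
      have h2 : Commute (lift (weyl (A ξ))) W := hμ _ fun r => by
        rw [← hw]
        exact hξ _ (Finset.mem_union_right _ (Finset.mem_image_of_mem _ (Finset.mem_univ r)))
      have h3 : ∀ x, W (lift (weyl (A ξ)) x) = lift (weyl (A ξ)) (W x) := fun x => by
        rw [← mul_apply', ← mul_apply', h2.eq]
      refine F.injective ?_
      simp only [mul_apply', apply_inv_self', h1, hA.2, map_smul, h3]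

theorem mem_orthogonalGroup {ι : Type*} [Fintype ι] [DecidableEq ι] {O : Matrix ι ι ℝ}
    (h : O * Oᵀ = 1) : O ∈ Matrix.orthogonalGroup ι ℝ :=
  (Matrix.mem_orthogonalGroup_iff ι ℝ).2 h

/-- `O` kills the last components of the constraint vectors, so `Oᵀ` sends forms in the last modes
to forms orthogonal to all constraints. -/
theorem IsDoped.exists_passive {n κ t : ℕ} (hn : κ * t ≤ n) {U : ModeUnitary n}
    (hU : IsDoped κ t U) :
    ∃ (G T : ModeUnitary n) (e : coreUnitary n) (O : Matrix (QIdx n) (QIdx n) ℝ),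
      IsGaussian G ∧ lift e ∈ gaussSubgroup n ∧ IsSymplectic O ∧ O * Oᵀ = 1 ∧
      Intertwines O e ∧ CommutesLast (κ * t) T ∧ U = G * T * lift e := by
  obtain ⟨F, B, s, rfl, hF, hs, hB⟩ := hU.exists_factorization
  obtain ⟨O, hO, hO1, hOs⟩ := exists_orthogonal_symplectic hn s hs
  obtain ⟨e, he, hOe⟩ := exists_intertwines hO
  have hP := hOe.isSymplecticUnitary he
  refine ⟨F * (lift e)⁻¹, lift e * B * (lift e)⁻¹, e, O, Submonoid.mul_mem _ hF he.2, he, hO, hO1,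
    hOe, fun η hη v => ?_, by group⟩
  have h1 : ∀ x, (lift e)⁻¹ (lift (weyl η) x) = lift (weyl (Oᵀ *ᵥ η)) ((lift e)⁻¹ x) := by
    intro x
    refine (lift e).injective ?_
    rw [hP.weyl_apply, apply_inv_self', apply_inv_self']
  have h2 : ∀ w ∈ s, w ⬝ᵥ (Oᵀ *ᵥ η) = 0 := by
    intro w hw
    rw [Matrix.dotProduct_mulVec, Matrix.vecMul_transpose, dotProduct]
    refine Finset.sum_eq_zero fun l _ => ?_
    by_cases hl : κ * t ≤ (l.1 : ℕ)
    · rw [hOs w hw l hl, zero_mul]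
    · rw [hη l (not_le.1 hl), mul_zero]
  rw [mul_apply', mul_apply', h1, hB _ h2, hP.weyl_apply]
  rfl

theorem IsDoped.exists_decomposition {n κ t : ℕ} (hn : κ * t ≤ n) {U : ModeUnitary n}
    (hU : IsDoped κ t U) :
    ∃ (G T Gpassive : ModeUnitary n) (u : ModeUnitary (κ * t)),
      IsGaussian G ∧ IsPassive Gpassive ∧ IsAmplification hn u T ∧ U = G * T * Gpassive := by
  obtain ⟨G, T, e, O, hG, he, hO, hO1, hOe, hT, rfl⟩ := hU.exists_passive hn
  obtain ⟨u, hu⟩ := hT.exists_amplification hn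
  exact ⟨G, T, lift e, u, hG, ⟨O, hO, mem_orthogonalGroup hO1, hOe.isSymplecticUnitary he⟩, hu,
    rfl⟩

/-! ### Vectors on which the Weyl operators are differentiable -/

/-- `X = (∑ k, ξ_k R_k) ψ`, where the operator is the generator of the Weyl operators of the
multiples of `ξ`. -/
def WeylDeriv {n : ℕ} (ψ : Modes n) (ξ : QIdx n → ℝ) (X : Modes n) : Prop :=
  HasDerivAt (fun s : ℝ => lift (weyl (s • ξ)) ψ) (Complex.I • X) 0

theorem hasDerivAt_inner_left {n : ℕ} {g : ℝ → Modes n} {X : Modes n} {s : ℝ}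
    (h : HasDerivAt g X s) (χ : Modes n) : HasDerivAt (fun s => ⟪χ, g s⟫_ℂ) ⟪χ, X⟫_ℂ s :=
  ((innerSL ℂ χ).restrictScalars ℝ).hasFDerivAt.comp_hasDerivAt s h

theorem hasDerivAt_inner_right {n : ℕ} {g : ℝ → Modes n} {X : Modes n} {s : ℝ}
    (h : HasDerivAt g X s) (χ : Modes n) : HasDerivAt (fun s => ⟪g s, χ⟫_ℂ) ⟪X, χ⟫_ℂ s := by
  have h3 := Complex.conjCLE.toContinuousLinearMap.hasFDerivAt.comp_hasDerivAt s
    (hasDerivAt_inner_left h χ)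
  simpa [Function.comp_def] using h3

theorem weylDeriv_core {n : ℕ} (f : Core n) (ξ : QIdx n → ℝ) :
    WeylDeriv (coreIncl n f) ξ (coreIncl n (linOp ξ f)) := by
  refine ((isFlow_weyl ξ).deriv_zero f).congr_deriv ?_
  rw [LinearMap.neg_apply, map_neg, neg_smul_neg]

theorem WeylDeriv.comp_mul {n : ℕ} {ψ : Modes n} {ξ : QIdx n → ℝ} {X : Modes n}
    (h : WeylDeriv ψ ξ X) (c : ℝ) :
    HasDerivAt (fun s : ℝ => lift (weyl ((c * s) • ξ)) ψ) ((c : ℂ) • Complex.I • X) 0 := by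
  have h1 : HasDerivAt (fun s : ℝ => c * s) c 0 := by
    simpa using (hasDerivAt_id (0 : ℝ)).const_mul c
  have h2 : HasDerivAt (fun s : ℝ => lift (weyl (s • ξ)) ψ) (Complex.I • X) (c * 0) := by
    rw [mul_zero]; exact h
  rw [Complex.coe_smul]
  exact h2.scomp (0 : ℝ) h1

theorem WeylDeriv.smul {n : ℕ} {ψ : Modes n} {ξ : QIdx n → ℝ} {X : Modes n}
    (h : WeylDeriv ψ ξ X) (c : ℝ) : WeylDeriv ψ (c • ξ) ((c : ℂ) • X) := by
  have h1 := h.comp_mul c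
  rw [smul_comm] at h1
  simp only [mul_comm c, mul_smul] at h1
  exact h1

theorem WeylDeriv.inner_neg_weyl {n : ℕ} {ψ : Modes n} {ξ : QIdx n → ℝ} {X : Modes n}
    (h : WeylDeriv ψ ξ X) (χ : Modes n) :
    HasDerivAt (fun s : ℝ => ⟪ψ, lift (weyl (s • ξ)) χ⟫_ℂ) (Complex.I * ⟪X, χ⟫_ℂ) 0 := by
  have h1 := hasDerivAt_inner_right (h.comp_mul (-1)) χ
  have h2 : ∀ s : ℝ, ⟪lift (weyl ((-1 * s) • ξ)) ψ, χ⟫_ℂ = ⟪ψ, lift (weyl (s • ξ)) χ⟫_ℂ := by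
    intro s
    rw [neg_one_mul, neg_smul, weyl_neg, inner_inv_left]
  simp only [h2] at h1
  refine h1.congr_deriv ?_
  rw [inner_smul_left, inner_smul_left]
  simp

theorem WeylDeriv.inner_comm {n : ℕ} {ψ χ : Modes n} {ξ : QIdx n → ℝ} {X Y : Modes n}
    (h : WeylDeriv ψ ξ X) (h' : WeylDeriv χ ξ Y) : ⟪X, χ⟫_ℂ = ⟪ψ, Y⟫_ℂ := by
  have h1 := (h.inner_neg_weyl χ).unique (hasDerivAt_inner_left h' ψ)
  rw [inner_smul_right] at h1
  exact mul_left_cancel₀ Complex.I_ne_zero h1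

theorem weyl_comm {n : ℕ} (ξ η : QIdx n → ℝ) (v : Modes n) :
    lift (weyl ξ) (lift (weyl η) v)
      = Complex.exp (-(Complex.I * omega ξ η)) • lift (weyl η) (lift (weyl ξ) v) := by
  have h1 := lift_weyl_add_apply ξ η v
  have h2 := lift_weyl_add_apply η ξ v
  have h3 : omega η ξ = -omega ξ η := by
    rw [omega, omega, real_inner_comm, real_inner_comm (posPart ξ) (momPart η)]; ring
  rw [add_comm, h1, h3] at h2
  have h4 : lift (weyl ξ) (lift (weyl η) v) = Complex.exp (-(Complex.I * (omega ξ η / 2 : ℝ))) •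
      (Complex.exp (Complex.I * (omega ξ η / 2 : ℝ)) • lift (weyl ξ) (lift (weyl η) v)) := by
    rw [smul_smul, ← Complex.exp_add]; simp
  rw [h4, h2, smul_smul, ← Complex.exp_add]
  congr 2
  push_cast; ring

theorem omega_smul_smul {n : ℕ} (s t : ℝ) (ξ η : QIdx n → ℝ) :
    omega (s • ξ) (t • η) = s * t * omega ξ η := by
  rw [omega_eq_dotProduct, omega_eq_dotProduct, Matrix.mulVec_smul, smul_dotProduct,
    dotProduct_smul]
  simp only [smul_eq_mul]; ring

theorem hasDerivAt_exp_mul (c : ℂ) :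
    HasDerivAt (fun s : ℝ => Complex.exp (c * s)) c 0 := by
  have h1 : HasDerivAt (fun s : ℝ => c * (s : ℂ)) c 0 := by
    simpa using (Complex.ofRealCLM.hasDerivAt (x := (0 : ℝ))).const_mul c
  simpa using h1.cexp

/-- The canonical commutation relation as a quadratic form, where products such as `R_k R_l ψ` need
not exist: the Weyl commutation relation is differentiated once in each parameter. -/
theorem WeylDeriv.commutation {n : ℕ} {ψ : Modes n} {ξ η : QIdx n → ℝ} {X Y : Modes n}
    (hX : WeylDeriv ψ ξ X) (hY : WeylDeriv ψ η Y) :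
    ⟪X, Y⟫_ℂ - ⟪Y, X⟫_ℂ = Complex.I * omega ξ η * ⟪ψ, ψ⟫_ℂ := by
  have key : ∀ t : ℝ, Complex.I * ⟪X, lift (weyl (t • η)) ψ⟫_ℂ
      = -(Complex.I * t * omega ξ η) * ⟪ψ, lift (weyl (t • η)) ψ⟫_ℂ
        + Complex.I * ⟪lift (weyl ((-1 * t) • η)) ψ, X⟫_ℂ := by
    intro t
    have h1 := hX.inner_neg_weyl (lift (weyl (t • η)) ψ)
    have h2 : ∀ s : ℝ, ⟪ψ, lift (weyl (s • ξ)) (lift (weyl (t • η)) ψ)⟫_ℂ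
        = Complex.exp (-(Complex.I * t * omega ξ η) * s) *
          ⟪lift (weyl ((-1 * t) • η)) ψ, lift (weyl (s • ξ)) ψ⟫_ℂ := by
      intro s
      rw [weyl_comm, inner_smul_right, omega_smul_smul, neg_one_mul, neg_smul, weyl_neg,
        inner_inv_left]
      congr 2
      push_cast; ring
    simp only [h2] at h1
    have h3 := (hasDerivAt_exp_mul (-(Complex.I * t * omega ξ η))).mul
      (hasDerivAt_inner_left hX (lift (weyl ((-1 * t) • η)) ψ))
    have h4 := h1.unique h3
    rw [h4, zero_smul, weyl_zero, map_one, neg_one_mul, neg_smul, weyl_neg,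
      inner_smul_right]
    rw [show ((1 : ModeUnitary n) ψ) = ψ from rfl, inner_inv_left]
    simp
  have h1 := (hasDerivAt_inner_left hY X).const_mul Complex.I
  simp only [key] at h1
  have h5 : HasDerivAt (fun t : ℝ => -(Complex.I * t * omega ξ η)) (-(Complex.I * omega ξ η)) 0 := by
    have := (Complex.ofRealCLM.hasDerivAt (x := (0 : ℝ))).const_mul (-(Complex.I * omega ξ η))
    refine (this.congr_deriv (by simp)).congr_of_eventuallyEq (Filter.Eventually.of_forall fun t => ?_)
    simp only [Complex.ofRealCLM_apply]; ring
  have h6 := (h5.mul (hasDerivAt_inner_left hY ψ)).add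
    ((hasDerivAt_inner_right (hY.comp_mul (-1)) X).const_mul Complex.I)
  have h7 := h1.unique h6
  rw [zero_smul, weyl_zero, map_one, inner_smul_right, inner_smul_left, inner_smul_left] at h7
  rw [show ((1 : ModeUnitary n) ψ) = ψ from rfl] at h7
  simp only [Complex.conj_I, map_neg, map_one, Complex.ofReal_neg, Complex.ofReal_one,
    Complex.ofReal_zero] at h7
  linear_combination (-1) * h7 + (⟪X, Y⟫_ℂ - ⟪Y, X⟫_ℂ) * Complex.I_mul_I

theorem WeylDeriv.add {n : ℕ} {ψ : Modes n} {ξ η : QIdx n → ℝ} {X Y : Modes n}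
    (hX : WeylDeriv ψ ξ X) (hY : WeylDeriv ψ η Y) : WeylDeriv ψ (ξ + η) (X + Y) := by
  have h1 : HasDerivAt (fun s : ℝ => lift (weyl (s • ξ)) (lift (weyl (s • η)) ψ))
      (Complex.I • X + Complex.I • Y) 0 := by
    have h2 := hasDerivAt_unitary_apply (U := fun s : ℝ => lift (weyl (s • ξ)))
      (y := fun s : ℝ => lift (weyl (s • η)) ψ) (s := 0) (w := Complex.I • X) hY
      (by simpa [weyl_zero, WeylDeriv] using hX) ((isFlow_weyl ξ).continuous _).continuousAt
    simpa [weyl_zero] using h2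
  have h3 : HasDerivAt (fun s : ℝ => Complex.exp (Complex.I * (omega (s • ξ) (s • η) / 2 : ℝ)))
      0 0 := by
    have h4 : HasDerivAt (fun s : ℝ => (Complex.I * omega ξ η / 2) * ((s : ℂ) * (s : ℂ))) 0 0 := by
      have h5 := (Complex.ofRealCLM.hasDerivAt (x := (0 : ℝ)))
      simpa using (h5.mul h5).const_mul (Complex.I * omega ξ η / 2)
    have h6 := h4.cexp
    refine (h6.congr_deriv (by simp)).congr_of_eventuallyEq (Filter.Eventually.of_forall fun t => ?_)
    simp only [omega_smul_smul]
    push_cast; congr 1; ring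
  have h7 := h3.smul h1
  refine (h7.congr_deriv ?_).congr_of_eventuallyEq (Filter.Eventually.of_forall fun s => ?_)
  · simp [omega, smul_add, posPart, momPart]
  · show lift (weyl (s • (ξ + η))) ψ = _
    rw [smul_add, lift_weyl_add_apply]; rfl

theorem weylDeriv_zero {n : ℕ} (ψ : Modes n) : WeylDeriv ψ 0 0 := by
  simpa [WeylDeriv] using hasDerivAt_const (0 : ℝ) (lift (weyl 0) ψ)

theorem WeylDeriv.sum {n : ℕ} {ι : Type*} {ψ : Modes n} {s : Finset ι} {ξ : ι → QIdx n → ℝ}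
    {X : ι → Modes n} (h : ∀ i, WeylDeriv ψ (ξ i) (X i)) :
    WeylDeriv ψ (∑ i ∈ s, ξ i) (∑ i ∈ s, X i) := by
  classical
  induction s using Finset.induction_on with
  | empty => simpa using weylDeriv_zero ψ
  | insert a s ha ih => rw [Finset.sum_insert ha, Finset.sum_insert ha]; exact (h a).add ih

theorem FiniteSecondMoments.weylDeriv_single {n : ℕ} {ψ : Modes n} (hψ : FiniteSecondMoments ψ)
    (k : QIdx n) : WeylDeriv ψ (Pi.single k 1) (quadOp k ⟨ψ, hψ k⟩) := by
  have h1 := isFlow_weyl (-(Pi.single k 1 : QIdx n → ℝ))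
  have h2 : -linOp (-(Pi.single k 1 : QIdx n → ℝ)) = quad k := by
    rw [← linOp_single k, ← neg_one_smul ℝ (Pi.single k 1 : QIdx n → ℝ), linOp_smul]
    simp
  rw [h2] at h1
  have h3 : WeylDeriv ψ (-(Pi.single k 1)) (-quadOp k ⟨ψ, hψ k⟩) := by
    have := h1.hasDerivAt_closedOp ⟨ψ, hψ k⟩
    rw [WeylDeriv, smul_neg, ← neg_smul]
    exact this
  simpa using h3.smul (-1)

theorem FiniteSecondMoments.weylDeriv {n : ℕ} {ψ : Modes n} (hψ : FiniteSecondMoments ψ)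
    (ξ : QIdx n → ℝ) : WeylDeriv ψ ξ (∑ k, (ξ k : ℂ) • quadOp k ⟨ψ, hψ k⟩) := by
  have h1 := WeylDeriv.sum (s := Finset.univ) fun k => (hψ.weylDeriv_single k).smul (ξ k)
  have h2 : ∑ k, ξ k • (Pi.single k 1 : QIdx n → ℝ) = ξ := by
    ext i; simp [Finset.sum_apply, Pi.single_apply]
  rwa [h2] at h1

theorem WeylDeriv.transport {n : ℕ} {W : ModeUnitary n} {χ Y : Modes n} {ξ η : QIdx n → ℝ} {d : ℝ}
    (hW : ∀ s : ℝ, W (lift (weyl (s • ξ)) χ)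
      = Complex.exp (Complex.I * d * s) • lift (weyl (s • η)) (W χ))
    (hY : WeylDeriv (W χ) η Y) : WeylDeriv χ ξ (W⁻¹ (Y + (d : ℂ) • W χ)) := by
  have h1 := (hasDerivAt_exp_mul (Complex.I * d)).smul hY
  have h2 := (W⁻¹.toContinuousLinearEquiv.toContinuousLinearMap.restrictScalars
      ℝ).hasFDerivAt.comp_hasDerivAt (0 : ℝ) h1
  refine (h2.congr_deriv ?_).congr_of_eventuallyEq (Filter.Eventually.of_forall fun s => ?_)
  · show W⁻¹ _ = _
    rw [← map_smul]
    simp [-Complex.coe_smul, weyl_zero, smul_smul, smul_add]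
  · show _ = W⁻¹ _
    refine W.injective ?_
    rw [apply_inv_self']
    exact hW s

/-- Differentiability under the two Weyl groups moves the quadratures from the test function to `χ`,
which turns the weak condition into an equation between vectors. -/
theorem weakAnn_annVec_iff {n : ℕ} {χ X Y : Modes n} {j : Fin n}
    (hX : WeylDeriv χ (Pi.single (j, 0) 1) X) (hY : WeylDeriv χ (Pi.single (j, 1) 1) Y) :
    WeakAnn (annVec j) χ ↔ X + Complex.I • Y = 0 := by
  have h1 : ∀ f, ⟪χ, coreIncl n (quad (j, 0) f - Complex.I • quad (j, 1) f)⟫_ℂ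
      = ⟪X + Complex.I • Y, coreIncl n f⟫_ℂ := by
    intro f
    have h2 := hX.inner_comm (weylDeriv_core f _)
    have h3 := hY.inner_comm (weylDeriv_core f _)
    rw [linOp_single] at h2 h3
    rw [map_sub, map_smul, inner_sub_right, inner_smul_right, inner_add_left, inner_smul_left, h2,
      h3, Complex.conj_I]
    ring
  rw [weakAnn_annVec]
  simp only [h1]
  exact ⟨eq_zero_of_inner_core, fun h f => by rw [h, inner_zero_left]⟩

/-! ### Doped Gaussian states -/

theorem linOp_coh_zero {n : ℕ} (ζ : QIdx n → ℝ) :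
    linOp ζ (coh 0) + Complex.I • linOp (-(Omega n *ᵥ ζ)) (coh 0) = 0 := by
  rw [linOp_apply, linOp_apply, Fintype.sum_prod_type, Fintype.sum_prod_type, Finset.smul_sum,
    ← Finset.sum_add_distrib]
  refine Finset.sum_eq_zero fun j _ => ?_
  have h1 := quad_coh j (0 : EuclideanSpace ℝ (Fin n))
  simp only [PiLp.zero_apply, Complex.ofReal_zero, mul_zero, zero_smul] at h1
  have h2 := congrArg (fun g => ((ζ (j, 0) : ℂ) - Complex.I * (ζ (j, 1) : ℂ)) • g) h1
  simp only [smul_zero] at h2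
  rw [← h2]
  simp only [Fin.sum_univ_two, Pi.neg_apply, Omega_mulVec_zero, Omega_mulVec_one, neg_neg,
    Complex.ofReal_neg]
  match_scalars
  · ring
  · linear_combination (ζ (j, 1) : ℂ) * Complex.I_mul_I

theorem exists_core_vacuum (n : ℕ) : ∃ f : Core n, vacuum n = coreIncl n f ∧
    ∀ ζ, linOp ζ f + Complex.I • linOp (-(Omega n *ᵥ ζ)) f = 0 := by
  refine ⟨((Real.pi ^ (-(n : ℝ) / 4) : ℝ) : ℂ) • coh 0, by rw [vacuum_eq, map_smul], fun ζ => ?_⟩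
  rw [map_smul, map_smul, smul_comm, ← smul_add, linOp_coh_zero, smul_zero]

theorem Omega_mulVec_single {n : ℕ} (j : Fin n) :
    -(Omega n *ᵥ Pi.single (j, 0) 1) = Pi.single (j, 1) 1 := by
  ext ⟨i, a⟩
  fin_cases a
  · refine (congrArg Neg.neg (Omega_mulVec_zero _ i)).trans ?_
    simp
  · refine (congrArg Neg.neg (Omega_mulVec_one _ i)).trans ?_
    simp [Pi.single_apply]

theorem WeylDeriv.map {n : ℕ} {O : Matrix (QIdx n) (QIdx n) ℝ} {P : ModeUnitary n}
    (hP : IsSymplecticUnitary O P) {χ X : Modes n} {η : QIdx n → ℝ}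
    (h : WeylDeriv χ (Oᵀ *ᵥ η) X) : WeylDeriv (P χ) η (P X) := by
  have h2 := (P.toContinuousLinearEquiv.toContinuousLinearMap.restrictScalars
      ℝ).hasFDerivAt.comp_hasDerivAt (0 : ℝ) h
  refine (h2.congr_deriv ?_).congr_of_eventuallyEq (Filter.Eventually.of_forall fun s => ?_)
  · exact map_smul P _ _
  · show lift (weyl (s • η)) (P χ) = P (lift (weyl (s • (Oᵀ *ᵥ η))) χ)
    rw [← Matrix.mulVec_smul, hP.weyl_apply]

/-- An orthogonal symplectic matrix has a transpose commuting with `Ω`, so annihilation operators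
are mixed among themselves, and all of them kill the vacuum. -/
theorem weakVac_passive {n : ℕ} (k : ℕ) {O : Matrix (QIdx n) (QIdx n) ℝ} {P : ModeUnitary n}
    (hO : IsSymplectic O) (hO1 : O * Oᵀ = 1) (hP : IsSymplecticUnitary O P) :
    WeakVac k (P (vacuum n)) := by
  obtain ⟨f, hf, hann⟩ := exists_core_vacuum n
  intro j _
  have hX : ∀ η, WeylDeriv (P (vacuum n)) η (P (coreIncl n (linOp (Oᵀ *ᵥ η) f))) := fun η => by
    rw [hf]; exact (weylDeriv_core f _).map hP
  have hcomm : Omega n * Oᵀ = Oᵀ * Omega n := by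
    have h1 : Oᵀ * O = 1 := mul_eq_one_comm.1 hO1
    calc Omega n * Oᵀ = Oᵀ * O * (Omega n * Oᵀ) := by rw [h1, one_mul]
      _ = Oᵀ * (O * Omega n * Oᵀ) := by simp only [mul_assoc]
      _ = _ := by rw [hO]
  refine (weakAnn_annVec_iff (hX _) (hX _)).2 ?_
  rw [← map_smul, ← map_smul, ← map_add, ← map_add, ← Omega_mulVec_single, Matrix.mulVec_neg,
    Matrix.mulVec_mulVec, ← hcomm, ← Matrix.mulVec_mulVec, hann, map_zero, map_zero]

theorem norm_eq_one_of_tensor {k n : ℕ} (h : k ≤ n) {φ : Modes k}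
    (hφ : ‖tensor h φ (vacuum (n - k))‖ = 1) : ‖φ‖ = 1 := by
  rwa [norm_tensor, norm_vacuum, mul_one] at hφ

theorem IsDopedState.norm {n κ t : ℕ} {ψ : Modes n} (h : IsDopedState κ t ψ) : ‖ψ‖ = 1 := by
  obtain ⟨U, _, rfl⟩ := h
  rw [U.norm_map, norm_vacuum]

theorem IsDopedState.exists_tensor {n κ t : ℕ} (hn : κ * t ≤ n) {ψ : Modes n}
    (h : IsDopedState κ t ψ) : ∃ (G : ModeUnitary n) (φ : Modes (κ * t)),
      IsGaussian G ∧ ‖φ‖ = 1 ∧ ψ = G (tensor hn φ (vacuum (n - κ * t))) := by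
  have hnorm := h.norm
  obtain ⟨U, hU, rfl⟩ := h
  obtain ⟨G, T, e, O, hG, he, hO, hO1, hOe, hT, rfl⟩ := hU.exists_passive hn
  obtain ⟨u, hu⟩ := hT.exists_amplification hn
  obtain ⟨φ, hφ⟩ := (weakVac_passive (κ * t) hO hO1 (hOe.isSymplecticUnitary he)).exists_tensor hn
  have h1 : (G * T * lift e) (vacuum n) = G (tensor hn (u φ) (vacuum (n - κ * t))) := by
    rw [mul_apply', mul_apply', hφ, hu]
  refine ⟨G, u φ, hG, ?_, h1⟩
  rw [h1, G.norm_map] at hnorm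
  exact norm_eq_one_of_tensor hn hnorm

/-! ### The Gram matrix of the centred quadratures -/

section Moments

variable {n : ℕ} {ψ : Modes n} (hψ : FiniteSecondMoments ψ)

/-- The vector `∑ k, ξ_k (R_k - m_k) ψ`. -/
def centredComb (ξ : QIdx n → ℝ) : Modes n := ∑ k, (ξ k : ℂ) • centred ψ hψ k

theorem inner_quadOp (k : QIdx n) : ⟪ψ, quadOp k ⟨ψ, hψ k⟩⟫_ℂ = (firstMoment ψ hψ k : ℂ) := by
  have h1 := (hψ.weylDeriv_single k).inner_comm (hψ.weylDeriv_single k)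
  rw [← inner_conj_symm] at h1
  exact (Complex.conj_eq_iff_re.1 h1).symm

theorem inner_quadOp_left (k : QIdx n) :
    ⟪quadOp k ⟨ψ, hψ k⟩, ψ⟫_ℂ = (firstMoment ψ hψ k : ℂ) := by
  rw [← inner_quadOp hψ]
  exact (hψ.weylDeriv_single k).inner_comm (hψ.weylDeriv_single k)

theorem omega_single (k l : QIdx n) : omega (Pi.single k 1) (Pi.single l 1) = Omega n k l := by
  simp [omega_eq_dotProduct]

/-- The real part is half the covariance by definition, the imaginary part half of `Ω` by the
commutation relation. -/
theorem inner_centred (h1 : ‖ψ‖ = 1) (k l : QIdx n) :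
    ⟪centred ψ hψ k, centred ψ hψ l⟫_ℂ
      = ((covariance ψ hψ k l : ℂ) + Complex.I * (Omega n k l : ℂ)) / 2 := by
  have hn : ⟪ψ, ψ⟫_ℂ = 1 := by rw [inner_self_eq_norm_sq_to_K, h1]; simp
  have h2 : ⟪centred ψ hψ k, centred ψ hψ l⟫_ℂ - ⟪centred ψ hψ l, centred ψ hψ k⟫_ℂ
      = Complex.I * (Omega n k l : ℂ) := by
    have h3 := (hψ.weylDeriv_single k).commutation (hψ.weylDeriv_single l)
    rw [omega_single, hn, mul_one] at h3
    rw [← h3]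
    simp only [centred, inner_sub_left, inner_sub_right, inner_smul_left, inner_smul_right,
      inner_quadOp, inner_quadOp_left, hn, Complex.conj_ofReal]
    ring
  have h4 : (covariance ψ hψ k l : ℂ)
      = ⟪centred ψ hψ k, centred ψ hψ l⟫_ℂ + ⟪centred ψ hψ l, centred ψ hψ k⟫_ℂ := by
    refine (Complex.conj_eq_iff_re
      (z := ⟪centred ψ hψ k, centred ψ hψ l⟫_ℂ + ⟪centred ψ hψ l, centred ψ hψ k⟫_ℂ)).1 ?_
    rw [map_add, inner_conj_symm, inner_conj_symm, add_comm]
  rw [h4, ← h2]; ring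

theorem inner_centredComb (h1 : ‖ψ‖ = 1) (ξ η : QIdx n → ℝ) :
    ⟪centredComb hψ ξ, centredComb hψ η⟫_ℂ
      = ((ξ ⬝ᵥ (covariance ψ hψ *ᵥ η) : ℝ) + Complex.I * (omega ξ η : ℝ)) / 2 := by
  simp only [centredComb, sum_inner, inner_sum, inner_smul_left, inner_smul_right,
    inner_centred hψ h1, omega_eq_dotProduct, dotProduct, Matrix.mulVec, Complex.conj_ofReal]
  push_cast
  simp only [Finset.mul_sum, ← Finset.sum_add_distrib, Finset.sum_div]
  rw [Finset.sum_comm]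
  refine Finset.sum_congr rfl fun k _ => Finset.sum_congr rfl fun l _ => ?_
  ring

theorem centredComb_eq (ξ : QIdx n → ℝ) :
    centredComb hψ ξ = ∑ k, (ξ k : ℂ) • quadOp k ⟨ψ, hψ k⟩
      - ((firstMoment ψ hψ ⬝ᵥ ξ : ℝ) : ℂ) • ψ := by
  simp only [centredComb, centred, smul_sub, Finset.sum_sub_distrib, smul_smul, dotProduct,
    Complex.ofReal_sum, Complex.ofReal_mul, Finset.sum_smul, mul_comm]

theorem inner_centredComb_right (h1 : ‖ψ‖ = 1) (ξ : QIdx n → ℝ) :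
    ⟪ψ, centredComb hψ ξ⟫_ℂ = 0 := by
  have hn : ⟪ψ, ψ⟫_ℂ = 1 := by rw [inner_self_eq_norm_sq_to_K, h1]; simp
  rw [centredComb, inner_sum]
  refine Finset.sum_eq_zero fun k _ => ?_
  rw [inner_smul_right, centred, inner_sub_right, inner_quadOp, inner_smul_right, hn]
  simp

theorem covariance_isSymm : (covariance ψ hψ).IsSymm := by
  ext k l
  simp [covariance, add_comm]

/-- A null vector of the covariance would give a vanishing centred combination; the imaginary part
of its pairings is the symplectic form, which is nondegenerate. -/
theorem posDef_covariance (h1 : ‖ψ‖ = 1) : (covariance ψ hψ).PosDef := by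
  refine Matrix.PosDef.of_dotProduct_mulVec_pos ?_ fun ξ hξ => ?_
  · ext k l
    simp [covariance, add_comm]
  · have h2 : ((‖centredComb hψ ξ‖ ^ 2 : ℝ) : ℂ)
        = ((ξ ⬝ᵥ (covariance ψ hψ *ᵥ ξ) / 2 : ℝ) : ℂ) := by
      have := inner_centredComb hψ h1 ξ ξ
      rw [inner_self_eq_norm_sq_to_K, omega_self] at this
      push_cast at this ⊢
      simpa using this
    have h3 := Complex.ofReal_injective h2
    rw [star_trivial]
    have h4 : 0 < ‖centredComb hψ ξ‖ ^ 2 := by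
      refine pow_pos (norm_pos_iff.2 fun h0 => hξ ?_) 2
      have h5 : ∀ η, omega ξ η = 0 := by
        intro η
        have h6 := inner_centredComb hψ h1 ξ η
        rw [h0, inner_zero_left] at h6
        have h7 := congrArg Complex.im h6
        simpa using h7.symm
      have h8 := h5 (-(Omega n *ᵥ ξ))
      rw [omega_eq_dotProduct, Matrix.mulVec_neg, Omega_mulVec_mulVec, neg_neg] at h8
      exact dotProduct_self_eq_zero.1 h8
    linarith

/-- The uncertainty relation with its defect. On the pair dual to mode `j` of a Williamson
decomposition it equals `d_j - 1`, giving both the bound on `d_j` and annihilation in case of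
equality. -/
theorem inner_annihilation (h1 : ‖ψ‖ = 1) (ξ η : QIdx n → ℝ) :
    ⟪centredComb hψ ξ + Complex.I • centredComb hψ η,
      centredComb hψ ξ + Complex.I • centredComb hψ η⟫_ℂ
      = (((ξ ⬝ᵥ (covariance ψ hψ *ᵥ ξ) + η ⬝ᵥ (covariance ψ hψ *ᵥ η)) / 2 - omega ξ η : ℝ) : ℂ) := by
  have h2 : η ⬝ᵥ (covariance ψ hψ *ᵥ ξ) = ξ ⬝ᵥ (covariance ψ hψ *ᵥ η) := by
    rw [dotProduct_comm, symm_dotProduct (covariance_isSymm hψ)]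
  have h3 : omega η ξ = -omega ξ η := by
    rw [omega, omega, real_inner_comm, real_inner_comm (posPart ξ) (momPart η)]; ring
  simp only [inner_add_left, inner_add_right, inner_smul_left, inner_smul_right,
    inner_centredComb hψ h1, h2, h3, omega_self, Complex.conj_I]
  push_cast
  linear_combination (omega ξ η - (η ⬝ᵥ (covariance ψ hψ *ᵥ η) : ℝ) / 2 : ℂ) * Complex.I_mul_I

end Moments

/-! ### The Williamson decomposition of the covariance matrix -/

section Moments

variable {n : ℕ} {ψ : Modes n} (hψ : FiniteSecondMoments ψ)

/-- The symplectic map of `G` carries the annihilation operators of `χ` to linear forms killing `ψ`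
up to a scalar. -/
theorem exists_annihilating (h1 : ‖ψ‖ = 1) {k : ℕ} {G : ModeUnitary n} (hG : IsGaussian G)
    {χ : Modes n} (hχ : WeakVac k χ) (he : ψ = G χ) :
    ∃ u : QIdx n → QIdx n → ℝ, (∀ p q, omega (u p) (u q) = Omega n p q) ∧
      ∀ j : Fin n, k ≤ (j : ℕ) →
        centredComb hψ (u (j, 0)) + Complex.I • centredComb hψ (u (j, 1)) = 0 := by
  obtain ⟨A, d, hA, hd⟩ := hG.exists_normalizesWeyl
  refine ⟨fun p => A (Pi.single p 1), fun p q => by rw [hA, omega_single], fun j hj => ?_⟩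
  have hX : ∀ ξ, WeylDeriv χ ξ (G⁻¹ ((∑ k, ((A ξ) k : ℂ) • quadOp k ⟨ψ, hψ k⟩) +
      (d ξ : ℂ) • ψ)) := by
    intro ξ
    have h2 := hψ.weylDeriv (A ξ)
    have h3 : WeylDeriv (G χ) (A ξ) (∑ k, ((A ξ) k : ℂ) • quadOp k ⟨ψ, hψ k⟩) := he ▸ h2
    have h4 := WeylDeriv.transport (W := G) (χ := χ) (ξ := ξ) (d := d ξ) (fun s => by
      rw [hd, map_smul, map_smul]
      congr 2
      simp only [smul_eq_mul]; push_cast; ring) h3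
    rwa [← he] at h4
  have h5 := (weakAnn_annVec_iff (hX _) (hX _)).1 (hχ j hj)
  rw [← map_smul, ← map_add] at h5
  have h6 := (map_eq_zero_iff (G⁻¹) (G⁻¹).injective).1 h5
  set ξ := A (Pi.single (j, 0) 1)
  set η := A (Pi.single (j, 1) 1)
  -- The scalar left by the means and by the phases of `G`. It vanishes because centred vectors are
  -- orthogonal to `ψ`.
  set z : ℂ := ((firstMoment ψ hψ ⬝ᵥ ξ : ℝ) + d (Pi.single (j, 0) 1))
    + Complex.I * ((firstMoment ψ hψ ⬝ᵥ η : ℝ) + d (Pi.single (j, 1) 1)) with hz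
  have h7 : centredComb hψ ξ + Complex.I • centredComb hψ η + z • ψ = 0 := by
    rw [← h6, centredComb_eq, centredComb_eq, hz]
    module
  have h8 : z = 0 := by
    have h9 := congrArg (fun v => ⟪ψ, v⟫_ℂ) h7
    simpa [inner_add_right, inner_smul_right, inner_centredComb_right hψ h1,
      inner_self_eq_norm_sq_to_K, h1] using h9
  rwa [h8, zero_smul, add_zero] at h7

theorem covariance_mulVec_of_annihilating (h1 : ‖ψ‖ = 1) {ξ η : QIdx n → ℝ}
    (h : centredComb hψ ξ + Complex.I • centredComb hψ η = 0) :
    covariance ψ hψ *ᵥ ξ = Omega n *ᵥ η ∧ covariance ψ hψ *ᵥ η = -(Omega n *ᵥ ξ) := by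
  have h2 : ∀ ζ : QIdx n → ℝ, ζ ⬝ᵥ (covariance ψ hψ *ᵥ ξ) = ζ ⬝ᵥ (Omega n *ᵥ η) ∧
      ζ ⬝ᵥ (covariance ψ hψ *ᵥ η) = ζ ⬝ᵥ (-(Omega n *ᵥ ξ)) := by
    intro ζ
    have h3 := congrArg (fun v => ⟪centredComb hψ ζ, v⟫_ℂ) h
    simp only [inner_add_right, inner_smul_right, inner_centredComb hψ h1, inner_zero_right,
      omega_eq_dotProduct] at h3
    have hre := congrArg Complex.re h3
    have him := congrArg Complex.im h3
    simp at hre him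
    rw [dotProduct_neg]
    constructor <;> linarith
  exact ⟨dotProduct_eq _ _ fun ζ => by rw [dotProduct_comm, (h2 ζ).1, dotProduct_comm],
    dotProduct_eq _ _ fun ζ => by rw [dotProduct_comm, (h2 ζ).2, dotProduct_comm]⟩

theorem omega_transpose_mulVec {S : Matrix (QIdx n) (QIdx n) ℝ} (hS : IsSymplectic S)
    (ξ η : QIdx n → ℝ) : omega (Sᵀ *ᵥ ξ) (Sᵀ *ᵥ η) = omega ξ η := by
  rw [omega_eq_dotProduct, omega_eq_dotProduct, dotProduct_comm, Matrix.dotProduct_mulVec,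
    Matrix.vecMul_transpose, Matrix.mulVec_mulVec, Matrix.mulVec_mulVec, hS,
    dotProduct_comm]

/-- The columns of the inverse `-Ω S Ω` of `Sᵀ`: against these vectors the covariance `S D Sᵀ` shows
its diagonal entries. -/
theorem IsSymplectic.exists_dual {S : Matrix (QIdx n) (QIdx n) ℝ} (hS : IsSymplectic S) :
    ∃ w : QIdx n → QIdx n → ℝ, (∀ p, Sᵀ *ᵥ w p = Pi.single p 1) ∧
      ∀ p q, omega (w p) (w q) = Omega n p q := by
  have h1 : Omega n * Omega n = -1 := by
    refine Matrix.toLin'.injective (LinearMap.ext fun ξ => ?_)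
    rw [Matrix.toLin'_apply, Matrix.toLin'_apply, ← Matrix.mulVec_mulVec, Omega_mulVec_mulVec,
      Matrix.neg_mulVec, Matrix.one_mulVec]
  have h2 : Sᵀ * (-(Omega n * S * Omega n)) = 1 := by
    refine mul_eq_one_comm.1 ?_
    rw [neg_mul, mul_assoc, mul_assoc, ← mul_assoc S, hS, h1, neg_neg]
  have h3 : ∀ p, Sᵀ *ᵥ (-(Omega n * S * Omega n) *ᵥ Pi.single p 1) = Pi.single p 1 := fun p => by
    rw [Matrix.mulVec_mulVec, h2, Matrix.one_mulVec]
  exact ⟨_, h3, fun p q => by rw [← omega_transpose_mulVec hS, h3, h3, omega_single]⟩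

theorem dual_dotProduct {S : Matrix (QIdx n) (QIdx n) ℝ} {d : QIdx n → ℝ}
    {w : QIdx n → QIdx n → ℝ} (hw : ∀ p, Sᵀ *ᵥ w p = Pi.single p 1) (p : QIdx n) :
    w p ⬝ᵥ ((S * Matrix.diagonal d * Sᵀ) *ᵥ w p) = d p := by
  rw [← Matrix.mulVec_mulVec, ← Matrix.mulVec_mulVec, hw, Matrix.dotProduct_mulVec,
    ← Matrix.mulVec_transpose, hw]
  simp

theorem Omega_zero_one (j : Fin n) : Omega n (j, 0) (j, 1) = 1 := by
  simp [Omega]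

theorem exists_covariance_williamson (h1 : ‖ψ‖ = 1) {k : ℕ} (hk : k ≤ n) {G : ModeUnitary n}
    (hG : IsGaussian G) {χ : Modes n} (hχ : WeakVac k χ) (he : ψ = G χ) :
    ∃ (S : Matrix (QIdx n) (QIdx n) ℝ) (d : Fin n → ℝ),
      IsSymplectic S ∧ (∀ j, 1 ≤ d j) ∧ (∀ j : Fin n, k ≤ (j : ℕ) → d j = 1) ∧
      covariance ψ hψ = S * Matrix.diagonal (fun k : QIdx n => d k.1) * Sᵀ := by
  obtain ⟨u, hu, hann⟩ := exists_annihilating hψ h1 hG hχ he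
  obtain ⟨S, d, hS, _, hd, hV⟩ := exists_williamson hk (posDef_covariance hψ h1)
    (fun j hj => (covariance_mulVec_of_annihilating hψ h1 (hann j hj)).1)
    (fun j hj => (covariance_mulVec_of_annihilating hψ h1 (hann j hj)).2) (fun p q _ _ => hu p q)
  refine ⟨S, d, hS, fun j => ?_, hd, hV⟩
  obtain ⟨w, hw, hw'⟩ := hS.exists_dual
  have h2 := inner_annihilation hψ h1 (w (j, 0)) (w (j, 1))
  rw [hV, dual_dotProduct hw, dual_dotProduct hw, hw', Omega_zero_one,
    inner_self_eq_norm_sq_to_K] at h2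
  dsimp only at h2
  have h3 : ‖centredComb hψ (w (j, 0)) + Complex.I • centredComb hψ (w (j, 1))‖ ^ 2
      = (d j + d j) / 2 - 1 := by
    refine Complex.ofReal_injective ?_
    push_cast at h2 ⊢
    simpa using h2
  nlinarith [sq_nonneg ‖centredComb hψ (w (j, 0)) + Complex.I • centredComb hψ (w (j, 1))‖]

theorem displacement_mul_symplectic_apply {S : Matrix (QIdx n) (QIdx n) ℝ} {US : ModeUnitary n}
    (hUS : IsSymplecticUnitary S US) (m η : QIdx n → ℝ) (χ : Modes n) (s : ℝ) :
    (lift (weyl (Omega n *ᵥ m)) * US) (lift (weyl (s • (Sᵀ *ᵥ η))) χ)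
      = Complex.exp (Complex.I * ((-(m ⬝ᵥ η) : ℝ) : ℂ) * s) •
        lift (weyl (s • η)) ((lift (weyl (Omega n *ᵥ m)) * US) χ) := by
  rw [mul_apply', mul_apply', ← Matrix.mulVec_smul, hUS.weyl_apply, weyl_comm,
    omega_eq_dotProduct, Omega_dotProduct, Omega_mulVec_mulVec, dotProduct_neg, neg_neg,
    dotProduct_smul]
  congr 2
  simp only [smul_eq_mul]; push_cast; ring

/-- Entries `1` make the squared norm in `inner_annihilation` vanish, so the centred dual pairs of
the last modes annihilate `ψ`. Pulled back by `U_S` they are the operators `x_j + i p_j`, and the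
displacement accounts exactly for the centring. -/
theorem weakVac_of_williamson (h1 : ‖ψ‖ = 1) {k : ℕ} {S : Matrix (QIdx n) (QIdx n) ℝ}
    {d : QIdx n → ℝ} (hS : IsSymplectic S) (hd : ∀ l : QIdx n, k ≤ (l.1 : ℕ) → d l = 1)
    (hV : covariance ψ hψ = S * Matrix.diagonal d * Sᵀ) {US : ModeUnitary n}
    (hUS : IsSymplecticUnitary S US) :
    WeakVac k ((lift (weyl (Omega n *ᵥ firstMoment ψ hψ)) * US)⁻¹ ψ) := by
  intro j hj
  obtain ⟨w, hw, hw'⟩ := hS.exists_dual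
  set W := lift (weyl (Omega n *ᵥ firstMoment ψ hψ)) * US with hW
  have hX : ∀ p, WeylDeriv (W⁻¹ ψ) (Pi.single p 1) (W⁻¹ (centredComb hψ (w p))) := by
    intro p
    have h2 : WeylDeriv (W (W⁻¹ ψ)) (w p) (∑ l, (w p l : ℂ) • quadOp l ⟨ψ, hψ l⟩) := by
      rw [apply_inv_self']; exact hψ.weylDeriv _
    have h3 := h2.transport (displacement_mul_symplectic_apply hUS (firstMoment ψ hψ) (w p) (W⁻¹ ψ))
    rw [hw, ← hW, apply_inv_self'] at h3
    rwa [centredComb_eq, sub_eq_add_neg, ← neg_smul, ← Complex.ofReal_neg]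
  refine (weakAnn_annVec_iff (hX _) (hX _)).2 ?_
  have h4 := inner_annihilation hψ h1 (w (j, 0)) (w (j, 1))
  rw [hV, dual_dotProduct hw, dual_dotProduct hw, hw', Omega_zero_one, hd _ hj, hd _ hj] at h4
  norm_num at h4
  rw [← map_smul, ← map_add, h4, map_zero]

end Moments

end Bosonic

end

theorem mainTheorem8 (n κ t : ℕ) (hn : κ * t ≤ n) :
    (∀ U : ModeUnitary n, IsDoped κ t U →
      ∃ (G T Gpassive : ModeUnitary n) (u : ModeUnitary (κ * t)),
        IsGaussian G ∧ IsPassive Gpassive ∧ IsAmplification hn u T ∧ U = G * T * Gpassive) ∧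
    (∀ ψ : Modes n, IsDopedState κ t ψ →
      (∃ (G : ModeUnitary n) (φ : Modes (κ * t)),
        IsGaussian G ∧ ‖φ‖ = 1 ∧ ψ = G (tensor hn φ (vacuum (n - κ * t)))) ∧
      ∀ hψ : FiniteSecondMoments ψ,
        (∃ (S : Matrix (QIdx n) (QIdx n) ℝ) (d : Fin n → ℝ),
          IsSymplectic S ∧ (∀ j, 1 ≤ d j) ∧ (∀ j : Fin n, κ * t ≤ (j : ℕ) → d j = 1) ∧
          covariance ψ hψ = S * Matrix.diagonal (fun k : QIdx n => d k.1) * Sᵀ) ∧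
        (∀ (S : Matrix (QIdx n) (QIdx n) ℝ) (d : QIdx n → ℝ),
          IsSymplectic S → (∀ k : QIdx n, κ * t ≤ (k.1 : ℕ) → d k = 1) →
          covariance ψ hψ = S * Matrix.diagonal d * Sᵀ →
          (∃ US : ModeUnitary n, IsSymplecticUnitary S US) ∧
          ∃ D : ModeUnitary n, IsDisplacement (firstMoment ψ hψ) D ∧
            ∀ US : ModeUnitary n, IsSymplecticUnitary S US →
              IsGaussian (D * US) ∧
              ∃ φ : Modes (κ * t), ‖φ‖ = 1 ∧
                ψ = (D * US) (tensor hn φ (vacuum (n - κ * t))))) := by 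
  refine ⟨fun U hU => hU.exists_decomposition hn, fun ψ hψ => ⟨hψ.exists_tensor hn, fun hm => ?_⟩⟩
  have h1 := hψ.norm
  obtain ⟨G, φ, hG, _, he⟩ := hψ.exists_tensor hn
  -- The identity commutes with every Weyl operator, so it serves as the operator acting on the
  -- first modes.
  have hχ : WeakVac (κ * t) (tensor hn φ (vacuum (n - κ * t))) :=
    CommutesLast.weakVac_tensor hn (T := 1) (fun _ _ _ => rfl) φ
  refine ⟨exists_covariance_williamson hm h1 hn hG hχ he, fun S d hS hd hV => ?_⟩
  obtain ⟨e, heG, hSe⟩ := exists_intertwines hS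
  refine ⟨⟨lift e, hSe.isSymplecticUnitary heG⟩, _, isDisplacement_weyl _, fun US hUS =>
    ⟨Submonoid.mul_mem _ (lift_weyl_mem _).1 hUS.1, ?_⟩⟩
  obtain ⟨φ', hφ'⟩ := (weakVac_of_williamson hm h1 hS hd hV hUS).exists_tensor hn
  refine ⟨φ', ?_, ?_⟩
  · refine norm_eq_one_of_tensor hn ?_
    rw [← hφ', LinearIsometryEquiv.norm_map, h1]
  · rw [← hφ', apply_inv_self']
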